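/- **Notation.** For $n\ge 0$ let $K_n$ be the group of all $p=(p_1,\dots,p_n)$, $p_j=(r_j,s_j)\in(\mathbb R/2\pi\mathbb Z)^2$, with $\sum_j p_j=0$ (mod $2\pi$), and let $\mu_n=\frac1{n!}\,\delta\big(\sum_j p_j\big)\prod_j dp_j$ on $K_n$, where $dp$ is normalised to total mass one (so $n!\,\mu_n$ is the Haar probability measure of $K_n$). Let $\mathcal H_n$ be the Hilbert space of symmetric functions in $L^2(K_n,\mu_n)$. Put $$\omega(\theta)=2-e^{i\theta}-e^{-i\theta},\qquad \omega(\mathbf r_n)=\sum_{j=1}^n\omega(r_j),\qquad \boldsymbol\omega(p)=\sum_{j=1}^n\big(\omega(r_j)+\omega(s_j)\big).$$ Let $-S_n$ be multiplication by $\boldsymbol\omega(p)$ on $\mathcal H_n$, and let $A_+:\mathcal H_n\to\mathcal H_{n+1}$ be the bounded operator $$(A_+F)(p_1,\dots,p_{n+1})=-\frac12\sum_{j\ne m}\big(e^{ir_j}-e^{-ir_m}\big)\,F(p_1,\dots,p_j+p_m,\dots,\widehat{p_m},\dots,p_{n+1}),$$ the sum being over ordered pairs of distinct indices in $\{1,\dots,n+1\}$;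 $A_+^*:\mathcal H_{n+1}\to\mathcal H_n$ is its adjoint. For $\lambda>0$ write $|\log\log\lambda|=\big|\log|\log\lambda|\big|$. For $\kappa\ge0$ and $\tau>0$ let $U^n_{\kappa,\tau}$ and $V^n_{\kappa,\tau}$ be the operators on $\mathcal H_n$ of multiplication by the functions that are both equal to $$\omega(\mathbf r_n)\,\big|\log(\lambda+\boldsymbol\omega(p))\big|^{\kappa}\qquad\text{where }\boldsymbol\omega(p)\le|\log\lambda|^{-2\tau},$$ and where $\boldsymbol\omega(p)>|\log\lambda|^{-2\tau}$ are equal to $$\omega(\mathbf r_n)\max\big(1,|\log(\lambda+\boldsymbol\omega(p))|\big)\ \text{ for }U^n_{\kappa,\tau},\qquad -|\log\log\lambda|^{2}\,\omega(\mathbf r_n)\ \text{ for }V^n_{\kappa,\tau}.$$ **Theorem.** For every $\tau>1$ there are constants $C>0$ and $\lambda_0>0$ such that the following holds for all $0<\lambda<\lambda_0$, all $0\le\kappa\le1$, all integers $n\ge1$ with $n^{10}\le|\log\log\lambda|^{1/2}$, all $0<\gamma\le|\log\log\lambda|^{-3}$ and all (possibly unbounded) self-adjoint operators $\Omega_{n+1}$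 on $\mathcal H_{n+1}$, where inequalities between operators are inequalities between quadratic forms (on the domain of $\Omega_{n+1}$ if this operator is involved). 1. If $\Omega_{n+1}\ge\gamma V^{n+1}_{\kappa,2\tau}$, then $\lambda-S_{n+1}+\Omega_{n+1}$ has a bounded inverse and $$A_+^*\,(\lambda-S_{n+1}+\Omega_{n+1})^{-1}A_+\ \le\ \gamma^{-1}|\log\log\lambda|^2\,U^n_{1-\kappa/2,\tau}.$$ 2. If $\Omega_{n+1}\le\gamma^{-1}U^{n+1}_{\kappa,\tau}$, and $\lambda-S_{n+1}+\Omega_{n+1}$ is positive with a bounded inverse, then $$A_+^*\,(\lambda-S_{n+1}+\Omega_{n+1})^{-1}A_+\ \ge\ C\gamma\,V^n_{1-\kappa/2,2\tau}.$$ -/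

import Mathlib

open MeasureTheory
open scoped ENNReal InnerProductSpace

namespace ASEP

noncomputable section

/-! ### Momentum space -/

instance factTwoPiPos : Fact (0 < 2 * Real.pi) := ⟨Real.two_pi_pos⟩

/-- `ℝ / 2πℤ`. -/
abbrev Angle : Type := AddCircle (2 * Real.pi)

/-- A momentum `p = (r, s)`, defined modulo `2π` in each component. -/
abbrev Momentum : Type := Angle × Angle

instance secondCountableAngle : SecondCountableTopology Angle :=
  (QuotientAddGroup.isQuotientMap_mk (N := AddSubgroup.zmultiples (2 * Real.pi))).secondCountableTopology
    QuotientAddGroup.isOpenMap_coe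

/-- The momenta `(p_1, …, p_n)` with `p_1 + ⋯ + p_n = 0` modulo `2π`, as a closed subgroup of the
torus. -/
def shell (n : ℕ) : AddSubgroup (Fin n → Momentum) where
  carrier := {p | ∑ j, p j = 0}
  zero_mem' := by simp
  add_mem' := by
    intro a b ha hb
    simp only [Set.mem_ofPred_eq] at *
    simp [Finset.sum_add_distrib, ha, hb]
  neg_mem' := by
    intro a ha
    simp only [Set.mem_ofPred_eq] at *
    simp [ha]

theorem mem_shell {n : ℕ} {p : Fin n → Momentum} : p ∈ shell n ↔ ∑ j, p j = 0 := Iff.rfl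

theorem isClosed_shell (n : ℕ) : IsClosed (shell n : Set (Fin n → Momentum)) := by
  have h : Continuous fun p : Fin n → Momentum => ∑ j, p j := by fun_prop
  exact isClosed_singleton.preimage h

instance compactSpaceShell (n : ℕ) : CompactSpace (shell n) :=
  isCompact_iff_compactSpace.mp (isClosed_shell n).isCompact

/-- The measure `(1 / n!) δ(p_1 + ⋯ + p_n) dp_1 ⋯ dp_n`, where `dp` is normalised to have total
mass one on the torus: up to the factor `1 / n!`, the Haar probability measure of the subgroup
`p_1 + ⋯ + p_n = 0`. -/
def mu (n : ℕ) : Measure (shell n) :=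
  ((n.factorial : ℝ≥0∞)⁻¹) • Measure.addHaarMeasure ⊤

theorem continuous_coord {n : ℕ} (j : Fin n) : Continuous fun p : shell n => p.1 j :=
  (continuous_apply j).comp continuous_subtype_val

/-- Permutation of the momenta. -/
def permute {n : ℕ} (σ : Equiv.Perm (Fin n)) : shell n →+ shell n where
  toFun p := ⟨fun j => p.1 (σ j), by
    have h := mem_shell.mp p.2
    rw [mem_shell, Equiv.sum_comp σ p.1, h]⟩
  map_zero' := by ext <;> simp
  map_add' p q := by ext <;> simp

/-- Merging of momenta. For `p = (p_1, …, p_{n+1})` the momentum `p_m` is deleted from the list and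
is added to the entry number `k` of the remaining list, that is to `p_j` with
`j = m.succAbove k`. As `k` varies, `j` runs over all the indices different from `m`. -/
def merge {n : ℕ} (m : Fin (n + 1)) (k : Fin n) : shell (n + 1) →+ shell n where
  toFun p := ⟨fun i => p.1 (m.succAbove i) + (if i = k then p.1 m else 0), by
    have h := mem_shell.mp p.2
    rw [Fin.sum_univ_succAbove _ m] at h
    rw [mem_shell, Finset.sum_add_distrib]
    simp only [Finset.sum_ite_eq', Finset.mem_univ, if_true]
    rw [add_comm, h]⟩
  map_zero' := by ext <;> simp
  map_add' p q := by
    apply Subtype.ext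
    funext i
    by_cases h : i = k
    · simp only [h, if_true, AddSubgroup.coe_add, Pi.add_apply]
      abel
    · simp [h]

theorem continuous_permute {n : ℕ} (σ : Equiv.Perm (Fin n)) : Continuous (permute σ) := by
  exact Continuous.subtype_mk
    (continuous_pi fun j => continuous_coord (σ j)) _

theorem continuous_merge {n : ℕ} (m : Fin (n + 1)) (k : Fin n) : Continuous (merge m k) := by
  apply Continuous.subtype_mk
  refine continuous_pi fun i => ?_
  split_ifs
  · exact (continuous_coord _).add (continuous_coord _)
  · exact (continuous_coord _).add continuous_const

theorem permute_surjective {n : ℕ} (σ : Equiv.Perm (Fin n)) : Function.Surjective (permute σ) := by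
  intro q
  refine ⟨permute σ⁻¹ q, ?_⟩
  apply Subtype.ext
  funext j
  simp [permute]

theorem merge_surjective {n : ℕ} (m : Fin (n + 1)) (k : Fin n) :
    Function.Surjective (merge m k) := by
  intro q
  refine ⟨⟨m.insertNth (α := fun _ => Momentum) 0 q.1, ?_⟩, ?_⟩
  · have h := mem_shell.mp q.2
    rw [mem_shell, Fin.sum_univ_succAbove _ m]
    simpa using h
  · apply Subtype.ext
    funext i
    simp [merge]

theorem measurePreserving_permute {n : ℕ} (σ : Equiv.Perm (Fin n)) :
    MeasurePreserving (permute σ) (mu n) (mu n) := by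
  have h : MeasurePreserving (permute σ) (Measure.addHaarMeasure ⊤) (Measure.addHaarMeasure ⊤) :=
    (permute σ).measurePreserving (continuous_permute σ) (permute_surjective σ) (by simp)
  exact h.smul_measure _

theorem map_merge_le {n : ℕ} (m : Fin (n + 1)) (k : Fin n) :
    (mu (n + 1)).map (merge m k) ≤ mu n := by
  have h : MeasurePreserving (merge m k) (Measure.addHaarMeasure ⊤) (Measure.addHaarMeasure ⊤) :=
    (merge m k).measurePreserving (continuous_merge m k) (merge_surjective m k) (by
      have h1 := Measure.addHaarMeasure_self
        (K₀ := (⊤ : TopologicalSpace.PositiveCompacts (shell n)))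
      have h2 := Measure.addHaarMeasure_self
        (K₀ := (⊤ : TopologicalSpace.PositiveCompacts (shell (n + 1))))
      simp only [TopologicalSpace.PositiveCompacts.coe_top] at h1 h2
      rw [h1, h2])
  rw [mu, mu, Measure.map_smul, h.map_eq]
  refine Measure.le_iff.mpr fun s _ => ?_
  simp only [Measure.smul_apply, smul_eq_mul]
  gcongr
  simp

/-! ### The Hilbert space of symmetric functions -/

/-- Composition with a permutation of the momenta. -/
def permuteOp {n : ℕ} (σ : Equiv.Perm (Fin n)) : Lp ℂ 2 (mu n) →ₗᵢ[ℂ] Lp ℂ 2 (mu n) :=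
  Lp.compMeasurePreservingₗᵢ ℂ (permute σ) (measurePreserving_permute σ)

/-- The square integrable symmetric functions of `n` momenta with sum zero. -/
def SymL2 (n : ℕ) : Submodule ℂ (Lp ℂ 2 (mu n)) where
  carrier := {F | ∀ σ, permuteOp σ F = F}
  zero_mem' := by simp
  add_mem' := by
    intro a b ha hb σ
    rw [map_add, ha σ, hb σ]
  smul_mem' := by
    intro c a ha σ
    rw [map_smul, ha σ]

theorem mem_symL2_iff {n : ℕ} {F : Lp ℂ 2 (mu n)} :
    F ∈ SymL2 n ↔ ∀ σ, ∀ᵐ p ∂mu n, F (permute σ p) = F p := by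
  refine forall_congr' fun σ => ?_
  rw [Lp.ext_iff]
  have h : permuteOp σ F =ᵐ[mu n] F ∘ permute σ :=
    Lp.coeFn_compMeasurePreserving F (measurePreserving_permute σ)
  exact ⟨fun h' => h.symm.trans h', fun h' => h.trans h'⟩

theorem isClosed_symL2 (n : ℕ) : IsClosed (SymL2 n : Set (Lp ℂ 2 (mu n))) := by
  have h : (SymL2 n : Set (Lp ℂ 2 (mu n))) = ⋂ σ, {F | permuteOp σ F = F} := by
    ext F
    simp only [Set.mem_iInter]
    exact Iff.rfl
  rw [h]
  exact isClosed_iInter fun σ => isClosed_eq (permuteOp σ).continuous continuous_id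

instance completeSpaceSymL2 (n : ℕ) : CompleteSpace (SymL2 n) :=
  (isClosed_symL2 n).completeSpace_coe

/-! ### Fourier multipliers -/

/-- The functions that define bounded multiplication operators on `SymL2 n`: measurable, bounded,
symmetric. -/
structure IsSymbol {n : ℕ} (φ : shell n → ℝ) : Prop where
  measurable : Measurable φ
  bounded : ∃ C, ∀ p, |φ p| ≤ C
  symmetric : ∀ σ p, φ (permute σ p) = φ p

theorem memLp_mul {n : ℕ} {φ : shell n → ℂ} (hφ : Measurable φ) (hb : ∃ C, ∀ p, ‖φ p‖ ≤ C)
    (F : Lp ℂ 2 (mu n)) : MemLp (fun p => φ p * F p) 2 (mu n) :=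
  (Lp.memLp F).of_le_mul (hφ.aestronglyMeasurable.mul (Lp.aestronglyMeasurable F))
    (Filter.Eventually.of_forall fun p => by
      rw [norm_mul]
      exact mul_le_mul_of_nonneg_right (hb.choose_spec p) (norm_nonneg _))

/-- Multiplication by a bounded measurable function on `L²`. -/
def mulLp {n : ℕ} (φ : shell n → ℂ) (hφ : Measurable φ) (hb : ∃ C, ∀ p, ‖φ p‖ ≤ C) :
    Lp ℂ 2 (mu n) →L[ℂ] Lp ℂ 2 (mu n) :=
  have hmem := memLp_mul hφ hb
  LinearMap.mkContinuous
    { toFun := fun F => (hmem F).toLp _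
      map_add' := by
        intro F G
        apply Lp.ext
        filter_upwards [(hmem (F + G)).coeFn_toLp, (hmem F).coeFn_toLp, (hmem G).coeFn_toLp,
          Lp.coeFn_add F G, Lp.coeFn_add ((hmem F).toLp _) ((hmem G).toLp _)]
          with p h1 h2 h3 h4 h5
        rw [h1, h5, Pi.add_apply, h2, h3, h4, Pi.add_apply, mul_add]
      map_smul' := by
        intro c F
        apply Lp.ext
        filter_upwards [(hmem (c • F)).coeFn_toLp, (hmem F).coeFn_toLp,
          Lp.coeFn_smul c F, Lp.coeFn_smul c ((hmem F).toLp _)] with p h1 h2 h3 h4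
        rw [h1, RingHom.id_apply, h4, Pi.smul_apply, h2, h3, Pi.smul_apply, smul_eq_mul,
          smul_eq_mul]
        ring }
    hb.choose
    (fun F => Lp.norm_le_mul_norm_of_ae_le_mul (by
      filter_upwards [(hmem F).coeFn_toLp] with p h1
      simp only [LinearMap.coe_mk, AddHom.coe_mk]
      rw [h1, norm_mul]
      exact mul_le_mul_of_nonneg_right (hb.choose_spec p) (norm_nonneg _)))

theorem mulLp_coe {n : ℕ} (φ : shell n → ℂ) (hφ : Measurable φ) (hb : ∃ C, ∀ p, ‖φ p‖ ≤ C)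
    (F : Lp ℂ 2 (mu n)) : ∀ᵐ p ∂mu n, mulLp φ hφ hb F p = φ p * F p :=
  (memLp_mul hφ hb F).coeFn_toLp

theorem IsSymbol.measurable_ofReal {n : ℕ} {φ : shell n → ℝ} (h : IsSymbol φ) :
    Measurable fun p => (φ p : ℂ) :=
  Complex.measurable_ofReal.comp h.measurable

theorem IsSymbol.bounded_ofReal {n : ℕ} {φ : shell n → ℝ} (h : IsSymbol φ) :
    ∃ C, ∀ p, ‖(φ p : ℂ)‖ ≤ C := by
  obtain ⟨C, hC⟩ := h.bounded
  exact ⟨C, fun p => by simpa using hC p⟩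

theorem IsSymbol.mulLp_mem {n : ℕ} {φ : shell n → ℝ} (h : IsSymbol φ) (F : SymL2 n) :
    mulLp (fun p => (φ p : ℂ)) h.measurable_ofReal h.bounded_ofReal (F : Lp ℂ 2 (mu n))
      ∈ SymL2 n := by
  rw [mem_symL2_iff]
  intro σ
  have h1 := mulLp_coe (fun p => (φ p : ℂ)) h.measurable_ofReal h.bounded_ofReal (F : Lp ℂ 2 (mu n))
  have h2 := (measurePreserving_permute σ).quasiMeasurePreserving.ae h1
  filter_upwards [h1, h2, mem_symL2_iff.mp F.2 σ] with p h1 h2 h3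
  rw [h1, h2, h.symmetric, h3]

open Classical in
/-- The Fourier multiplier `F(p) ↦ φ(p) F(p)` on the symmetric functions, for measurable, bounded,
symmetric `φ` (and zero for other `φ`). -/
def mulOp {n : ℕ} (φ : shell n → ℝ) : SymL2 n →L[ℂ] SymL2 n :=
  if h : IsSymbol φ then
    ((mulLp (fun p => (φ p : ℂ)) h.measurable_ofReal h.bounded_ofReal).comp
      (SymL2 n).subtypeL).codRestrict (SymL2 n) h.mulLp_mem
  else 0

theorem mulOp_coe {n : ℕ} {φ : shell n → ℝ} (h : IsSymbol φ) (F : SymL2 n) :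
    ∀ᵐ p ∂mu n, (mulOp φ F : Lp ℂ 2 (mu n)) p = φ p * (F : Lp ℂ 2 (mu n)) p := by
  rw [mulOp, dif_pos h]
  exact mulLp_coe _ h.measurable_ofReal h.bounded_ofReal (F : Lp ℂ 2 (mu n))

/-! ### The operator `A₊` -/

/-- `e^{iθ}`. -/
def phase (θ : Angle) : ℂ := (AddCircle.toCircle θ : ℂ)

theorem continuous_phase : Continuous phase :=
  continuous_subtype_val.comp AddCircle.continuous_toCircle

theorem norm_phase (θ : Angle) : ‖phase θ‖ = 1 := Circle.norm_coe _

/-- The factor `e^{i r_j} - e^{-i r_m}`, `j = m.succAbove k`. -/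
def creationFactor {n : ℕ} (m : Fin (n + 1)) (k : Fin n) (p : shell (n + 1)) : ℂ :=
  phase (p.1 (m.succAbove k)).1 - phase (-(p.1 m).1)

theorem measurable_creationFactor {n : ℕ} (m : Fin (n + 1)) (k : Fin n) :
    Measurable (creationFactor m k) := by
  have h : Continuous (creationFactor m k) :=
    (continuous_phase.comp (continuous_fst.comp (continuous_coord _))).sub
      (continuous_phase.comp (continuous_fst.comp (continuous_coord _)).neg)
  exact h.measurable

theorem bounded_creationFactor {n : ℕ} (m : Fin (n + 1)) (k : Fin n) :
    ∃ C, ∀ p, ‖creationFactor m k p‖ ≤ C := by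
  refine ⟨2, fun p => (norm_sub_le _ _).trans ?_⟩
  rw [norm_phase, norm_phase]
  norm_num

/-- `A₊` on functions of `n` momenta:
`(A₊ F)(p_1, …, p_{n+1}) = -(1/2) ∑_{j ≠ m} (e^{i r_j} - e^{-i r_m}) F(…, p_j + p_m, …, p̂_m, …)`,
the sum being over the ordered pairs of distinct indices. -/
def creationFun {n : ℕ} (F : shell n → ℂ) (p : shell (n + 1)) : ℂ :=
  -(1 / 2) * ∑ m : Fin (n + 1), ∑ k : Fin n, creationFactor m k p * F (merge m k p)

theorem quasi_merge {n : ℕ} (m : Fin (n + 1)) (k : Fin n) :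
    Measure.QuasiMeasurePreserving (merge m k) (mu (n + 1)) (mu n) :=
  ⟨(continuous_merge m k).measurable, (map_merge_le m k).absolutelyContinuous⟩

theorem memLp_merge {n : ℕ} (m : Fin (n + 1)) (k : Fin n) (F : Lp ℂ 2 (mu n)) :
    MemLp (fun p => F (merge m k p)) 2 (mu (n + 1)) :=
  ((Lp.memLp F).mono_measure (map_merge_le m k)).comp_of_map
    (continuous_merge m k).measurable.aemeasurable

/-- Composition with the merging map. -/
def mergeLp {n : ℕ} (m : Fin (n + 1)) (k : Fin n) : Lp ℂ 2 (mu n) →L[ℂ] Lp ℂ 2 (mu (n + 1)) :=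
  have hmeas : Measurable (merge m k) := (continuous_merge m k).measurable
  have hmem := memLp_merge m k
  LinearMap.mkContinuous
    { toFun := fun F => (hmem F).toLp _
      map_add' := by
        intro F G
        apply Lp.ext
        filter_upwards [(hmem (F + G)).coeFn_toLp, (hmem F).coeFn_toLp, (hmem G).coeFn_toLp,
          (quasi_merge m k).ae (Lp.coeFn_add F G),
          Lp.coeFn_add ((hmem F).toLp _) ((hmem G).toLp _)] with p h1 h2 h3 h4 h5
        rw [h1, h5, Pi.add_apply, h2, h3, h4, Pi.add_apply]
      map_smul' := by
        intro c F
        apply Lp.ext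
        filter_upwards [(hmem (c • F)).coeFn_toLp, (hmem F).coeFn_toLp,
          (quasi_merge m k).ae (Lp.coeFn_smul c F), Lp.coeFn_smul c ((hmem F).toLp _)]
          with p h1 h2 h3 h4
        rw [h1, RingHom.id_apply, h4, Pi.smul_apply, h2, h3, Pi.smul_apply] }
    1
    (fun F => by
      simp only [LinearMap.coe_mk, AddHom.coe_mk, one_mul]
      rw [Lp.norm_toLp, Lp.norm_def]
      refine ENNReal.toReal_mono (Lp.eLpNorm_ne_top F) ?_
      have h : eLpNorm (fun p => F (merge m k p)) 2 (mu (n + 1))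
          = eLpNorm F 2 ((mu (n + 1)).map (merge m k)) :=
        (eLpNorm_map_measure ((Lp.memLp F).mono_measure (map_merge_le m k)).1
          hmeas.aemeasurable).symm
      rw [h]
      exact eLpNorm_mono_measure _ (map_merge_le m k))

theorem mergeLp_coe {n : ℕ} (m : Fin (n + 1)) (k : Fin n) (F : Lp ℂ 2 (mu n)) :
    ∀ᵐ p ∂mu (n + 1), mergeLp m k F p = F (merge m k p) :=
  (memLp_merge m k F).coeFn_toLp

/-- `A₊` on `L²`. -/
def creationLp (n : ℕ) : Lp ℂ 2 (mu n) →L[ℂ] Lp ℂ 2 (mu (n + 1)) :=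
  (-(1 / 2) : ℂ) • ∑ m : Fin (n + 1), ∑ k : Fin n,
    (mulLp (creationFactor m k) (measurable_creationFactor m k) (bounded_creationFactor m k)).comp
      (mergeLp m k)

theorem coeFn_sum {n : ℕ} {ι : Type*} (s : Finset ι) (f : ι → Lp ℂ 2 (mu n)) :
    ∀ᵐ p ∂mu n, (∑ i ∈ s, f i : Lp ℂ 2 (mu n)) p = ∑ i ∈ s, f i p := by
  classical
  induction s using Finset.induction_on with
  | empty =>
    filter_upwards [Lp.coeFn_zero ℂ 2 (mu n)] with p h
    simpa using h
  | insert a s ha ih =>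
    rw [Finset.sum_insert ha]
    filter_upwards [Lp.coeFn_add (f a) (∑ i ∈ s, f i), ih] with p h1 h2
    rw [h1, Pi.add_apply, h2, Finset.sum_insert ha]

theorem creationLp_coe {n : ℕ} (F : Lp ℂ 2 (mu n)) :
    ∀ᵐ p ∂mu (n + 1), creationLp n F p = creationFun F p := by
  let T (m : Fin (n + 1)) (k : Fin n) : Lp ℂ 2 (mu (n + 1)) :=
    mulLp (creationFactor m k) (measurable_creationFactor m k) (bounded_creationFactor m k)
      (mergeLp m k F)
  have h0 : creationLp n F = (-(1 / 2) : ℂ) • ∑ m, ∑ k, T m k := by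
    simp [creationLp, T]
  have h1 : ∀ᵐ p ∂mu (n + 1), ∀ m k, T m k p = creationFactor m k p * F (merge m k p) := by
    refine ae_all_iff.mpr fun m => ae_all_iff.mpr fun k => ?_
    filter_upwards [mergeLp_coe m k F, mulLp_coe (creationFactor m k)
      (measurable_creationFactor m k) (bounded_creationFactor m k) (mergeLp m k F)] with p h2 h3
    rw [h3, h2]
  have h2 : ∀ᵐ p ∂mu (n + 1), ∀ m, (∑ k, T m k : Lp ℂ 2 (mu (n + 1))) p = ∑ k, T m k p :=
    ae_all_iff.mpr fun m => coeFn_sum _ _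
  rw [h0]
  filter_upwards [h1, h2, coeFn_sum Finset.univ (fun m => ∑ k, T m k),
    Lp.coeFn_smul (-(1 / 2) : ℂ) (∑ m, ∑ k, T m k)] with p h1 h2 h3 h4
  rw [h4, Pi.smul_apply, h3, smul_eq_mul, creationFun]
  simp only [h2, h1]

/-- The permutation of the remaining indices that `σ` induces when `m` is deleted from the source
and `σ m` from the target. -/
def inducedPerm {n : ℕ} (σ : Equiv.Perm (Fin (n + 1))) (m : Fin (n + 1)) : Equiv.Perm (Fin n) :=
  ((finSuccAboveEquiv m).trans (σ.subtypeEquiv (fun x => by simp))).trans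
    (finSuccAboveEquiv (σ m)).symm

theorem succAbove_inducedPerm {n : ℕ} (σ : Equiv.Perm (Fin (n + 1))) (m : Fin (n + 1))
    (i : Fin n) : (σ m).succAbove (inducedPerm σ m i) = σ (m.succAbove i) := by
  have h : finSuccAboveEquiv (σ m) (inducedPerm σ m i)
      = (σ.subtypeEquiv (fun x => by simp) : {x // x ≠ m} ≃ {x // x ≠ σ m})
        (finSuccAboveEquiv m i) := by
    simp [inducedPerm]
  exact congrArg Subtype.val h

theorem merge_permute {n : ℕ} (σ : Equiv.Perm (Fin (n + 1))) (m : Fin (n + 1)) (k : Fin n)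
    (p : shell (n + 1)) :
    merge m k (permute σ p) = permute (inducedPerm σ m) (merge (σ m) (inducedPerm σ m k) p) := by
  apply Subtype.ext
  funext i
  simp [merge, permute, succAbove_inducedPerm]

theorem creationFactor_permute {n : ℕ} (σ : Equiv.Perm (Fin (n + 1))) (m : Fin (n + 1))
    (k : Fin n) (p : shell (n + 1)) :
    creationFactor m k (permute σ p) = creationFactor (σ m) (inducedPerm σ m k) p := by
  simp [creationFactor, permute, succAbove_inducedPerm]

theorem creationFun_permute {n : ℕ} (σ : Equiv.Perm (Fin (n + 1))) (F : shell n → ℂ)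
    (p : shell (n + 1))
    (hF : ∀ (m : Fin (n + 1)) (k : Fin n) (π : Equiv.Perm (Fin n)),
      F (permute π (merge m k p)) = F (merge m k p)) :
    creationFun F (permute σ p) = creationFun F p := by
  have h (m : Fin (n + 1)) (k : Fin n) :
      creationFactor m k (permute σ p) * F (merge m k (permute σ p))
        = creationFactor (σ m) (inducedPerm σ m k) p * F (merge (σ m) (inducedPerm σ m k) p) := by
    rw [merge_permute, creationFactor_permute, hF]
  simp only [creationFun, h]
  congr 1
  rw [← Equiv.sum_comp σ (fun m => ∑ k, creationFactor m k p * F (merge m k p))]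
  exact Finset.sum_congr rfl fun m _ =>
    Equiv.sum_comp (inducedPerm σ m) (fun k => creationFactor (σ m) k p * F (merge (σ m) k p))

theorem mem_symL2_of_creationFun {n : ℕ} (F : SymL2 n) (G : Lp ℂ 2 (mu (n + 1)))
    (hG : ∀ᵐ p ∂mu (n + 1), G p = creationFun (F : Lp ℂ 2 (mu n)) p) : G ∈ SymL2 (n + 1) := by
  refine mem_symL2_iff.mpr fun σ => ?_
  have hF : ∀ᵐ p ∂mu (n + 1), ∀ (m : Fin (n + 1)) (k : Fin n) (π : Equiv.Perm (Fin n)),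
      (F : Lp ℂ 2 (mu n)) (permute π (merge m k p)) = (F : Lp ℂ 2 (mu n)) (merge m k p) := by
    refine ae_all_iff.mpr fun m => ae_all_iff.mpr fun k => ae_all_iff.mpr fun π => ?_
    have h := mem_symL2_iff.mp F.2 π
    exact (quasi_merge m k).ae
      (p := fun q => (F : Lp ℂ 2 (mu n)) (permute π q) = (F : Lp ℂ 2 (mu n)) q) h
  have h2 := (measurePreserving_permute σ).quasiMeasurePreserving.ae hG
  filter_upwards [hF, hG, h2] with p hF h1 h2
  exact h2.trans ((creationFun_permute σ _ p hF).trans h1.symm)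

theorem creationLp_mem {n : ℕ} (F : SymL2 n) : creationLp n (F : Lp ℂ 2 (mu n)) ∈ SymL2 (n + 1) :=
  mem_symL2_of_creationFun F _ (creationLp_coe (F : Lp ℂ 2 (mu n)))

/-- The operator `A₊`, from symmetric functions of `n` momenta to symmetric functions of `n + 1`
momenta. -/
def creation (n : ℕ) : SymL2 n →L[ℂ] SymL2 (n + 1) :=
  ((creationLp n).comp (SymL2 n).subtypeL).codRestrict (SymL2 (n + 1)) creationLp_mem

theorem creation_coe {n : ℕ} (F : SymL2 n) :
    ∀ᵐ p ∂mu (n + 1), (creation n F : Lp ℂ 2 (mu (n + 1))) p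
      = creationFun (F : Lp ℂ 2 (mu n)) p :=
  creationLp_coe _

/-! ### The dispersion relation and the self-energies -/

/-- `ω(θ) = -(e^{iθ} - 2 + e^{-iθ})`, a nonnegative real number. -/
def omega1 (θ : Angle) : ℝ := -(phase θ - 2 + phase (-θ)).re

/-- `ω(r_1) + ⋯ + ω(r_n)`. -/
def omegaR {n : ℕ} (p : shell n) : ℝ := ∑ j, omega1 (p.1 j).1

/-- `ω(p_1) + ⋯ + ω(p_n)`, `ω(p) = ω(r) + ω(s)`. -/
def omega {n : ℕ} (p : shell n) : ℝ := ∑ j, (omega1 (p.1 j).1 + omega1 (p.1 j).2)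

/-- `|log log λ|`, to be read as `|log |log λ||` since `log λ < 0` for small `λ`. -/
def loglog (lam : ℝ) : ℝ := |Real.log (|Real.log lam|)|

/-- The good set `ω(p) ≤ |log λ|^{-2τ}`. -/
def Good {n : ℕ} (lam τ : ℝ) (p : shell n) : Prop := omega p ≤ |Real.log lam| ^ (-2 * τ)

open Classical in
/-- The upper self-energy: `ω(r) |log(λ + ω(p))|^κ` on the good set and `ω(r) |log(λ + ω(p))|` off
it. Off the good set the logarithm is bounded below by one, because `λ + ω(p)` takes the value one
there. -/
def symbolU (n : ℕ) (lam κ τ : ℝ) (p : shell n) : ℝ :=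
  if Good lam τ p then omegaR p * |Real.log (lam + omega p)| ^ κ
  else omegaR p * max 1 |Real.log (lam + omega p)|

open Classical in
/-- The lower self-energy: `ω(r) |log(λ + ω(p))|^κ` on the good set and `-|log log λ|² ω(r)` off
it. -/
def symbolV (n : ℕ) (lam κ τ : ℝ) (p : shell n) : ℝ :=
  if Good lam τ p then omegaR p * |Real.log (lam + omega p)| ^ κ
  else -(loglog lam ^ 2) * omegaR p

theorem continuous_omega1 : Continuous omega1 := by
  have h := continuous_phase
  unfold omega1
  fun_prop

theorem continuous_omegaR (n : ℕ) : Continuous (omegaR (n := n)) := by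
  exact continuous_finsetSum _ fun j _ =>
    continuous_omega1.comp (continuous_fst.comp (continuous_coord j))

theorem continuous_omega (n : ℕ) : Continuous (omega (n := n)) := by
  exact continuous_finsetSum _ fun j _ =>
    (continuous_omega1.comp (continuous_fst.comp (continuous_coord j))).add
      (continuous_omega1.comp (continuous_snd.comp (continuous_coord j)))

theorem omega1_nonneg (θ : Angle) : 0 ≤ omega1 θ := by
  have h1 := (Complex.re_le_norm (phase θ)).trans (norm_phase θ).le
  have h2 := (Complex.re_le_norm (phase (-θ))).trans (norm_phase (-θ)).le
  simp only [omega1, Complex.add_re, Complex.sub_re, Complex.re_ofNat]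
  linarith

theorem omega_nonneg {n : ℕ} (p : shell n) : 0 ≤ omega p :=
  Finset.sum_nonneg fun _ _ => add_nonneg (omega1_nonneg _) (omega1_nonneg _)

theorem omegaR_permute {n : ℕ} (σ : Equiv.Perm (Fin n)) (p : shell n) :
    omegaR (permute σ p) = omegaR p :=
  Equiv.sum_comp σ fun j => omega1 (p.1 j).1

theorem omega_permute {n : ℕ} (σ : Equiv.Perm (Fin n)) (p : shell n) :
    omega (permute σ p) = omega p :=
  Equiv.sum_comp σ fun j => omega1 (p.1 j).1 + omega1 (p.1 j).2

theorem bounded_of_continuous {n : ℕ} {f : shell n → ℝ} (hf : Continuous f) :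
    ∃ C, ∀ p, |f p| ≤ C := by
  obtain ⟨C, hC⟩ := isCompact_univ.exists_bound_of_continuousOn hf.continuousOn
  exact ⟨C, fun p => hC p (Set.mem_univ p)⟩

theorem isSymbol_of_ite {n : ℕ} {lam τ : ℝ} {f g : shell n → ℝ} (hf : Continuous f)
    (hg : Continuous g) (hfs : ∀ σ p, f (permute σ p) = f p)
    (hgs : ∀ σ p, g (permute σ p) = g p) [DecidablePred (Good (n := n) lam τ)] :
    IsSymbol (fun p => if Good lam τ p then f p else g p) := by
  obtain ⟨C, hC⟩ := bounded_of_continuous hf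
  obtain ⟨C', hC'⟩ := bounded_of_continuous hg
  refine ⟨?_, ⟨max C C', fun p => ?_⟩, fun σ p => ?_⟩
  · refine Measurable.ite ?_ hf.measurable hg.measurable
    exact measurableSet_le (continuous_omega n).measurable measurable_const
  · split_ifs
    · exact (hC p).trans (le_max_left _ _)
    · exact (hC' p).trans (le_max_right _ _)
  · have h : Good lam τ (permute σ p) ↔ Good lam τ p := by
      rw [Good, Good, omega_permute]
    by_cases h' : Good lam τ p
    · rw [if_pos h', if_pos (h.mpr h'), hfs]
    · rw [if_neg h', if_neg (fun h'' => h' (h.mp h'')), hgs]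

theorem continuous_log_omega {n : ℕ} {lam : ℝ} (hlam : 0 < lam) :
    Continuous fun p : shell n => |Real.log (lam + omega p)| :=
  ((continuous_const.add (continuous_omega n)).log fun p =>
    (add_pos_of_pos_of_nonneg hlam (omega_nonneg p)).ne').abs

theorem isSymbol_lam_add_omega (n : ℕ) (lam : ℝ) :
    IsSymbol (fun p : shell n => lam + omega p) := by
  have h : Continuous fun p : shell n => lam + omega p :=
    continuous_const.add (continuous_omega n)
  exact ⟨h.measurable, bounded_of_continuous h, fun σ p => by rw [omega_permute]⟩

theorem isSymbol_symbolU (n : ℕ) {lam κ : ℝ} (hlam : 0 < lam) (hκ : 0 ≤ κ) (τ : ℝ) :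
    IsSymbol (symbolU n lam κ τ) := by
  classical
  have hl := continuous_log_omega (n := n) hlam
  exact isSymbol_of_ite ((continuous_omegaR n).mul (hl.rpow_const fun _ => Or.inr hκ))
    ((continuous_omegaR n).mul (continuous_const.max hl))
    (fun σ p => by simp only [Pi.mul_apply, omega_permute, omegaR_permute])
    (fun σ p => by simp only [Pi.mul_apply, omega_permute, omegaR_permute])

theorem isSymbol_symbolV (n : ℕ) {lam κ : ℝ} (hlam : 0 < lam) (hκ : 0 ≤ κ) (τ : ℝ) :
    IsSymbol (symbolV n lam κ τ) := by
  classical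
  have hl := continuous_log_omega (n := n) hlam
  exact isSymbol_of_ite ((continuous_omegaR n).mul (hl.rpow_const fun _ => Or.inr hκ))
    (continuous_const.mul (continuous_omegaR n))
    (fun σ p => by simp only [Pi.mul_apply, omega_permute, omegaR_permute])
    (fun σ p => by simp only [Pi.mul_apply, omegaR_permute])

/-- The Fourier multiplier `U^n_{κ,τ}`. -/
def opU (n : ℕ) (lam κ τ : ℝ) : SymL2 n →L[ℂ] SymL2 n := mulOp (symbolU n lam κ τ)

/-- The Fourier multiplier `V^n_{κ,τ}`. -/
def opV (n : ℕ) (lam κ τ : ℝ) : SymL2 n →L[ℂ] SymL2 n := mulOp (symbolV n lam κ τ)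

/-! ### Operators with a domain -/

/-- `λ - S + Ω`, with the domain of `Ω`. Here `-S` (minus the discrete Laplacian) is the multiplier
`ω`. -/
def shifted {n : ℕ} (lam : ℝ) (Ω : SymL2 n →ₗ.[ℂ] SymL2 n) : SymL2 n →ₗ.[ℂ] SymL2 n :=
  (mulOp (fun p : shell n => lam + omega p) : SymL2 n →ₗ[ℂ] SymL2 n) +ᵥ Ω

/-- The inequality `T ≤ Ω` for bounded `T`, as quadratic forms on the domain of `Ω`. -/
def BoundedBelowBy {n : ℕ} (Ω : SymL2 n →ₗ.[ℂ] SymL2 n) (T : SymL2 n →L[ℂ] SymL2 n) : Prop :=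
  ∀ x : Ω.domain, (⟪(x : SymL2 n), T x⟫_ℂ).re ≤ (⟪(x : SymL2 n), Ω x⟫_ℂ).re

/-- The inequality `Ω ≤ T` for bounded `T`, as quadratic forms on the domain of `Ω`. -/
def BoundedAboveBy {n : ℕ} (Ω : SymL2 n →ₗ.[ℂ] SymL2 n) (T : SymL2 n →L[ℂ] SymL2 n) : Prop :=
  ∀ x : Ω.domain, (⟪(x : SymL2 n), Ω x⟫_ℂ).re ≤ (⟪(x : SymL2 n), T x⟫_ℂ).re

/-- `R` is the bounded inverse of `D`. -/
def IsBoundedInverse {n : ℕ} (D : SymL2 n →ₗ.[ℂ] SymL2 n) (R : SymL2 n →L[ℂ] SymL2 n) : Prop :=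
  (∀ y, ∃ x : D.domain, (x : SymL2 n) = R y ∧ D x = y) ∧ ∀ x : D.domain, R (D x) = x

end

end ASEP

/-!
The inverse of `λ - S + Ω` is monotone decreasing in `Ω`, also for unbounded `Ω`: this is the
variational principle `⟪x, D⁻¹ x⟫ = sup_y (2 Re ⟪x, y⟫ - ⟪y, D y⟫)`, used in
`re_inner_inverse_le` and `re_inner_le_inverse` through the positivity of one square. Hence the
operator may be replaced by a Fourier multiplier, `λ + ω + γ V` (`lowerSymbol`) from below and
`γ⁻¹ (λ + ω + U)` (`upperSymbol`) from above. What remains is to estimate, for a weight `W` that is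
the inverse of such a multiplier, the integral of `W |A₊ F|²`.

Because `F` is symmetric, the terms of `A₊ F` that belong to the pairs `(j, m)` and `(m, j)` combine
to one whose factor has absolute value squared `(4 - ω(r_j - r_m)) ω(r_j + r_m)`, and
`r_j + r_m` is one of the momenta of `F`. This is where the factor `ω(𝐫)` of the self-energies comes
from (`creation_ae_eq`). The measure on the shell is a product of the measure on the shell with one
momentum less and of the Haar measure of the torus (`lintegral_mu_succ`), so that each diagonal term
is an integral of `ω(r) |F|²` against the fibre integral of `W`.

On a fibre over `q`, with `b = λ + ω(q)`, the weight compares to the inverse of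
`b + r² + s² + r² |log|^κ`. The integral over `s` and `r` is of the order of
`∫ ds / (s |log s|^{κ/2})`, that is `|log b|^{1-κ/2}` (`lintegral_fibre_le`, `le_lintegral_fibre`).
For the upper bound, the cross terms are estimated by the Cauchy-Schwarz inequality, which costs a
factor `n (n + 1)`, and the region off the good set contributes a multiple of `log |log λ|`; the
product of these two factors is smaller than `|log log λ|²`.

For the lower bound, the cross terms of two different pairs have to be small compared to the
diagonal ones (`le_lintegral_creation`). The product of the terms of the pairs `e` and `e'` is
estimated by the arithmetic-geometric mean inequality, with the ratio of `ω(𝐫)` at the two merged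
configurations to the power `3/4` as a weight (`crossWeight`). This leads to fibre integrals of
`ω(r)^{-1/4} / (a + ω(r) + ω(s))`, in which no logarithm appears. So the cross terms are bounded by a
multiple of `n⁴ ⟪F, ω(𝐫) F⟫`, which is absorbed by the logarithm on the good set, where it is at
least `|log log λ|^{1/2}`, and by the negative part of `V` off it
(`SmallParameters.symbolV_add_le`).
-/

namespace ASEP

noncomputable section

/-! ### Unbounded self-adjoint operators and quadratic forms -/

section Operators

variable {H : Type*} [NormedAddCommGroup H] [InnerProductSpace ℂ H] [CompleteSpace H]

theorem inner_map_eq_of_isSelfAdjoint {D : H →ₗ.[ℂ] H} (hD : IsSelfAdjoint D) (x y : D.domain) :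
    ⟪D x, (y : H)⟫_ℂ = ⟪(x : H), D y⟫_ℂ := by
  have h := LinearPMap.adjoint_isFormalAdjoint hD.dense_domain
  rw [LinearPMap.isSelfAdjoint_def.mp hD] at h
  exact h x y

/-- A bounded self-adjoint perturbation of a self-adjoint operator is self-adjoint on the same
domain. -/
theorem isSelfAdjoint_vadd {B : H →L[ℂ] H} (hB : IsSelfAdjoint B) {Ω : H →ₗ.[ℂ] H}
    (hΩ : IsSelfAdjoint Ω) : IsSelfAdjoint ((B : H →ₗ[ℂ] H) +ᵥ Ω) := by
  have hBs (x y : H) : ⟪B x, y⟫_ℂ = ⟪x, B y⟫_ℂ := hB.isSymmetric x y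
  have hdense : Dense (((B : H →ₗ[ℂ] H) +ᵥ Ω).domain : Set H) := hΩ.dense_domain
  have hformal : ((B : H →ₗ[ℂ] H) +ᵥ Ω).IsFormalAdjoint ((B : H →ₗ[ℂ] H) +ᵥ Ω) := by
    intro x y
    rw [LinearPMap.vadd_apply, LinearPMap.vadd_apply, inner_add_left, inner_add_right]
    exact congrArg₂ (· + ·) (hBs _ _) (inner_map_eq_of_isSelfAdjoint hΩ x y)
  rw [LinearPMap.isSelfAdjoint_def]
  have hle := hformal.le_adjoint hdense
  refine (LinearPMap.eq_of_le_of_domain_eq hle (le_antisymm hle.1 fun y hy => ?_)).symm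
  change y ∈ Ω.domain
  rw [← LinearPMap.isSelfAdjoint_def.mp hΩ]
  refine LinearPMap.mem_adjoint_domain_of_exists y
    ⟨((B : H →ₗ[ℂ] H) +ᵥ Ω).adjoint ⟨y, hy⟩ - B y, fun x => ?_⟩
  have h := LinearPMap.adjoint_isFormalAdjoint hdense ⟨y, hy⟩ x
  rw [LinearPMap.vadd_apply, inner_add_right] at h
  rw [inner_sub_left, hBs]
  exact sub_eq_of_eq_add' h

/-- A self-adjoint operator with a positive lower bound has a bounded inverse: on its graph, which
is complete, the second projection is bounded below, so it has closed range, and its range is dense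
because the kernel of the adjoint is trivial. -/
theorem exists_boundedInverse {D : H →ₗ.[ℂ] H} (hD : IsSelfAdjoint D) {c : ℝ} (hc : 0 < c)
    (hlow : ∀ x : D.domain, c * ‖(x : H)‖ ^ 2 ≤ (⟪(x : H), D x⟫_ℂ).re) :
    ∃ R : H →L[ℂ] H, (∀ y, ∃ x : D.domain, (x : H) = R y ∧ D x = y) ∧
      ∀ x : D.domain, R (D x) = x := by
  have hnorm (x : D.domain) : ‖(x : H)‖ ≤ c⁻¹ * ‖D x‖ := by
    rcases eq_or_ne (‖(x : H)‖) 0 with h | h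
    · rw [h]; positivity
    · have hx : 0 < ‖(x : H)‖ := lt_of_le_of_ne (norm_nonneg _) h.symm
      have h1 : c * ‖(x : H)‖ ^ 2 ≤ ‖(x : H)‖ * ‖D x‖ :=
        (hlow x).trans ((Complex.re_le_norm _).trans (norm_inner_le_norm _ _))
      have h2 : c * ‖(x : H)‖ ≤ ‖D x‖ := by
        refine le_of_mul_le_mul_left ?_ hx
        linarith [h1, sq (‖(x : H)‖)]
      rw [inv_mul_eq_div, le_div_iff₀ hc]
      linarith
  have hcomplete : CompleteSpace D.graph := hD.isClosed.completeSpace_coe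
  let f : D.graph →L[ℂ] H := (ContinuousLinearMap.snd ℂ H H).comp D.graph.subtypeL
  have hmem (x : D.domain) : ((x : H), D x) ∈ D.graph := D.mem_graph x
  have hgraph (z : D.graph) : ∃ x : D.domain, (z : H × H) = ((x : H), D x) := by
    obtain ⟨x, hx1, hx2⟩ := D.mem_graph_iff.mp z.2
    exact ⟨x, Prod.ext hx1.symm hx2.symm⟩
  have hanti : AntilipschitzWith (Real.toNNReal (max 1 c⁻¹)) f := by
    refine AddMonoidHomClass.antilipschitz_of_bound f fun z => ?_
    obtain ⟨x, hx⟩ := hgraph z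
    have h0 : (Real.toNNReal (max 1 c⁻¹) : ℝ) = max 1 c⁻¹ :=
      Real.coe_toNNReal _ (le_trans zero_le_one (le_max_left _ _))
    have hf : f z = D x := by
      change (z : H × H).2 = D x
      rw [hx]
    have hz : ‖z‖ = max ‖(x : H)‖ ‖D x‖ := by
      change ‖(z : H × H)‖ = _
      rw [hx, Prod.norm_def]
    rw [h0, hf, hz]
    refine max_le ((hnorm x).trans ?_) ?_
    · exact mul_le_mul_of_nonneg_right (le_max_right _ _) (norm_nonneg _)
    · exact le_mul_of_one_le_left (norm_nonneg _) (le_max_left _ _)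
  have hker : f.ker = ⊥ := LinearMap.ker_eq_bot.mpr hanti.injective
  have hrange : f.range = ⊤ := by
    have hcl : IsClosed (f.range : Set H) := hanti.isClosed_range f.uniformContinuous
    have : f.range.topologicalClosure = ⊤ := by
      rw [Submodule.topologicalClosure_eq_top_iff, Submodule.eq_bot_iff]
      intro z hz
      have hz' (x : D.domain) : ⟪z, D x⟫_ℂ = 0 :=
        Submodule.inner_left_of_mem_orthogonal (K := f.range) ⟨⟨_, hmem x⟩, rfl⟩ hz
      have hzd : z ∈ D.domain := by
        rw [← LinearPMap.isSelfAdjoint_def.mp hD]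
        exact LinearPMap.mem_adjoint_domain_of_exists z ⟨0, fun x => by rw [hz', inner_zero_left]⟩
      have h := hlow ⟨z, hzd⟩
      rw [hz'] at h
      have : ‖z‖ ^ 2 = 0 := by
        have h' : c * ‖z‖ ^ 2 ≤ 0 := h
        nlinarith [sq_nonneg ‖z‖]
      simpa using this
    rwa [hcl.submodule_topologicalClosure_eq] at this
  let e := ContinuousLinearEquiv.ofBijective f hker hrange
  refine ⟨(ContinuousLinearMap.fst ℂ H H).comp (D.graph.subtypeL.comp (e.symm : H →L[ℂ] D.graph)),
    fun y => ?_, fun x => ?_⟩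
  · obtain ⟨x, hx⟩ := hgraph (e.symm y)
    refine ⟨x, ?_, ?_⟩
    · change _ = (e.symm y : H × H).1
      rw [hx]
    · have h : f (e.symm y) = y := e.apply_symm_apply y
      change (e.symm y : H × H).2 = y at h
      rwa [hx] at h
  · have h : e.symm (D x) = ⟨_, hmem x⟩ := by
      rw [ContinuousLinearEquiv.symm_apply_eq]
      rfl
    change (e.symm (D x) : H × H).1 = _
    rw [h]

/-- The bounded inverse of a symmetric operator is self-adjoint. -/
theorem isSelfAdjoint_of_inverse {D : H →ₗ.[ℂ] H} (hD : IsSelfAdjoint D) {R : H →L[ℂ] H}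
    (hR : ∀ y, ∃ x : D.domain, (x : H) = R y ∧ D x = y) : IsSelfAdjoint R := by
  rw [ContinuousLinearMap.isSelfAdjoint_iff_isSymmetric]
  intro a b
  obtain ⟨x, hx, hx'⟩ := hR a
  obtain ⟨y, hy, hy'⟩ := hR b
  have h := inner_map_eq_of_isSelfAdjoint hD x y
  rw [hx', hy', hx, hy] at h
  exact h.symm

theorem re_inner_map_sub {M : H →L[ℂ] H} (hM : IsSelfAdjoint M) (x y : H) :
    (⟪x - y, M (x - y)⟫_ℂ).re
      = (⟪x, M x⟫_ℂ).re - 2 * (⟪x, M y⟫_ℂ).re + (⟪y, M y⟫_ℂ).re := by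
  have h : (⟪y, M x⟫_ℂ).re = (⟪x, M y⟫_ℂ).re := by
    have h1 : ⟪M x, y⟫_ℂ = ⟪x, M y⟫_ℂ := hM.isSymmetric x y
    rw [← h1, ← inner_conj_symm, Complex.conj_re]
  rw [map_sub, inner_sub_left, inner_sub_right, inner_sub_right]
  simp only [Complex.sub_re]
  rw [h]
  ring

/-- Inversion reverses the order: if `0 ≤ M ≤ D` then `D⁻¹ ≤ M⁻¹`. Here `u` plays the role of
`M⁻¹ x`. -/
theorem re_inner_inverse_le {D : H →ₗ.[ℂ] H} {R M : H →L[ℂ] H}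
    (hR : ∀ y, ∃ x : D.domain, (x : H) = R y ∧ D x = y) (hM : IsSelfAdjoint M)
    (hM0 : ∀ x, 0 ≤ (⟪x, M x⟫_ℂ).re)
    (hMD : ∀ x : D.domain, (⟪(x : H), M x⟫_ℂ).re ≤ (⟪(x : H), D x⟫_ℂ).re)
    {x u : H} (hu : M u = x) : (⟪x, R x⟫_ℂ).re ≤ (⟪x, u⟫_ℂ).re := by
  obtain ⟨y, hy, hyx⟩ := hR x
  have h1 := hM0 ((y : H) - u)
  rw [re_inner_map_sub hM, hu] at h1
  have h2 := hMD y
  rw [hyx] at h2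
  have h3 : (⟪x, (y : H)⟫_ℂ).re = (⟪(y : H), x⟫_ℂ).re := by
    rw [← inner_conj_symm, Complex.conj_re]
  have h4 : (⟪x, u⟫_ℂ).re = (⟪u, x⟫_ℂ).re := by
    rw [← inner_conj_symm, Complex.conj_re]
  rw [← hy, h3, h4]
  linarith

/-- Inversion reverses the order: if `0 ≤ D ≤ M` on the domain of `D` then `M⁻¹ ≤ D⁻¹`. Here `u`
plays the role of `M⁻¹ x`; it need not belong to the domain of `D`, but it is a limit of elements of
the domain. -/
theorem re_inner_le_inverse {D : H →ₗ.[ℂ] H} (hD : IsSelfAdjoint D) {R M : H →L[ℂ] H}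
    (hR : ∀ y, ∃ x : D.domain, (x : H) = R y ∧ D x = y)
    (hD0 : ∀ x : D.domain, 0 ≤ (⟪(x : H), D x⟫_ℂ).re)
    (hDM : ∀ x : D.domain, (⟪(x : H), D x⟫_ℂ).re ≤ (⟪(x : H), M x⟫_ℂ).re)
    {x u : H} (hu : M u = x) : (⟪x, u⟫_ℂ).re ≤ (⟪x, R x⟫_ℂ).re := by
  obtain ⟨y, hy, hyx⟩ := hR x
  have key (v : D.domain) :
      0 ≤ (⟪(v : H), M v⟫_ℂ).re - 2 * (⟪x, (v : H)⟫_ℂ).re + (⟪x, R x⟫_ℂ).re := by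
    have h := hD0 (v - y)
    have hsym := inner_map_eq_of_isSelfAdjoint hD y v
    rw [LinearPMap.map_sub, Submodule.coe_sub, inner_sub_left, inner_sub_right, inner_sub_right,
      ← hsym, hyx] at h
    simp only [Complex.sub_re] at h
    have h3 : (⟪(v : H), x⟫_ℂ).re = (⟪x, (v : H)⟫_ℂ).re := by
      rw [← inner_conj_symm, Complex.conj_re]
    have h4 : (⟪(y : H), x⟫_ℂ).re = (⟪x, (y : H)⟫_ℂ).re := by
      rw [← inner_conj_symm, Complex.conj_re]
    rw [h3, h4] at h
    rw [← hy]
    linarith [hDM v]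
  have hall : ∀ v : H, 0 ≤ (⟪v, M v⟫_ℂ).re - 2 * (⟪x, v⟫_ℂ).re + (⟪x, R x⟫_ℂ).re := by
    intro v
    have hcl : IsClosed {v : H |
        0 ≤ (⟪v, M v⟫_ℂ).re - 2 * (⟪x, v⟫_ℂ).re + (⟪x, R x⟫_ℂ).re} := by
      refine isClosed_le continuous_const ?_
      have := Complex.continuous_re
      fun_prop
    have hsub : (D.domain : Set H) ⊆ {v : H |
        0 ≤ (⟪v, M v⟫_ℂ).re - 2 * (⟪x, v⟫_ℂ).re + (⟪x, R x⟫_ℂ).re} :=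
      fun v hv => key ⟨v, hv⟩
    exact hcl.closure_subset_iff.mpr hsub (hD.dense_domain v)
  have h := hall u
  have h4 : (⟪u, x⟫_ℂ).re = (⟪x, u⟫_ℂ).re := by
    rw [← inner_conj_symm, Complex.conj_re]
  rw [hu, h4] at h
  linarith

theorem le_of_re_inner_le {S T : H →L[ℂ] H} (hS : IsSelfAdjoint S) (hT : IsSelfAdjoint T)
    (h : ∀ x, (⟪x, S x⟫_ℂ).re ≤ (⟪x, T x⟫_ℂ).re) : S ≤ T := by
  rw [ContinuousLinearMap.le_def, ContinuousLinearMap.isPositive_iff_complex]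
  intro x
  have hsym : ⟪(T - S) x, x⟫_ℂ = ⟪x, (T - S) x⟫_ℂ := (hT.sub hS).isSymmetric x x
  refine ⟨Complex.conj_eq_iff_re.mp ?_, ?_⟩
  · rw [inner_conj_symm, hsym]
  · change 0 ≤ (⟪(T - S) x, x⟫_ℂ).re
    rw [hsym]
    change 0 ≤ (⟪x, T x - S x⟫_ℂ).re
    rw [inner_sub_right, Complex.sub_re]
    linarith [h x]

end Operators

/-! ### The dispersion relation on the circle -/

theorem phase_add (θ η : Angle) : phase (θ + η) = phase θ * phase η := by
  simp [phase, AddCircle.toCircle_add]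

theorem phase_neg (θ : Angle) : phase (-θ) = star (phase θ) := by
  rw [phase, AddCircle.toCircle_neg, Circle.coe_inv_eq_conj]
  rfl

theorem phase_mul_star (θ : Angle) : phase θ * star (phase θ) = 1 := by
  have h := Complex.mul_conj (phase θ)
  rw [Complex.normSq_eq_norm_sq, norm_phase] at h
  simpa using h

theorem omega1_eq (θ : Angle) : omega1 θ = 2 - 2 * (phase θ).re := by
  rw [omega1, phase_neg]
  simp only [Complex.add_re, Complex.sub_re, Complex.re_ofNat, Complex.star_def, Complex.conj_re]
  ring

theorem omega1_eq_norm_sq (θ : Angle) : omega1 θ = ‖1 - phase θ‖ ^ 2 := by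
  have h := norm_phase θ
  rw [← sq_eq_sq₀ (norm_nonneg _) zero_le_one, ← Complex.normSq_eq_norm_sq,
    Complex.normSq_apply] at h
  rw [omega1_eq, ← Complex.normSq_eq_norm_sq, Complex.normSq_apply]
  simp only [Complex.sub_re, Complex.sub_im, Complex.one_re, Complex.one_im]
  linarith

theorem omega1_neg (θ : Angle) : omega1 (-θ) = omega1 θ := by
  rw [omega1_eq, omega1_eq, phase_neg, Complex.star_def, Complex.conj_re]

theorem omega1_add_le (θ η : Angle) : omega1 (θ + η) ≤ 2 * (omega1 θ + omega1 η) := by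
  have h : ‖1 - phase (θ + η)‖ ≤ ‖1 - phase θ‖ + ‖1 - phase η‖ := by
    have h1 : 1 - phase (θ + η) = (1 - phase θ) + phase θ * (1 - phase η) := by
      rw [phase_add]; ring
    rw [h1]
    refine (norm_add_le _ _).trans ?_
    rw [norm_mul, norm_phase, one_mul]
  rw [omega1_eq_norm_sq, omega1_eq_norm_sq, omega1_eq_norm_sq]
  nlinarith [norm_nonneg (1 - phase (θ + η)), sq_nonneg (‖1 - phase θ‖ - ‖1 - phase η‖)]

theorem omega1_sub_le (θ η : Angle) : omega1 (θ - η) ≤ 2 * (omega1 θ + omega1 η) := by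
  have h := omega1_add_le θ (-η)
  rwa [omega1_neg, ← sub_eq_add_neg] at h

theorem omega1_coe (x : ℝ) : omega1 (x : Angle) = 2 - 2 * Real.cos x := by
  have h : phase (x : Angle) = Complex.exp (x * Complex.I) := by
    have h1 : 2 * Real.pi / (2 * Real.pi) * x = x := by field_simp
    rw [phase, AddCircle.toCircle_apply_mk, h1, Circle.coe_exp]
  rw [omega1_eq, h, Complex.exp_ofReal_mul_I_re]

theorem omega1_coe_le (x : ℝ) : omega1 (x : Angle) ≤ x ^ 2 := by
  rw [omega1_coe]
  linarith [Real.one_sub_sq_div_two_le_cos (x := x)]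

theorem le_omega1_coe {x : ℝ} (hx : |x| ≤ Real.pi) : x ^ 2 / 4 ≤ omega1 (x : Angle) := by
  rw [omega1_coe]
  have h := Real.cos_le_one_sub_mul_cos_sq hx
  have h1 : x ^ 2 / 4 ≤ 2 * (2 / Real.pi ^ 2 * x ^ 2) := by
    have h2 : 1 / 4 ≤ 2 * (2 / Real.pi ^ 2) := by
      rw [← mul_div_assoc, div_le_div_iff₀ (by norm_num) (by positivity)]
      nlinarith [Real.pi_pos, Real.pi_lt_four]
    nlinarith [sq_nonneg x]
  linarith

/-! ### Integrals over the circle and the torus -/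

/-- The Haar probability measure of the circle. -/
abbrev circleMeasure : Measure Angle := AddCircle.haarAddCircle

/-- The Haar probability measure of the torus. -/
abbrev torusMeasure : Measure Momentum := circleMeasure.prod circleMeasure

theorem lintegral_circle (g : Angle → ℝ≥0∞) :
    ∫⁻ θ, g θ ∂circleMeasure
      = (ENNReal.ofReal (2 * Real.pi))⁻¹ * ∫⁻ x in Set.Ioc (-Real.pi) Real.pi, g (x : Angle) := by
  have h := AddCircle.lintegral_preimage (2 * Real.pi) (-Real.pi) g
  have h1 : -Real.pi + 2 * Real.pi = Real.pi := by ring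
  rw [h1] at h
  have hpos : ENNReal.ofReal (2 * Real.pi) ≠ 0 := by
    rw [Ne, ENNReal.ofReal_eq_zero, not_le]; exact Real.two_pi_pos
  rw [h, AddCircle.volume_eq_smul_haarAddCircle, lintegral_smul_measure, smul_eq_mul, ← mul_assoc,
    ENNReal.inv_mul_cancel hpos ENNReal.ofReal_ne_top, one_mul]

theorem lintegral_circle_le {g : Angle → ℝ≥0∞} {f : ℝ → ℝ≥0∞}
    (h₁ : ∀ x ∈ Set.Ioo 0 Real.pi, g (x : Angle) ≤ f x)
    (h₂ : ∀ x ∈ Set.Ioo 0 Real.pi, g ((-x : ℝ) : Angle) ≤ f x) :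
    ∫⁻ θ, g θ ∂circleMeasure ≤ ∫⁻ x in Set.Ioo 0 Real.pi, f x := by
  have hsplit : Set.Ioc (-Real.pi) Real.pi = Set.Ioc (-Real.pi) 0 ∪ Set.Ioc 0 Real.pi :=
    (Set.Ioc_union_Ioc_eq_Ioc (by linarith [Real.pi_pos]) Real.pi_pos.le).symm
  have hpos : ∫⁻ x in Set.Ioc 0 Real.pi, g (x : Angle) ≤ ∫⁻ x in Set.Ioo 0 Real.pi, f x := by
    rw [Measure.restrict_congr_set Ioo_ae_eq_Ioc.symm]
    exact setLIntegral_mono' measurableSet_Ioo h₁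
  have hneg : ∫⁻ x in Set.Ioc (-Real.pi) 0, g (x : Angle) ≤ ∫⁻ x in Set.Ioo 0 Real.pi, f x := by
    rw [Measure.restrict_congr_set Ioo_ae_eq_Ioc.symm]
    have h := (Measure.measurePreserving_neg (volume : Measure ℝ)).setLIntegral_comp_preimage_emb
      (MeasurableEquiv.neg ℝ).measurableEmbedding (fun x : ℝ => g (x : Angle))
      (Set.Ioo (-Real.pi) 0)
    have hpre : (Neg.neg ⁻¹' Set.Ioo (-Real.pi) 0 : Set ℝ) = Set.Ioo 0 Real.pi := by
      ext x
      simp only [Set.mem_preimage, Set.mem_Ioo]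
      constructor <;> rintro ⟨h1, h2⟩ <;> constructor <;> linarith
    rw [hpre] at h
    rw [← h]
    exact setLIntegral_mono' measurableSet_Ioo h₂
  rw [lintegral_circle, hsplit]
  have h2 := (lintegral_union_le (fun x : ℝ => g (x : Angle)) (Set.Ioc (-Real.pi) 0)
    (Set.Ioc 0 Real.pi) (μ := volume)).trans (add_le_add hneg hpos)
  have h3 : (ENNReal.ofReal (2 * Real.pi))⁻¹ * 2 ≤ 1 := by
    rw [← ENNReal.div_eq_inv_mul]
    refine ENNReal.div_le_of_le_mul ?_
    rw [one_mul, ← ENNReal.ofReal_ofNat]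
    exact ENNReal.ofReal_le_ofReal (by linarith [Real.pi_gt_three])
  calc _ ≤ (ENNReal.ofReal (2 * Real.pi))⁻¹ * (2 * ∫⁻ x in Set.Ioo 0 Real.pi, f x) := by
        refine mul_le_mul_right ?_ _
        exact h2.trans_eq (two_mul _).symm
    _ ≤ _ := by
        rw [← mul_assoc]
        exact mul_le_of_le_one_left (zero_le) h3

theorem le_lintegral_circle {g : Angle → ℝ≥0∞} {f : ℝ → ℝ≥0∞} {a b : ℝ} (ha : 0 ≤ a)
    (hb : b ≤ Real.pi) (h : ∀ x ∈ Set.Ioo a b, f x ≤ g (x : Angle)) :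
    ENNReal.ofReal (1 / 8) * ∫⁻ x in Set.Ioo a b, f x ≤ ∫⁻ θ, g θ ∂circleMeasure := by
  rw [lintegral_circle]
  have h1 : ENNReal.ofReal (1 / 8) ≤ (ENNReal.ofReal (2 * Real.pi))⁻¹ := by
    rw [← ENNReal.ofReal_inv_of_pos Real.two_pi_pos, one_div]
    exact ENNReal.ofReal_le_ofReal
      (inv_anti₀ Real.two_pi_pos (by linarith [Real.pi_lt_four]))
  have h2 : Set.Ioo a b ⊆ Set.Ioc (-Real.pi) Real.pi := fun x hx =>
    ⟨by linarith [hx.1, Real.pi_pos], hx.2.le.trans hb⟩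
  exact mul_le_mul' h1
    ((setLIntegral_mono' measurableSet_Ioo h).trans (lintegral_mono_set h2))

/-- The fundamental theorem of calculus for a nonnegative derivative on an open interval. -/
theorem lintegral_deriv {G g : ℝ → ℝ} {a b : ℝ} (hab : a ≤ b) (hG : ContinuousOn G (Set.Icc a b))
    (hderiv : ∀ x ∈ Set.Ioo a b, HasDerivAt G (g x) x) (hg : ∀ x ∈ Set.Ioo a b, 0 ≤ g x) :
    ∫⁻ x in Set.Ioo a b, ENNReal.ofReal (g x) = ENNReal.ofReal (G b - G a) := by
  have hint : IntervalIntegrable g volume a b := by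
    refine intervalIntegral.intervalIntegrable_deriv_of_nonneg (g := G) ?_ ?_ ?_
    · rwa [Set.uIcc_of_le hab]
    · rwa [min_eq_left hab, max_eq_right hab]
    · rwa [min_eq_left hab, max_eq_right hab]
  have hint' : IntegrableOn g (Set.Ioo a b) :=
    ((intervalIntegrable_iff_integrableOn_Ioc_of_le hab).mp hint).mono_set Set.Ioo_subset_Ioc_self
  rw [← ofReal_integral_eq_lintegral_ofReal hint'
    ((ae_restrict_iff' measurableSet_Ioo).mpr (Filter.Eventually.of_forall hg)),
    ← integral_Ioc_eq_integral_Ioo, ← intervalIntegral.integral_of_le hab,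
    intervalIntegral.integral_eq_sub_of_hasDerivAt_of_le hab hG hderiv hint]

/-- A bound of an integral over the circle by the antiderivative of a majorant. The integrand is a
function of `θ` that is bounded in terms of the distance `x` of `θ` to the origin. -/
theorem lintegral_circle_le_of_deriv {g : Angle → ℝ≥0∞} {f G : ℝ → ℝ} {s : ℝ} (hs : 0 ≤ s)
    (hg : ∀ x : ℝ, |x| ∈ Set.Ioo 0 s → |x| < Real.pi → g (x : Angle) ≤ ENNReal.ofReal (f |x|))
    (hg0 : ∀ x : ℝ, s ≤ |x| → |x| < Real.pi → g (x : Angle) = 0)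
    (hG : ContinuousOn G (Set.Icc 0 s)) (hderiv : ∀ x ∈ Set.Ioo 0 s, HasDerivAt G (f x) x)
    (hf : ∀ x ∈ Set.Ioo 0 s, 0 ≤ f x) :
    ∫⁻ θ, g θ ∂circleMeasure ≤ ENNReal.ofReal (G s - G 0) := by
  have key (y : ℝ) (hy : |y| ∈ Set.Ioo 0 Real.pi) : g (y : Angle)
      ≤ (Set.Ioo 0 s).indicator (fun x => ENNReal.ofReal (f x)) |y| := by
    by_cases h : |y| < s
    · rw [Set.indicator_of_mem (show |y| ∈ Set.Ioo 0 s from ⟨hy.1, h⟩)]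
      exact hg y ⟨hy.1, h⟩ hy.2
    · rw [hg0 y (not_lt.mp h) hy.2]
      exact zero_le
  rw [← lintegral_deriv hs hG hderiv hf, ← lintegral_indicator measurableSet_Ioo]
  refine le_trans (lintegral_circle_le (f := (Set.Ioo 0 s).indicator
    (fun x => ENNReal.ofReal (f x))) (fun x hx => ?_) (fun x hx => ?_))
    (setLIntegral_le_lintegral _ _)
  · have h := key x (by rwa [abs_of_pos hx.1])
    rwa [abs_of_pos hx.1] at h
  · have h := key (-x) (by rwa [abs_neg, abs_of_pos hx.1])
    rwa [abs_neg, abs_of_pos hx.1] at h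

/-- `∫ dθ / (a + ω(θ)) ≲ a^{-1/2}`. -/
theorem lintegral_inv_add_omega1_le {a : ℝ} (ha : 0 < a) :
    ∫⁻ θ, ENNReal.ofReal (a + omega1 θ)⁻¹ ∂circleMeasure ≤ ENNReal.ofReal (4 / √a) := by
  have hsa : 0 < √a := Real.sqrt_pos.mpr ha
  have h := lintegral_circle_le_of_deriv (g := fun θ => ENNReal.ofReal (a + omega1 θ)⁻¹)
    (f := fun x => (a + x ^ 2 / 4)⁻¹) (G := fun x => 2 / √a * Real.arctan (x / (2 * √a)))
    Real.pi_pos.le ?_ ?_ (by fun_prop) ?_ ?_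
  · refine h.trans (ENNReal.ofReal_le_ofReal ?_)
    simp only [zero_div, Real.arctan_zero, mul_zero, sub_zero]
    rw [div_mul_eq_mul_div]
    gcongr
    linarith [Real.arctan_lt_pi_div_two (Real.pi / (2 * √a)), Real.pi_lt_four]
  · intro x _ hx
    refine ENNReal.ofReal_le_ofReal (inv_anti₀ (by positivity) ?_)
    rw [sq_abs]
    linarith [le_omega1_coe hx.le]
  · intro x h1 h2
    linarith
  · intro x _
    have h := (((hasDerivAt_id x).div_const (2 * √a)).arctan).const_mul (2 / √a)
    refine h.congr_deriv ?_
    simp only [id]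
    have h2 : √a ^ 2 = a := Real.sq_sqrt ha.le
    rw [div_pow, mul_pow, h2]
    field_simp
    rw [h2]
    ring
  · intro x _
    positivity

theorem sqrt_add_sq_div_four_ge {a : ℝ} (ha : 0 ≤ a) (x : ℝ) :
    (√a + x) / 3 ≤ √(a + x ^ 2 / 4) := by
  refine Real.le_sqrt_of_sq_le ?_
  nlinarith [Real.sq_sqrt ha, sq_nonneg (√a - x), Real.sqrt_nonneg a]

theorem measurable_omega1 : Measurable omega1 := continuous_omega1.measurable

/-- The singularity `ω(θ)^{-1/4}` is integrable. -/
theorem lintegral_inv_sqrt_sqrt_le {b : ℝ} (hb : 0 ≤ b) :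
    ∫⁻ θ, ENNReal.ofReal (√√(b + omega1 θ))⁻¹ ∂circleMeasure ≤ ENNReal.ofReal 8 := by
  have h := lintegral_circle_le_of_deriv (g := fun θ => ENNReal.ofReal (√√(b + omega1 θ))⁻¹)
    (f := fun x => 2 / √x) (G := fun x => 4 * √x)
    Real.pi_pos.le ?_ ?_ (by fun_prop) ?_ ?_
  · refine h.trans (ENNReal.ofReal_le_ofReal ?_)
    simp only [Real.sqrt_zero, mul_zero, sub_zero]
    have : √Real.pi ≤ 2 := Real.sqrt_le_iff.mpr ⟨by norm_num, by linarith [Real.pi_lt_four]⟩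
    linarith
  · intro x h0 hx
    refine ENNReal.ofReal_le_ofReal ?_
    have h1 : |x| / 4 ≤ √(b + omega1 (x : Angle)) := by
      refine Real.le_sqrt_of_sq_le ?_
      nlinarith [le_omega1_coe hx.le, sq_abs x, sq_nonneg x]
    have h2 : √|x| / 2 ≤ √√(b + omega1 (x : Angle)) := by
      refine Real.le_sqrt_of_sq_le ?_
      rw [div_pow, Real.sq_sqrt (abs_nonneg x)]
      linarith
    have h3 : 0 < √|x| := Real.sqrt_pos.mpr h0.1
    calc _ ≤ (√|x| / 2)⁻¹ := inv_anti₀ (by positivity) h2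
      _ = _ := inv_div _ _
  · intro x h1 h2
    linarith
  · intro x hx
    have h := (Real.hasDerivAt_sqrt hx.1.ne').const_mul 4
    refine h.congr_deriv ?_
    have : 0 < √x := Real.sqrt_pos.mpr hx.1
    field_simp
    ring
  · intro x _
    positivity

/-- `∫ dr ds ω(r)^{-1/4} / (a + ω(r) + ω(s)) ≲ a^{-1/4}`. The singular factor is an inverse in
`ℝ≥0∞`, so that it is infinite and not zero at the origin. -/
theorem lintegral_singular_le {a : ℝ} (ha : 0 < a) :
    ∫⁻ t, (ENNReal.ofReal (√√(omega1 t.1)))⁻¹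
        * ENNReal.ofReal (a + omega1 t.1 + omega1 t.2)⁻¹ ∂torusMeasure
      ≤ ENNReal.ofReal (96 / √√a) := by
  have hm := measurable_omega1
  have hsa : 0 < √a := Real.sqrt_pos.mpr ha
  have hssa : 0 < √√a := Real.sqrt_pos.mpr hsa
  rw [lintegral_prod _ (by fun_prop)]
  have h1 (r : Angle) : ∫⁻ s, (ENNReal.ofReal (√√(omega1 r)))⁻¹
        * ENNReal.ofReal (a + omega1 r + omega1 s)⁻¹ ∂circleMeasure
      ≤ (ENNReal.ofReal (√√(omega1 r)))⁻¹ * ENNReal.ofReal (4 / √(a + omega1 r)) := by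
    rw [lintegral_const_mul _ (by fun_prop)]
    gcongr
    exact lintegral_inv_add_omega1_le (by linarith [omega1_nonneg r])
  refine (lintegral_mono h1).trans ?_
  have h := lintegral_circle_le_of_deriv
    (g := fun r => (ENNReal.ofReal (√√(omega1 r)))⁻¹ * ENNReal.ofReal (4 / √(a + omega1 r)))
    (f := fun x => 24 * (1 / (√x * (√a + x))))
    (G := fun x => 24 * (2 / √√a * Real.arctan (√x / √√a)))
    Real.pi_pos.le ?_ ?_ (by fun_prop) ?_ ?_
  · refine h.trans (ENNReal.ofReal_le_ofReal ?_)
    simp only [Real.sqrt_zero, zero_div, Real.arctan_zero, mul_zero, sub_zero]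
    rw [div_mul_eq_mul_div, mul_div_assoc']
    gcongr
    linarith [Real.arctan_lt_pi_div_two (√Real.pi / √√a), Real.pi_lt_four]
  · intro x h0 hx
    have h1 : |x| / 4 ≤ √(omega1 (x : Angle)) := by
      refine Real.le_sqrt_of_sq_le ?_
      nlinarith [le_omega1_coe hx.le, sq_abs x, sq_nonneg x]
    have h2 : √|x| / 2 ≤ √√(omega1 (x : Angle)) := by
      refine Real.le_sqrt_of_sq_le ?_
      rw [div_pow, Real.sq_sqrt (abs_nonneg x)]
      linarith
    have h3 : 0 < √|x| := Real.sqrt_pos.mpr h0.1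
    have h4 : (√a + |x|) / 3 ≤ √(a + omega1 (x : Angle)) := by
      refine (sqrt_add_sq_div_four_ge ha.le |x|).trans (Real.sqrt_le_sqrt ?_)
      rw [sq_abs]
      linarith [le_omega1_coe hx.le]
    have h5 := h0.1
    rw [← ENNReal.ofReal_inv_of_pos (by linarith), ← ENNReal.ofReal_mul (by positivity)]
    refine ENNReal.ofReal_le_ofReal ?_
    calc (√√(omega1 (x : Angle)))⁻¹ * (4 / √(a + omega1 (x : Angle)))
        ≤ (√|x| / 2)⁻¹ * (4 / ((√a + |x|) / 3)) := by gcongr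
      _ = 24 * (1 / (√|x| * (√a + |x|))) := by field_simp; ring
  · intro x h1 h2
    linarith
  · intro x hx
    have hx0 : 0 < √x := Real.sqrt_pos.mpr hx.1
    have h := (((((Real.hasDerivAt_sqrt hx.1.ne').div_const (√√a)).arctan).const_mul
      (2 / √√a))).const_mul 24
    refine h.congr_deriv ?_
    rw [div_pow, Real.sq_sqrt hx.1.le, Real.sq_sqrt hsa.le]
    have h2 : √√a ^ 2 = √a := Real.sq_sqrt hsa.le
    have hx1 := hx.1
    field_simp
    exact h2.symm
  · intro x hx
    have := hx.1
    positivity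

/-- `∫ dr ds / (a + ω(r) + ω(s)) ≲ log(1 / a)`. -/
theorem lintegral_inv_torus_le {a : ℝ} (ha : 0 < a) (ha1 : a ≤ 1) :
    ∫⁻ t, ENNReal.ofReal (a + omega1 t.1 + omega1 t.2)⁻¹ ∂torusMeasure
      ≤ ENNReal.ofReal (24 + 6 * (-Real.log a)) := by
  have hm := measurable_omega1
  have hsa : 0 < √a := Real.sqrt_pos.mpr ha
  rw [lintegral_prod _ (by fun_prop)]
  have h1 (r : Angle) : ∫⁻ s, ENNReal.ofReal (a + omega1 r + omega1 s)⁻¹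
      ∂circleMeasure ≤ ENNReal.ofReal (4 / √(a + omega1 r)) :=
    lintegral_inv_add_omega1_le (by linarith [omega1_nonneg r])
  refine (lintegral_mono h1).trans ?_
  have h := lintegral_circle_le_of_deriv
    (g := fun r => ENNReal.ofReal (4 / √(a + omega1 r)))
    (f := fun x => 12 * (1 / (√a + x)))
    (G := fun x => 12 * Real.log (√a + x))
    Real.pi_pos.le ?_ ?_ ?_ ?_ ?_
  · refine h.trans (ENNReal.ofReal_le_ofReal ?_)
    have h2 : Real.log (√a) = Real.log a / 2 := Real.log_sqrt ha.le
    have h3 : √a ≤ 1 := Real.sqrt_le_one.mpr ha1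
    have h4 : Real.log (√a + Real.pi) ≤ 2 := by
      rw [Real.log_le_iff_le_exp (by linarith [Real.pi_pos])]
      have h5 : Real.exp 2 = Real.exp 1 * Real.exp 1 := by rw [← Real.exp_add]; norm_num
      rw [h5]
      nlinarith [Real.exp_one_gt_d9, Real.pi_lt_four]
    rw [add_zero, h2]
    linarith
  · intro x _ hx
    refine ENNReal.ofReal_le_ofReal ?_
    have h4 : (√a + |x|) / 3 ≤ √(a + omega1 (x : Angle)) := by
      refine (sqrt_add_sq_div_four_ge ha.le |x|).trans (Real.sqrt_le_sqrt ?_)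
      rw [sq_abs]
      linarith [le_omega1_coe hx.le]
    calc 4 / √(a + omega1 (x : Angle)) ≤ 4 / ((√a + |x|) / 3) := by gcongr
      _ = 12 * (1 / (√a + |x|)) := by field_simp; ring
  · intro x h1 h2
    linarith
  · refine continuousOn_const.mul (ContinuousOn.log (by fun_prop) fun x hx => ?_)
    linarith [hx.1]
  · intro x hx
    have h := (((hasDerivAt_id x).const_add (√a)).log (by simp only [id]; linarith [hx.1])).const_mul
      12
    exact h
  · intro x hx
    have := hx.1
    positivity

theorem lintegral_inv_sqrt_add_le {b : ℝ} (hb : 0 < b) :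
    ∫⁻ t, ENNReal.ofReal (8 * (√(b + omega1 t.2) + omega1 t.1)⁻¹) ∂torusMeasure
      ≤ ENNReal.ofReal 256 := by
  have hm := measurable_omega1
  rw [lintegral_prod_symm _ (by fun_prop)]
  have h1 (s : Angle) : ∫⁻ r, ENNReal.ofReal (8 * (√(b + omega1 s) + omega1 r)⁻¹) ∂circleMeasure
      ≤ ENNReal.ofReal 32 * ENNReal.ofReal (√√(b + omega1 s))⁻¹ := by
    have hs := omega1_nonneg s
    simp_rw [ENNReal.ofReal_mul (show (0 : ℝ) ≤ 8 by norm_num)]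
    rw [lintegral_const_mul _ (by fun_prop)]
    refine (mul_le_mul_right (lintegral_inv_add_omega1_le (a := √(b + omega1 s))
      (Real.sqrt_pos.mpr (by linarith))) _).trans_eq ?_
    rw [← ENNReal.ofReal_mul (by norm_num), ← ENNReal.ofReal_mul (by norm_num)]
    congr 1
    ring
  refine (lintegral_mono h1).trans ?_
  rw [lintegral_const_mul _ (by fun_prop)]
  refine (mul_le_mul_right (lintegral_inv_sqrt_sqrt_le hb.le) _).trans_eq ?_
  rw [← ENNReal.ofReal_mul (by norm_num)]
  norm_num

/-- The logarithmic integral with a logarithmic weight in one direction: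
`∫ dr ds / (b + ω(s) + ω(r) |log(b + ω(s))|^κ) ≲ |log b|^{1 - κ/2}` near the origin. -/
theorem lintegral_log_weight_le {b κ : ℝ} (hb : 0 < b) (hb1 : b ≤ 1 / 1296) (hκ : 0 ≤ κ)
    (hκ1 : κ ≤ 1) :
    ∫⁻ t, {t : Momentum | b + omega1 t.2 ≤ 1 / 1296}.indicator (fun t => ENNReal.ofReal
        (4 * (b + omega1 t.2 + omega1 t.1 * (-Real.log (b + omega1 t.2)) ^ κ)⁻¹)) t ∂torusMeasure
      ≤ ENNReal.ofReal (96 * (-Real.log b) ^ (1 - κ / 2)) := by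
  have hm := measurable_omega1
  have hsb : 0 < √b := Real.sqrt_pos.mpr hb
  have hsb1 : √b ≤ 1 / 36 := Real.sqrt_le_iff.mpr ⟨by norm_num, by norm_num; linarith⟩
  have hset : MeasurableSet {t : Momentum | b + omega1 t.2 ≤ 1 / 1296} :=
    measurableSet_le (by fun_prop) measurable_const
  rw [lintegral_prod_symm _ (by
    refine Measurable.aemeasurable (Measurable.indicator ?_ hset)
    fun_prop)]
  have h1 (s : Angle) : ∫⁻ r, {t : Momentum | b + omega1 t.2 ≤ 1 / 1296}.indicator
      (fun t => ENNReal.ofReal (4 * (b + omega1 t.2 + omega1 t.1 *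
        (-Real.log (b + omega1 t.2)) ^ κ)⁻¹)) (r, s) ∂circleMeasure
      ≤ {s : Angle | b + omega1 s ≤ 1 / 1296}.indicator (fun s => ENNReal.ofReal
        (16 / (√(b + omega1 s) * (-Real.log (b + omega1 s)) ^ (κ / 2)))) s := by
    have hs := omega1_nonneg s
    by_cases hw : b + omega1 s ≤ 1 / 1296
    · rw [Set.indicator_of_mem (show s ∈ {s : Angle | b + omega1 s ≤ 1 / 1296} from hw)]
      have hl : 0 < -Real.log (b + omega1 s) := by
        rw [neg_pos]
        exact Real.log_neg (by linarith) (by linarith)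
      set w := b + omega1 s with hwdef
      have hw0 : 0 < w := by linarith
      set M := (-Real.log w) ^ κ with hM
      have hM0 : 0 < M := Real.rpow_pos_of_pos hl _
      have hMs : √M = (-Real.log w) ^ (κ / 2) := by
        rw [hM, Real.sqrt_eq_rpow, ← Real.rpow_mul hl.le]
        congr 1
        ring
      have h2 (r : Angle) : {t : Momentum | b + omega1 t.2 ≤ 1 / 1296}.indicator
          (fun t => ENNReal.ofReal (4 * (b + omega1 t.2 + omega1 t.1 *
          (-Real.log (b + omega1 t.2)) ^ κ)⁻¹)) (r, s)
          = ENNReal.ofReal (4 / M) * ENNReal.ofReal (w / M + omega1 r)⁻¹ := by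
        rw [Set.indicator_of_mem (show (r, s) ∈ {t : Momentum | b + omega1 t.2 ≤ 1 / 1296} from hw),
          ← ENNReal.ofReal_mul (by positivity)]
        congr 1
        simp only [← hwdef, ← hM]
        have hr := omega1_nonneg r
        have h3 : 0 < w + omega1 r * M := by positivity
        have h4 : 0 < w / M + omega1 r := by positivity
        field_simp
      simp_rw [h2]
      rw [lintegral_const_mul _ (by fun_prop)]
      refine (mul_le_mul_right (lintegral_inv_add_omega1_le (by positivity)) _).trans_eq ?_
      rw [← ENNReal.ofReal_mul (by positivity), ← hMs, Real.sqrt_div hw0.le]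
      congr 1
      have h5 : 0 < √M := Real.sqrt_pos.mpr hM0
      have h6 : 0 < √w := Real.sqrt_pos.mpr hw0
      field_simp
      rw [Real.sq_sqrt hM0.le]
      ring
    · have h2 (r : Angle) : {t : Momentum | b + omega1 t.2 ≤ 1 / 1296}.indicator
          (fun t => ENNReal.ofReal (4 * (b + omega1 t.2 + omega1 t.1 *
          (-Real.log (b + omega1 t.2)) ^ κ)⁻¹)) (r, s) = 0 :=
        Set.indicator_of_notMem (by simpa using hw) _
      simp_rw [h2]
      simp
  refine (lintegral_mono h1).trans ?_
  have hp : 0 < 1 - κ / 2 := by linarith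
  -- With `v = √b + s` one has `v² / 9 ≤ b + ω(s) ≤ v²`, and `v⁻¹ (-log v)^(-κ/2)` has an explicit
  -- antiderivative.
  have hlogv {x : ℝ} (hx0 : 0 ≤ x) (hx1 : x ≤ 1 / 8 - √b) : 0 < -Real.log (√b + x) := by
    rw [neg_pos]
    exact Real.log_neg (by linarith) (by linarith)
  have h := lintegral_circle_le_of_deriv
    (g := {s : Angle | b + omega1 s ≤ 1 / 1296}.indicator (fun s => ENNReal.ofReal
        (16 / (√(b + omega1 s) * (-Real.log (b + omega1 s)) ^ (κ / 2)))))
    (f := fun x => 48 * ((√b + x)⁻¹ * (-Real.log (√b + x)) ^ (-(κ / 2))))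
    (G := fun x => 48 * (-((1 - κ / 2)⁻¹ * (-Real.log (√b + x)) ^ (1 - κ / 2))))
    (s := 1 / 8 - √b) (by linarith) ?_ ?_ ?_ ?_ ?_
  · refine h.trans (ENNReal.ofReal_le_ofReal ?_)
    have h2 : 0 ≤ (-Real.log (√b + (1 / 8 - √b))) ^ (1 - κ / 2) :=
      Real.rpow_nonneg (hlogv (by linarith) le_rfl).le _
    have hb2 : 0 < -Real.log b := neg_pos.mpr (Real.log_neg hb (by linarith))
    have h3 : (-Real.log (√b + 0)) ^ (1 - κ / 2) ≤ (-Real.log b) ^ (1 - κ / 2) := by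
      rw [add_zero, Real.log_sqrt hb.le]
      refine Real.rpow_le_rpow (by linarith) (by linarith) hp.le
    have h4 : (1 - κ / 2)⁻¹ ≤ 2 := by
      rw [inv_le_comm₀ hp (by norm_num)]
      linarith
    have h5 : 0 < (1 - κ / 2)⁻¹ := inv_pos.mpr hp
    have h6 : 0 ≤ (-Real.log b) ^ (1 - κ / 2) := Real.rpow_nonneg hb2.le _
    have h9 : 0 ≤ (-Real.log (√b + 0)) ^ (1 - κ / 2) :=
      Real.rpow_nonneg (hlogv le_rfl (by linarith)).le _
    have h7 : (1 - κ / 2)⁻¹ * (-Real.log (√b + 0)) ^ (1 - κ / 2)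
        ≤ 2 * (-Real.log b) ^ (1 - κ / 2) := by gcongr
    have h8 := mul_nonneg h5.le h2
    linarith
  · intro x hx0 hx
    by_cases hw : b + omega1 (x : Angle) ≤ 1 / 1296
    · rw [Set.indicator_of_mem (show (x : Angle) ∈ {s : Angle | b + omega1 s ≤ 1 / 1296} from hw)]
      refine ENNReal.ofReal_le_ofReal ?_
      have hlv := hlogv hx0.1.le hx0.2.le
      have hv : 0 < √b + |x| := by linarith [hx0.1]
      have hw0 : 0 < b + omega1 (x : Angle) := by linarith [omega1_nonneg (x : Angle)]
      have h4 : (√b + |x|) / 3 ≤ √(b + omega1 (x : Angle)) := by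
        refine (sqrt_add_sq_div_four_ge hb.le |x|).trans (Real.sqrt_le_sqrt ?_)
        rw [sq_abs]
        linarith [le_omega1_coe hx.le]
      have h5 : b + omega1 (x : Angle) ≤ √b + |x| := by
        have h6 := omega1_coe_le x
        have h7 : |x| ≤ 1 := by linarith [hx0.2]
        rw [← sq_abs] at h6
        nlinarith [hx0.1, Real.sq_sqrt hb.le]
      have h6 : -Real.log (√b + |x|) ≤ -Real.log (b + omega1 (x : Angle)) :=
        neg_le_neg (Real.log_le_log hw0 h5)
      have h7 : (-Real.log (√b + |x|)) ^ (κ / 2) ≤ (-Real.log (b + omega1 (x : Angle))) ^ (κ / 2) :=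
        Real.rpow_le_rpow hlv.le h6 (by linarith)
      have h8 : 0 < (-Real.log (√b + |x|)) ^ (κ / 2) := Real.rpow_pos_of_pos hlv _
      calc _ ≤ 16 / ((√b + |x|) / 3 * (-Real.log (√b + |x|)) ^ (κ / 2)) := by gcongr
        _ = _ := by
          rw [Real.rpow_neg hlv.le]
          field_simp
          ring
    · rw [Set.indicator_of_notMem (by simpa using hw)]
      exact zero_le
  · intro x hx0 hx
    refine Set.indicator_of_notMem ?_ _
    rw [Set.mem_ofPred_eq, not_le]
    have h6 := le_omega1_coe hx.le
    have h7 : 1 / 8 ≤ √b + |x| := by linarith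
    nlinarith [Real.sq_sqrt hb.le, sq_nonneg (√b - |x|), sq_abs x]
  · refine continuousOn_const.mul (ContinuousOn.neg (continuousOn_const.mul
      (ContinuousOn.rpow_const (ContinuousOn.neg (ContinuousOn.log (by fun_prop) ?_)) ?_)))
    · intro x hx
      linarith [hx.1]
    · intro x _
      exact Or.inr hp.le
  · intro x hx
    have hlv := hlogv hx.1.le hx.2.le
    have hv : √b + x ≠ 0 := by linarith [hx.1]
    have h := (((((((hasDerivAt_id x).const_add (√b)).log hv).neg).rpow_const
      (p := 1 - κ / 2) (Or.inl hlv.ne')).const_mul (1 - κ / 2)⁻¹).neg).const_mul 48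
    refine h.congr_deriv ?_
    simp only [id, Pi.neg_apply]
    have h1 : 1 - κ / 2 - 1 = -(κ / 2) := by ring
    have h2 : 2 - κ ≠ 0 := by linarith
    rw [h1]
    field_simp
  · intro x hx
    have hlv := hlogv hx.1.le hx.2.le
    have := hx.1
    positivity

/-- A lower bound for the logarithmic integral, from the region `r ≤ s / √M`, `s₀ ≤ s ≤ s₁`. -/
theorem le_lintegral_torus {f : Momentum → ℝ≥0∞} (hf : Measurable f) {K M s₀ s₁ : ℝ} (hK : 0 < K)
    (hM : 1 ≤ M) (hs₀ : 0 < s₀) (hs : s₀ ≤ s₁) (hs₁ : s₁ ≤ 1)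
    (h : ∀ r s : ℝ, 0 < r → r < s / √M → s₀ < s → s < s₁ →
      ENNReal.ofReal (K * s ^ 2)⁻¹ ≤ f ((r : Angle), (s : Angle))) :
    ENNReal.ofReal (Real.log (s₁ / s₀) / (64 * K * √M)) ≤ ∫⁻ t, f t ∂torusMeasure := by
  have hpi := Real.pi_gt_three
  have hM1 : 1 ≤ √M := Real.one_le_sqrt.mpr hM
  have hM0 : 0 < √M := by linarith
  rw [lintegral_prod_symm _ hf.aemeasurable]
  refine le_trans ?_ (le_lintegral_circle (a := s₀) (b := s₁) hs₀.le (by linarith)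
    (f := fun s => ENNReal.ofReal (1 / (8 * K * √M) * s⁻¹)) fun s hs => ?_)
  · rw [lintegral_deriv (G := fun s => 1 / (8 * K * √M) * Real.log s) hs,
      ← ENNReal.ofReal_mul (by norm_num), Real.log_div (by linarith) hs₀.ne']
    · refine ENNReal.ofReal_le_ofReal (le_of_eq ?_)
      field_simp
      ring
    · refine continuousOn_const.mul (ContinuousOn.log (by fun_prop) fun x hx => ?_)
      linarith [hx.1]
    · intro x hx
      exact (Real.hasDerivAt_log (by linarith [hx.1])).const_mul _
    · intro x hx
      have : 0 < x := by linarith [hx.1]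
      positivity
  · have hs0 : 0 < s := by linarith [hs.1]
    refine le_trans ?_ (le_lintegral_circle (a := 0) (b := s / √M) le_rfl ?_
      (f := fun _ => ENNReal.ofReal (K * s ^ 2)⁻¹) fun r hr => h r s hr.1 hr.2 hs.1 hs.2)
    · rw [lintegral_const, Measure.restrict_apply_univ, Real.volume_Ioo, sub_zero,
        ← ENNReal.ofReal_mul (by positivity), ← ENNReal.ofReal_mul (by norm_num)]
      refine ENNReal.ofReal_le_ofReal (le_of_eq ?_)
      field_simp
    · rw [div_le_iff₀ hM0]
      nlinarith [hs.2]

/-! ### Splitting a momentum -/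

/-- The inverse of merging: `split m k (q, t)` is the configuration that has momentum `t` at the
place `m` and whose momenta number `m` and `m.succAbove k` merge to `q k`. -/
def split {n : ℕ} (m : Fin (n + 1)) (k : Fin n) : shell n × Momentum →+ shell (n + 1) where
  toFun z := ⟨m.insertNth (α := fun _ => Momentum) z.2
      (fun i => z.1.1 i - (if i = k then z.2 else 0)), by
    have h := mem_shell.mp z.1.2
    rw [mem_shell, Fin.sum_univ_succAbove _ m]
    simp [Finset.sum_sub_distrib, h]⟩
  map_zero' := by
    apply Subtype.ext
    funext i
    refine m.succAboveCases ?_ (fun j => ?_) i <;> simp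
  map_add' x y := by
    apply Subtype.ext
    funext i
    refine m.succAboveCases ?_ (fun j => ?_) i
    · simp
    · by_cases h : j = k
      · simp only [h, AddSubgroup.coe_add, Pi.add_apply, Fin.insertNth_apply_succAbove, if_true,
          Prod.fst_add, Prod.snd_add]
        abel
      · simp [h]

theorem split_same {n : ℕ} (m : Fin (n + 1)) (k : Fin n) (q : shell n) (t : Momentum) :
    (split m k (q, t)).1 m = t := by
  simp [split]

theorem merge_split {n : ℕ} (m : Fin (n + 1)) (k : Fin n) (q : shell n) (t : Momentum) :
    merge m k (split m k (q, t)) = q := by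
  apply Subtype.ext
  funext i
  simp [merge, split]

theorem split_merge {n : ℕ} (m : Fin (n + 1)) (k : Fin n) (p : shell (n + 1)) :
    split m k (merge m k p, p.1 m) = p := by
  apply Subtype.ext
  funext i
  refine m.succAboveCases ?_ (fun j => ?_) i
  · simp [split]
  · simp [merge, split]

theorem continuous_split {n : ℕ} (m : Fin (n + 1)) (k : Fin n) : Continuous (split m k) := by
  apply Continuous.subtype_mk
  refine continuous_pi fun i => ?_
  refine m.succAboveCases ?_ (fun j => ?_) i
  · simpa using continuous_snd (X := shell n) (Y := Momentum)
  · simp only [Fin.insertNth_apply_succAbove]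
    refine ((continuous_coord j).comp continuous_fst).sub ?_
    split_ifs
    · exact continuous_snd
    · exact continuous_const

theorem split_surjective {n : ℕ} (m : Fin (n + 1)) (k : Fin n) :
    Function.Surjective (split m k) := fun p => ⟨_, split_merge m k p⟩

/-- The Haar probability measure of `shell n`. -/
abbrev shellMeasure (n : ℕ) : Measure (shell n) := Measure.addHaarMeasure ⊤

instance isProbabilityMeasure_shellMeasure (n : ℕ) : IsProbabilityMeasure (shellMeasure n) := by
  have h := Measure.addHaarMeasure_self (K₀ := (⊤ : TopologicalSpace.PositiveCompacts (shell n)))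
  exact ⟨by simpa using h⟩

instance borelSpace_shell_prod (n : ℕ) : BorelSpace (shell n × Momentum) :=
  haveI : SecondCountableTopologyEither (shell n) Momentum := ⟨Or.inr inferInstance⟩
  Prod.borelSpace

instance measurableAdd_shell (n : ℕ) : MeasurableAdd (shell n) where
  measurable_const_add _ := (continuous_const.add continuous_id).measurable
  measurable_add_const _ := (continuous_id.add continuous_const).measurable

instance isAddHaarMeasure_prod (n : ℕ) :
    ((shellMeasure n).prod torusMeasure).IsAddHaarMeasure :=
  Measure.prod.instIsAddHaarMeasure (shellMeasure n) torusMeasure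

theorem measurePreserving_split {n : ℕ} (m : Fin (n + 1)) (k : Fin n) :
    MeasurePreserving (split m k) ((shellMeasure n).prod torusMeasure) (shellMeasure (n + 1)) :=
  (split m k).measurePreserving (continuous_split m k) (split_surjective m k) (by
    rw [measure_univ, measure_univ])

/-- Integration over the fibres of the merging map. -/
theorem lintegral_mu_succ {n : ℕ} (m : Fin (n + 1)) (k : Fin n) {W : shell (n + 1) → ℝ≥0∞}
    (hW : Measurable W) :
    ∫⁻ p, W p ∂mu (n + 1)
      = ((n + 1 : ℕ) : ℝ≥0∞)⁻¹ * ∫⁻ q, ∫⁻ t, W (split m k (q, t)) ∂torusMeasure ∂mu n := by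
  have hc := (continuous_split m k).measurable
  rw [mu, mu, lintegral_smul_measure, lintegral_smul_measure,
    ← (measurePreserving_split m k).lintegral_comp hW,
    lintegral_prod (fun z => W (split m k z)) (hW.comp hc).aemeasurable,
    smul_eq_mul, smul_eq_mul, ← mul_assoc, Nat.factorial_succ, Nat.cast_mul,
    ENNReal.mul_inv (Or.inr (ENNReal.natCast_ne_top _)) (Or.inl (ENNReal.natCast_ne_top _))]

/-! ### Estimates of the dispersion relation under merging -/

theorem omegaR_nonneg {n : ℕ} (p : shell n) : 0 ≤ omegaR p :=
  Finset.sum_nonneg fun _ _ => omega1_nonneg _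

theorem omegaR_le_omega {n : ℕ} (p : shell n) : omegaR p ≤ omega p :=
  Finset.sum_le_sum fun _ _ => le_add_of_nonneg_right (omega1_nonneg _)

theorem omega1_le_omegaR {n : ℕ} (p : shell n) (j : Fin n) : omega1 (p.1 j).1 ≤ omegaR p :=
  Finset.single_le_sum (f := fun j => omega1 (p.1 j).1) (fun _ _ => omega1_nonneg _)
    (Finset.mem_univ j)

theorem add_le_omega {n : ℕ} (p : shell n) (j : Fin n) :
    omega1 (p.1 j).1 + omega1 (p.1 j).2 ≤ omega p :=
  Finset.single_le_sum (f := fun j => omega1 (p.1 j).1 + omega1 (p.1 j).2)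
    (fun _ _ => add_nonneg (omega1_nonneg _) (omega1_nonneg _)) (Finset.mem_univ j)

/-- A subadditivity principle for sums over the momenta: if `g ≥ 0` and
`g (x + y) ≤ 2 (g x + g y)` then the sum of `g` over the momenta at most doubles under merging. -/
theorem sum_merge_le {n : ℕ} {g : Momentum → ℝ} (hg : ∀ x, 0 ≤ g x)
    (hadd : ∀ x y, g (x + y) ≤ 2 * (g x + g y)) (m : Fin (n + 1)) (k : Fin n) (p : shell (n + 1)) :
    ∑ i, g ((merge m k p).1 i) ≤ 2 * ∑ j, g (p.1 j) := by
  have h (i : Fin n) : g ((merge m k p).1 i)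
      ≤ 2 * g (p.1 (m.succAbove i)) + if i = k then 2 * g (p.1 m) else 0 := by
    by_cases hi : i = k
    · have h1 := hadd (p.1 (m.succAbove i)) (p.1 m)
      simp only [merge, AddMonoidHom.coe_mk, ZeroHom.coe_mk, hi, if_true] at h1 ⊢
      linarith
    · have h1 := hg (p.1 (m.succAbove i))
      simp only [merge, AddMonoidHom.coe_mk, ZeroHom.coe_mk, hi, if_false, add_zero]
      linarith
  refine (Finset.sum_le_sum fun i _ => h i).trans (le_of_eq ?_)
  rw [Finset.sum_add_distrib, Finset.sum_ite_eq' Finset.univ k, if_pos (Finset.mem_univ k),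
    Fin.sum_univ_succAbove _ m, ← Finset.mul_sum]
  ring

/-- Conversely, splitting off a momentum `t` at most doubles the sum of `g`, up to `3 g t`. -/
theorem sum_le_sum_merge {n : ℕ} {g : Momentum → ℝ} (hg : ∀ x, 0 ≤ g x)
    (hsub : ∀ x y, g (x - y) ≤ 2 * (g x + g y)) (m : Fin (n + 1)) (k : Fin n) (p : shell (n + 1)) :
    ∑ j, g (p.1 j) ≤ 3 * g (p.1 m) + 2 * ∑ i, g ((merge m k p).1 i) := by
  have h (i : Fin n) : g (p.1 (m.succAbove i))
      ≤ 2 * g ((merge m k p).1 i) + if i = k then 2 * g (p.1 m) else 0 := by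
    by_cases hi : i = k
    · have h1 := hsub (p.1 (m.succAbove i) + p.1 m) (p.1 m)
      rw [add_sub_cancel_right] at h1
      simp only [merge, AddMonoidHom.coe_mk, ZeroHom.coe_mk, hi, if_true] at h1 ⊢
      linarith
    · have h1 := hg (p.1 (m.succAbove i))
      simp only [merge, AddMonoidHom.coe_mk, ZeroHom.coe_mk, hi, if_false, add_zero]
      linarith
  rw [Fin.sum_univ_succAbove _ m]
  have h2 := Finset.sum_le_sum fun i (_ : i ∈ Finset.univ) => h i
  rw [Finset.sum_add_distrib, Finset.sum_ite_eq' Finset.univ k, if_pos (Finset.mem_univ k),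
    ← Finset.mul_sum] at h2
  linarith

theorem omega_merge_le {n : ℕ} (m : Fin (n + 1)) (k : Fin n) (p : shell (n + 1)) :
    omega (merge m k p) ≤ 2 * omega p :=
  sum_merge_le (g := fun x => omega1 x.1 + omega1 x.2)
    (fun x => add_nonneg (omega1_nonneg _) (omega1_nonneg _))
    (fun x y => by
      have h1 := omega1_add_le x.1 y.1
      have h2 := omega1_add_le x.2 y.2
      simp only [Prod.fst_add, Prod.snd_add]
      linarith) m k p

theorem omega_le_merge {n : ℕ} (m : Fin (n + 1)) (k : Fin n) (p : shell (n + 1)) :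
    omega p ≤ 3 * (omega1 (p.1 m).1 + omega1 (p.1 m).2) + 2 * omega (merge m k p) :=
  sum_le_sum_merge (g := fun x => omega1 x.1 + omega1 x.2)
    (fun x => add_nonneg (omega1_nonneg _) (omega1_nonneg _))
    (fun x y => by
      have h1 := omega1_sub_le x.1 y.1
      have h2 := omega1_sub_le x.2 y.2
      simp only [Prod.fst_sub, Prod.snd_sub]
      linarith) m k p

theorem omegaR_le_merge {n : ℕ} (m : Fin (n + 1)) (k : Fin n) (p : shell (n + 1)) :
    omegaR p ≤ 3 * omega1 (p.1 m).1 + 2 * omegaR (merge m k p) :=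
  sum_le_sum_merge (g := fun x => omega1 x.1) (fun _ => omega1_nonneg _)
    (fun x y => omega1_sub_le x.1 y.1) m k p

theorem merge_apply_same {n : ℕ} (m : Fin (n + 1)) (k : Fin n) (p : shell (n + 1)) :
    (merge m k p).1 k = p.1 (m.succAbove k) + p.1 m := by
  simp [merge]

theorem merge_apply_of_ne {n : ℕ} (m : Fin (n + 1)) {k i : Fin n} (h : i ≠ k)
    (p : shell (n + 1)) : (merge m k p).1 i = p.1 (m.succAbove i) := by
  simp [merge, h]

/-! ### The symmetrised form of `A₊` -/

/-- Exchange of the two indices of an ordered pair `(m, m.succAbove k)` of distinct indices. -/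
def swapPair {n : ℕ} (e : Fin (n + 1) × Fin n) : Fin (n + 1) × Fin n :=
  (e.1.succAbove e.2, e.2.predAbove e.1)

theorem swapPair_swapPair {n : ℕ} (e : Fin (n + 1) × Fin n) : swapPair (swapPair e) = e :=
  Prod.ext (Fin.succAbove_succAbove_predAbove _ _) (Fin.predAbove_predAbove_succAbove _ _)

theorem swapPair_ne {n : ℕ} (e : Fin (n + 1) × Fin n) : swapPair e ≠ e := fun h =>
  Fin.succAbove_ne e.1 e.2 (congrArg Prod.fst h)

theorem succAbove_swapPair {n : ℕ} (e : Fin (n + 1) × Fin n) :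
    (swapPair e).1.succAbove (swapPair e).2 = e.1 :=
  Fin.succAbove_succAbove_predAbove _ _

/-- The exchange of the indices as a permutation of the set of ordered pairs. -/
def swapEquiv (n : ℕ) : Equiv.Perm (Fin (n + 1) × Fin n) :=
  Function.Involutive.toPerm swapPair swapPair_swapPair

/-- Merging does not depend on the order of the two indices, up to a permutation of the result. -/
theorem exists_permute_merge_swapPair {n : ℕ} (e : Fin (n + 1) × Fin n) :
    ∃ π : Equiv.Perm (Fin n), ∀ p : shell (n + 1),
      merge e.1 e.2 p = permute π (merge (swapPair e).1 (swapPair e).2 p) := by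
  obtain ⟨m, k⟩ := e
  refine ⟨inducedPerm (Equiv.swap m (m.succAbove k)) m, fun p => ?_⟩
  have h1 := merge_permute (Equiv.swap m (m.succAbove k)) m k p
  have h2 : (swapPair (m, k)).2 = inducedPerm (Equiv.swap m (m.succAbove k)) m k := by
    have h3 := succAbove_inducedPerm (Equiv.swap m (m.succAbove k)) m k
    rw [Equiv.swap_apply_right, Equiv.swap_apply_left] at h3
    refine Fin.succAbove_right_injective (p := m.succAbove k) ?_
    rw [h3]
    exact succAbove_swapPair (m, k)
  rw [Equiv.swap_apply_left] at h1
  rw [h2]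
  change merge m k p = permute _ (merge (m.succAbove k) _ p)
  rw [← h1]
  apply Subtype.ext
  funext i
  by_cases hi : i = k
  · subst hi
    rw [merge_apply_same, merge_apply_same]
    simp only [permute, AddMonoidHom.coe_mk, ZeroHom.coe_mk, Equiv.swap_apply_left,
      Equiv.swap_apply_right]
    exact add_comm _ _
  · rw [merge_apply_of_ne m hi, merge_apply_of_ne m hi]
    simp only [permute, AddMonoidHom.coe_mk, ZeroHom.coe_mk]
    rw [Equiv.swap_apply_of_ne_of_ne (Fin.succAbove_ne m i)
      (fun h => hi (Fin.succAbove_right_injective h))]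

/-- The symmetrised factor `e^{i r_j} - e^{-i r_m} + e^{i r_m} - e^{-i r_j}` of the pair
`e = (m, k)`, where `j = m.succAbove k`. -/
def pairFactor {n : ℕ} (e : Fin (n + 1) × Fin n) (p : shell (n + 1)) : ℂ :=
  creationFactor e.1 e.2 p + creationFactor (swapPair e).1 (swapPair e).2 p

/-- The dispersion relation of the sum of the two first components of the momenta of a pair. -/
def pairOmega {n : ℕ} (e : Fin (n + 1) × Fin n) (p : shell (n + 1)) : ℝ :=
  omega1 ((merge e.1 e.2 p).1 e.2).1

theorem pairFactor_swapPair {n : ℕ} (e : Fin (n + 1) × Fin n) (p : shell (n + 1)) :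
    pairFactor (swapPair e) p = pairFactor e p := by
  rw [pairFactor, swapPair_swapPair, add_comm, ← pairFactor]

theorem pairOmega_nonneg {n : ℕ} (e : Fin (n + 1) × Fin n) (p : shell (n + 1)) :
    0 ≤ pairOmega e p := omega1_nonneg _

theorem pairOmega_swapPair {n : ℕ} (e : Fin (n + 1) × Fin n) (p : shell (n + 1)) :
    pairOmega (swapPair e) p = pairOmega e p := by
  rw [pairOmega, pairOmega, merge_apply_same, merge_apply_same, succAbove_swapPair]
  exact congrArg (fun x : Momentum => omega1 x.1) (add_comm _ _)

/-- `|sin r_j + sin r_m|² = 4 sin²((r_j + r_m)/2) cos²((r_j - r_m)/2)` in terms of the dispersion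
relation. The factor vanishes as `r_j + r_m → 0`. -/
theorem norm_pairFactor_sq {n : ℕ} (e : Fin (n + 1) × Fin n) (p : shell (n + 1)) :
    ‖pairFactor e p‖ ^ 2
      = (4 - omega1 ((p.1 (e.1.succAbove e.2)).1 - (p.1 e.1).1)) * pairOmega e p := by
  rw [pairOmega, merge_apply_same]
  simp only [pairFactor, creationFactor, succAbove_swapPair]
  change ‖phase (p.1 (e.1.succAbove e.2)).1 - phase (-(p.1 e.1).1)
    + (phase (p.1 e.1).1 - phase (-(p.1 (e.1.succAbove e.2)).1))‖ ^ 2 = _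
  set a := (p.1 (e.1.succAbove e.2)).1
  set b := (p.1 e.1).1
  rw [Prod.fst_add]
  change _ = _ * omega1 (a + b)
  rw [omega1_eq, omega1_eq, sub_eq_add_neg a b, phase_add, phase_add, phase_neg, phase_neg,
    ← Complex.normSq_eq_norm_sq, Complex.normSq_apply]
  have ha := phase_mul_star a
  have hb := phase_mul_star b
  have ha' := congrArg Complex.re ha
  have hb' := congrArg Complex.re hb
  simp only [Complex.star_def, Complex.mul_re, Complex.conj_re, Complex.conj_im, Complex.one_re,
    Complex.add_re, Complex.add_im, Complex.sub_re, Complex.sub_im] at *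
  set x := (phase a).re
  set y := (phase a).im
  set u := (phase b).re
  set v := (phase b).im
  have h1 : y * y = 1 - x * x := by linarith
  have h2 : v * v = 1 - u * u := by linarith
  linear_combination (4 - 4 * v * v) * h1 + 4 * x * x * h2

theorem norm_pairFactor_sq_le {n : ℕ} (e : Fin (n + 1) × Fin n) (p : shell (n + 1)) :
    ‖pairFactor e p‖ ^ 2 ≤ 4 * pairOmega e p := by
  rw [norm_pairFactor_sq]
  refine mul_le_mul_of_nonneg_right ?_ (pairOmega_nonneg e p)
  have h := omega1_nonneg ((p.1 (e.1.succAbove e.2)).1 - (p.1 e.1).1)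
  linarith

theorem le_norm_pairFactor_sq {n : ℕ} (e : Fin (n + 1) × Fin n) {p : shell (n + 1)}
    (hp : omega p ≤ 1 / 2) : 2 * pairOmega e p ≤ ‖pairFactor e p‖ ^ 2 := by
  rw [norm_pairFactor_sq]
  refine mul_le_mul_of_nonneg_right ?_ (pairOmega_nonneg e p)
  have h1 := omega1_sub_le (p.1 (e.1.succAbove e.2)).1 (p.1 e.1).1
  have h2 := (omega1_le_omegaR p (e.1.succAbove e.2)).trans (omegaR_le_omega p)
  have h3 := (omega1_le_omegaR p e.1).trans (omegaR_le_omega p)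
  linarith

theorem continuous_pairFactor {n : ℕ} (e : Fin (n + 1) × Fin n) : Continuous (pairFactor e) := by
  have h (m : Fin (n + 1)) (k : Fin n) : Continuous (creationFactor m k) :=
    (continuous_phase.comp (continuous_fst.comp (continuous_coord _))).sub
      (continuous_phase.comp (continuous_fst.comp (continuous_coord _)).neg)
  exact (h _ _).add (h _ _)

theorem continuous_pairOmega {n : ℕ} (e : Fin (n + 1) × Fin n) : Continuous (pairOmega e) :=
  continuous_omega1.comp (continuous_fst.comp ((continuous_coord _).comp (continuous_merge _ _)))

/-- The contribution of the ordered pair `e` to the symmetrised form of `A₊ F`. -/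
def pairTerm {n : ℕ} (F : shell n → ℂ) (e : Fin (n + 1) × Fin n) (p : shell (n + 1)) : ℂ :=
  -(1 / 4) * (pairFactor e p * F (merge e.1 e.2 p))

theorem ae_merge_swapPair {n : ℕ} (F : SymL2 n) : ∀ᵐ p ∂mu (n + 1), ∀ e : Fin (n + 1) × Fin n,
    (F : Lp ℂ 2 (mu n)) (merge (swapPair e).1 (swapPair e).2 p)
      = (F : Lp ℂ 2 (mu n)) (merge e.1 e.2 p) := by
  rw [ae_all_iff]
  intro e
  obtain ⟨π, hπ⟩ := exists_permute_merge_swapPair e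
  have h := (quasi_merge (swapPair e).1 (swapPair e).2).ae (mem_symL2_iff.mp F.2 π)
  filter_upwards [h] with p hp
  rw [hπ p, hp]

theorem creation_ae_eq {n : ℕ} (F : SymL2 n) : ∀ᵐ p ∂mu (n + 1),
    (creation n F : Lp ℂ 2 (mu (n + 1))) p = ∑ e, pairTerm (F : Lp ℂ 2 (mu n)) e p := by
  filter_upwards [creation_coe F, ae_merge_swapPair F] with p h1 h2
  rw [h1, creationFun]
  have h3 : ∑ m : Fin (n + 1), ∑ k : Fin n, creationFactor m k p
        * (F : Lp ℂ 2 (mu n)) (merge m k p)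
      = ∑ e : Fin (n + 1) × Fin n, creationFactor e.1 e.2 p
        * (F : Lp ℂ 2 (mu n)) (merge e.1 e.2 p) :=
    (Fintype.sum_prod_type' (fun m k => creationFactor m k p
      * (F : Lp ℂ 2 (mu n)) (merge m k p))).symm
  have h4 := Equiv.sum_comp (swapEquiv n) (fun e => creationFactor e.1 e.2 p
        * (F : Lp ℂ 2 (mu n)) (merge e.1 e.2 p))
  have h5 : ∑ e : Fin (n + 1) × Fin n, pairFactor e p * (F : Lp ℂ 2 (mu n)) (merge e.1 e.2 p)
      = 2 * ∑ e : Fin (n + 1) × Fin n, creationFactor e.1 e.2 p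
        * (F : Lp ℂ 2 (mu n)) (merge e.1 e.2 p) := by
    refine Eq.trans ?_ ((congrArg₂ (· + ·) rfl h4).trans (two_mul _).symm)
    rw [← Finset.sum_add_distrib]
    refine Finset.sum_congr rfl fun e _ => ?_
    change _ = _ + creationFactor (swapPair e).1 (swapPair e).2 p
      * (F : Lp ℂ 2 (mu n)) (merge (swapPair e).1 (swapPair e).2 p)
    rw [h2 e, pairFactor]
    ring
  simp only [pairTerm]
  rw [h3, ← Finset.mul_sum, h5]
  ring

/-! ### Quadratic forms of Fourier multipliers -/

theorem measurable_coe_symL2 {n : ℕ} (F : SymL2 n) :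
    Measurable ((F : Lp ℂ 2 (mu n)) : shell n → ℂ) :=
  (Lp.stronglyMeasurable (F : Lp ℂ 2 (mu n))).measurable

theorem integrable_mul_norm_sq {n : ℕ} {φ : shell n → ℝ} (hφ : Measurable φ)
    (hb : ∃ C, ∀ p, |φ p| ≤ C) (F : SymL2 n) :
    Integrable (fun p => φ p * ‖(F : Lp ℂ 2 (mu n)) p‖ ^ 2) (mu n) := by
  obtain ⟨C, hC⟩ := hb
  have h : Integrable (fun p => ‖(F : Lp ℂ 2 (mu n)) p‖ ^ 2) (mu n) :=
    (Lp.memLp (F : Lp ℂ 2 (mu n))).integrable_norm_pow (p := 2) (by norm_num)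
  exact h.bdd_mul hφ.aestronglyMeasurable (Filter.Eventually.of_forall hC)

theorem inner_mulOp {n : ℕ} {φ : shell n → ℝ} (hφ : IsSymbol φ) (F : SymL2 n) :
    (⟪F, mulOp φ F⟫_ℂ).re = ∫ p, φ p * ‖(F : Lp ℂ 2 (mu n)) p‖ ^ 2 ∂mu n := by
  have h : ⟪F, mulOp φ F⟫_ℂ
      = ∫ p, ((φ p * ‖(F : Lp ℂ 2 (mu n)) p‖ ^ 2 : ℝ) : ℂ) ∂mu n := by
    rw [Submodule.coe_inner, L2.inner_def]
    refine integral_congr_ae ?_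
    filter_upwards [mulOp_coe hφ F] with p hp
    rw [hp, RCLike.inner_apply, mul_assoc, Complex.mul_conj, Complex.normSq_eq_norm_sq]
    push_cast
    rfl
  rw [h, integral_complex_ofReal, Complex.ofReal_re]

theorem isSelfAdjoint_mulOp {n : ℕ} {φ : shell n → ℝ} (hφ : IsSymbol φ) :
    IsSelfAdjoint (mulOp φ) := by
  rw [ContinuousLinearMap.isSelfAdjoint_iff_isSymmetric]
  intro F G
  change ⟪mulOp φ F, G⟫_ℂ = ⟪F, mulOp φ G⟫_ℂ
  rw [Submodule.coe_inner, Submodule.coe_inner, L2.inner_def, L2.inner_def]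
  refine integral_congr_ae ?_
  filter_upwards [mulOp_coe hφ F, mulOp_coe hφ G] with p h1 h2
  rw [h1, h2, RCLike.inner_apply, RCLike.inner_apply, map_mul, Complex.conj_ofReal]
  ring

theorem mulOp_mulOp_inv {n : ℕ} {φ : shell n → ℝ} (hφ : IsSymbol φ)
    (hφ' : IsSymbol fun p => (φ p)⁻¹) (h0 : ∀ p, φ p ≠ 0) (F : SymL2 n) :
    mulOp φ (mulOp (fun p => (φ p)⁻¹) F) = F := by
  apply Subtype.ext
  apply Lp.ext
  filter_upwards [mulOp_coe hφ (mulOp (fun p => (φ p)⁻¹) F), mulOp_coe hφ' F] with p h1 h2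
  rw [h1, h2, ← mul_assoc, ← Complex.ofReal_mul, mul_inv_cancel₀ (h0 p), Complex.ofReal_one,
    one_mul]

theorem IsSymbol.inv {n : ℕ} {φ : shell n → ℝ} (hφ : IsSymbol φ) {c : ℝ} (hc : 0 < c)
    (h : ∀ p, c ≤ φ p) : IsSymbol fun p => (φ p)⁻¹ where
  measurable := hφ.measurable.inv
  bounded := ⟨c⁻¹, fun p => by
    rw [abs_of_pos (inv_pos.mpr (hc.trans_le (h p)))]
    exact inv_anti₀ hc (h p)⟩
  symmetric σ p := by rw [hφ.symmetric]

theorem IsSymbol.add {n : ℕ} {φ ψ : shell n → ℝ} (hφ : IsSymbol φ) (hψ : IsSymbol ψ) :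
    IsSymbol fun p => φ p + ψ p where
  measurable := hφ.measurable.add hψ.measurable
  bounded := by
    obtain ⟨C, hC⟩ := hφ.bounded
    obtain ⟨C', hC'⟩ := hψ.bounded
    exact ⟨C + C', fun p => (abs_add_le _ _).trans (add_le_add (hC p) (hC' p))⟩
  symmetric σ p := by rw [hφ.symmetric, hψ.symmetric]

theorem IsSymbol.const_mul {n : ℕ} {φ : shell n → ℝ} (hφ : IsSymbol φ) (c : ℝ) :
    IsSymbol fun p => c * φ p where
  measurable := hφ.measurable.const_mul c
  bounded := by
    obtain ⟨C, hC⟩ := hφ.bounded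
    exact ⟨|c| * C, fun p => by
      rw [abs_mul]
      exact mul_le_mul_of_nonneg_left (hC p) (abs_nonneg c)⟩
  symmetric σ p := by rw [hφ.symmetric]

/-! ### Integrals of the terms of `A₊` -/

theorem lintegral_mul_merge {n : ℕ} (m : Fin (n + 1)) (k : Fin n) {W : shell (n + 1) → ℝ≥0∞}
    (hW : Measurable W) {G : shell n → ℝ≥0∞} (hG : Measurable G) :
    ∫⁻ p, W p * G (merge m k p) ∂mu (n + 1)
      = ((n + 1 : ℕ) : ℝ≥0∞)⁻¹
        * ∫⁻ q, (∫⁻ t, W (split m k (q, t)) ∂torusMeasure) * G q ∂mu n := by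
  have hc : Measurable (merge m k) := (continuous_merge m k).measurable
  rw [lintegral_mu_succ m k (W := fun p => W p * G (merge m k p)) (hW.mul (hG.comp hc))]
  congr 1
  refine lintegral_congr fun q => ?_
  simp only [merge_split]
  rw [lintegral_mul_const]
  exact hW.comp ((continuous_split m k).measurable.comp measurable_prodMk_left)

theorem norm_pairTerm_sq {n : ℕ} (F : shell n → ℂ) (e : Fin (n + 1) × Fin n)
    (p : shell (n + 1)) :
    ‖pairTerm F e p‖ ^ 2 = 1 / 16 * (‖pairFactor e p‖ ^ 2 * ‖F (merge e.1 e.2 p)‖ ^ 2) := by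
  rw [pairTerm, norm_mul, norm_mul]
  norm_num
  ring

theorem norm_pairTerm_le {n : ℕ} (F : shell n → ℂ) (e : Fin (n + 1) × Fin n)
    (p : shell (n + 1)) :
    ‖pairTerm F e p‖ ≤ √(pairOmega e p) * ‖F (merge e.1 e.2 p)‖ := by
  have h1 : ‖pairFactor e p‖ ≤ 2 * √(pairOmega e p) := by
    refine (sq_le_sq₀ (norm_nonneg _) (by positivity)).mp ?_
    rw [mul_pow, Real.sq_sqrt (pairOmega_nonneg e p)]
    linarith [norm_pairFactor_sq_le e p]
  rw [pairTerm, norm_mul, norm_mul]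
  have h2 : ‖(-(1 / 4) : ℂ)‖ = 1 / 4 := by norm_num
  rw [h2]
  have h3 := mul_le_mul_of_nonneg_right h1 (norm_nonneg (F (merge e.1 e.2 p)))
  have h4 := mul_nonneg (Real.sqrt_nonneg (pairOmega e p)) (norm_nonneg (F (merge e.1 e.2 p)))
  linarith

theorem pairOmega_split {n : ℕ} (e : Fin (n + 1) × Fin n) (q : shell n) (t : Momentum) :
    pairOmega e (split e.1 e.2 (q, t)) = omega1 (q.1 e.2).1 := by
  rw [pairOmega, merge_split]

theorem measurable_split_right {n : ℕ} (m : Fin (n + 1)) (k : Fin n) (q : shell n) :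
    Measurable fun t => split m k (q, t) :=
  (continuous_split m k).measurable.comp measurable_prodMk_left

theorem lintegral_pairTerm_le {n : ℕ} {F : shell n → ℂ} (hF : Measurable F)
    {W : shell (n + 1) → ℝ≥0∞} (hW : Measurable W) {J : shell n → ℝ≥0∞}
    (hJ : ∀ m k q, ∫⁻ t, W (split m k (q, t)) ∂torusMeasure ≤ J q) (e : Fin (n + 1) × Fin n) :
    ∫⁻ p, W p * ENNReal.ofReal (‖pairTerm F e p‖ ^ 2) ∂mu (n + 1)
      ≤ ((n + 1 : ℕ) : ℝ≥0∞)⁻¹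
        * ∫⁻ q, ENNReal.ofReal (omega1 (q.1 e.2).1) * (J q * ENNReal.ofReal (‖F q‖ ^ 2))
          ∂mu n := by
  have hm := (continuous_pairOmega e).measurable
  calc _ ≤ ∫⁻ p, (W p * ENNReal.ofReal (pairOmega e p))
        * ENNReal.ofReal (‖F (merge e.1 e.2 p)‖ ^ 2) ∂mu (n + 1) := by
        refine lintegral_mono fun p => ?_
        rw [mul_assoc, ← ENNReal.ofReal_mul (pairOmega_nonneg e p)]
        refine mul_le_mul_right (ENNReal.ofReal_le_ofReal ?_) _
        calc _ ≤ (√(pairOmega e p) * ‖F (merge e.1 e.2 p)‖) ^ 2 :=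
              pow_le_pow_left₀ (norm_nonneg _) (norm_pairTerm_le F e p) 2
          _ = _ := by rw [mul_pow, Real.sq_sqrt (pairOmega_nonneg e p)]
    _ = ((n + 1 : ℕ) : ℝ≥0∞)⁻¹ * ∫⁻ q, (∫⁻ t, W (split e.1 e.2 (q, t))
        * ENNReal.ofReal (pairOmega e (split e.1 e.2 (q, t))) ∂torusMeasure)
        * ENNReal.ofReal (‖F q‖ ^ 2) ∂mu n :=
        lintegral_mul_merge e.1 e.2 (hW.mul (by fun_prop))
          (G := fun q => ENNReal.ofReal (‖F q‖ ^ 2)) (by fun_prop)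
    _ ≤ _ := by
        refine mul_le_mul_right (lintegral_mono fun q => ?_) _
        simp only [pairOmega_split]
        rw [lintegral_mul_const' _ _ ENNReal.ofReal_ne_top,
          mul_comm _ (ENNReal.ofReal (omega1 _)), mul_assoc]
        gcongr
        exact hJ _ _ _

/-- Summation over the pairs: the factor `1 / (n + 1)` of the measure is compensated by the choice
of the split momentum, and the dispersion relations of the merged momenta add up to `ω(r)`. -/
theorem sum_lintegral_pairs {n : ℕ} {G : shell n → ℝ≥0∞} (hG : Measurable G) :
    ∑ e : Fin (n + 1) × Fin n, ((n + 1 : ℕ) : ℝ≥0∞)⁻¹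
        * ∫⁻ q, ENNReal.ofReal (omega1 (q.1 e.2).1) * G q ∂mu n
      = ∫⁻ q, ENNReal.ofReal (omegaR q) * G q ∂mu n := by
  have hm (k : Fin n) : Measurable fun q : shell n => ENNReal.ofReal (omega1 (q.1 k).1) :=
    (continuous_omega1.comp (continuous_fst.comp (continuous_coord k))).measurable.ennreal_ofReal
  rw [Fintype.sum_prod_type]
  simp only [Finset.sum_const, Finset.card_univ, Fintype.card_fin, nsmul_eq_mul]
  rw [← Finset.mul_sum, ← mul_assoc, ENNReal.mul_inv_cancel (by simp) (ENNReal.natCast_ne_top _),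
    one_mul,
    ← lintegral_finsetSum (f := fun k (q : shell n) => ENNReal.ofReal (omega1 (q.1 k).1) * G q)
      _ fun k _ => (hm k).mul hG]
  refine lintegral_congr fun q => ?_
  rw [← Finset.sum_mul, omegaR, ENNReal.ofReal_sum_of_nonneg fun _ _ => omega1_nonneg _]

theorem lintegral_creation_le {n : ℕ} (F : SymL2 n)
    {W : shell (n + 1) → ℝ≥0∞} (hW : Measurable W) {J : shell n → ℝ≥0∞} (hJm : Measurable J)
    (hJ : ∀ m k q, ∫⁻ t, W (split m k (q, t)) ∂torusMeasure ≤ J q) :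
    ∫⁻ p, W p * ENNReal.ofReal (‖(creation n F : Lp ℂ 2 (mu (n + 1))) p‖ ^ 2) ∂mu (n + 1)
      ≤ ENNReal.ofReal ((n + 1) * n) * ∫⁻ q, ENNReal.ofReal (omegaR q)
        * (J q * ENNReal.ofReal (‖(F : Lp ℂ 2 (mu n)) q‖ ^ 2)) ∂mu n := by
  have hF := measurable_coe_symL2 F
  have hpt (e : Fin (n + 1) × Fin n) : Measurable (pairTerm (F : Lp ℂ 2 (mu n)) e) := by
    have h1 := (continuous_pairFactor e).measurable
    have h2 : Measurable (merge e.1 e.2) := (continuous_merge e.1 e.2).measurable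
    unfold pairTerm
    fun_prop
  rw [← sum_lintegral_pairs (G := fun q => J q * ENNReal.ofReal (‖(F : Lp ℂ 2 (mu n)) q‖ ^ 2))
    (hJm.mul (by fun_prop))]
  calc _ ≤ ∫⁻ p, ENNReal.ofReal ((n + 1) * n) * ∑ e, W p
        * ENNReal.ofReal (‖pairTerm (F : Lp ℂ 2 (mu n)) e p‖ ^ 2) ∂mu (n + 1) := by
        refine lintegral_mono_ae ?_
        filter_upwards [creation_ae_eq F] with p hp
        rw [hp, ← Finset.mul_sum, ← mul_assoc, mul_comm (ENNReal.ofReal ((n + 1) * n)), mul_assoc]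
        refine mul_le_mul_right ?_ _
        rw [← ENNReal.ofReal_sum_of_nonneg fun _ _ => sq_nonneg _, ← ENNReal.ofReal_mul
          (by positivity)]
        refine ENNReal.ofReal_le_ofReal ?_
        have h1 := pow_le_pow_left₀ (norm_nonneg _) (norm_sum_le Finset.univ
          fun e => pairTerm (F : Lp ℂ 2 (mu n)) e p) 2
        have h2 := sq_sum_le_card_mul_sum_sq (s := Finset.univ)
          (f := fun e => ‖pairTerm (F : Lp ℂ 2 (mu n)) e p‖)
        rw [Finset.card_univ, Fintype.card_prod, Fintype.card_fin, Fintype.card_fin] at h2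
        push_cast at h2
        exact h1.trans h2
    _ = ENNReal.ofReal ((n + 1) * n) * ∑ e, ∫⁻ p, W p
        * ENNReal.ofReal (‖pairTerm (F : Lp ℂ 2 (mu n)) e p‖ ^ 2) ∂mu (n + 1) := by
        rw [lintegral_const_mul', lintegral_finsetSum]
        · intro e _
          have := hpt e
          fun_prop
        · exact ENNReal.ofReal_ne_top
    _ ≤ _ := by
        gcongr with e
        exact lintegral_pairTerm_le hF hW hJ e

/-! ### The off-diagonal terms -/

/-- The square of a sum of terms that come in equal pairs, bounded from below by the diagonal and
the off-diagonal contributions. -/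
theorem two_mul_sum_sq_le {ι : Type*} [Fintype ι] [DecidableEq ι] {f : ι → ℂ} {s : ι → ι}
    (hs : ∀ e, s e ≠ e) (hf : ∀ e, f (s e) = f e) :
    2 * ∑ e, ‖f e‖ ^ 2
      ≤ ‖∑ e, f e‖ ^ 2 + ∑ e, ∑ e' ∈ (Finset.univ.erase e).erase (s e), ‖f e‖ * ‖f e'‖ := by
  have h1 : ‖∑ e, f e‖ ^ 2 = ∑ e, (star (f e) * ∑ e', f e').re := by
    rw [← Complex.re_sum, ← Finset.sum_mul, ← star_sum, Complex.star_def, mul_comm,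
      Complex.mul_conj, Complex.ofReal_re, Complex.normSq_eq_norm_sq]
  rw [h1, Finset.mul_sum, ← Finset.sum_add_distrib]
  refine Finset.sum_le_sum fun e _ => ?_
  have h2 : ∑ e', f e' = f e + (f e + ∑ e' ∈ (Finset.univ.erase e).erase (s e), f e') := by
    rw [← Finset.add_sum_erase _ f (Finset.mem_univ e),
      ← Finset.add_sum_erase _ f (Finset.mem_erase.mpr ⟨hs e, Finset.mem_univ _⟩), hf]
  have h3 : (star (f e) * f e).re = ‖f e‖ ^ 2 := by
    rw [Complex.star_def, mul_comm, Complex.mul_conj, Complex.ofReal_re, Complex.normSq_eq_norm_sq]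
  have h4 : -(∑ e' ∈ (Finset.univ.erase e).erase (s e), ‖f e‖ * ‖f e'‖)
      ≤ (star (f e) * ∑ e' ∈ (Finset.univ.erase e).erase (s e), f e').re := by
    refine (neg_le_neg ?_).trans (neg_abs_le _)
    refine (Complex.abs_re_le_norm _).trans ?_
    rw [norm_mul, norm_star, ← Finset.mul_sum]
    exact mul_le_mul_of_nonneg_left (norm_sum_le _ _) (norm_nonneg _)
  rw [h2, mul_add, mul_add, Complex.add_re, Complex.add_re, h3]
  linarith

/-- The function `x^{3/4}`. -/
def threeQuarters (x : ℝ) : ℝ := √x * √√x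

theorem threeQuarters_nonneg (x : ℝ) : 0 ≤ threeQuarters x := by
  unfold threeQuarters
  positivity

/-- The weight of `|F(merge e p)|²` in the estimate of the product of the terms of the pairs `e` and
`e'` by the arithmetic-geometric mean inequality. The power `3/4` of the ratio of the dispersion
relations of the two merged configurations makes the integral over the split momentum converge
without a logarithm, both at zero and at infinity. -/
def crossWeight {n : ℕ} (lam : ℝ) (e e' : Fin (n + 1) × Fin n) (p : shell (n + 1)) : ℝ :=
  (lam + omega p)⁻¹ * (√(pairOmega e p) * √(pairOmega e' p)
    * (threeQuarters (omegaR (merge e.1 e.2 p)) / threeQuarters (omegaR (merge e'.1 e'.2 p))))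

theorem measurable_threeQuarters_omegaR {n : ℕ} (e : Fin (n + 1) × Fin n) :
    Measurable fun p => threeQuarters (omegaR (merge e.1 e.2 p)) := by
  have h1 := ((continuous_omegaR n).comp (continuous_merge e.1 e.2)).measurable
  exact h1.sqrt.mul h1.sqrt.sqrt

theorem measurable_crossWeight {n : ℕ} (lam : ℝ) (e e' : Fin (n + 1) × Fin n) :
    Measurable (crossWeight lam e e') := by
  have h1 := (continuous_pairOmega e).measurable
  have h2 := (continuous_pairOmega e').measurable
  have h3 := measurable_threeQuarters_omegaR e
  have h4 := measurable_threeQuarters_omegaR e'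
  have h5 := (continuous_omega (n + 1)).measurable
  exact (measurable_const.add h5).inv.mul ((h1.sqrt.mul h2.sqrt).mul (h3.div h4))

theorem pairOmega_le_omegaR {n : ℕ} (e : Fin (n + 1) × Fin n) (p : shell (n + 1)) :
    pairOmega e p ≤ omegaR (merge e.1 e.2 p) := omega1_le_omegaR _ _

theorem omegaR_merge_swapPair {n : ℕ} (e : Fin (n + 1) × Fin n) (p : shell (n + 1)) :
    omegaR (merge (swapPair e).1 (swapPair e).2 p) = omegaR (merge e.1 e.2 p) := by
  obtain ⟨π, hπ⟩ := exists_permute_merge_swapPair e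
  rw [hπ p, omegaR_permute]

theorem crossWeight_swapPair {n : ℕ} (lam : ℝ) (e e' : Fin (n + 1) × Fin n)
    (p : shell (n + 1)) : crossWeight lam (swapPair e) e' p = crossWeight lam e e' p := by
  rw [crossWeight, crossWeight, pairOmega_swapPair, omegaR_merge_swapPair]

theorem norm_mul_norm_pairTerm_le {n : ℕ} {lam : ℝ} (hlam : 0 < lam) (F : shell n → ℂ)
    (e e' : Fin (n + 1) × Fin n) (p : shell (n + 1)) :
    (lam + omega p)⁻¹ * (‖pairTerm F e p‖ * ‖pairTerm F e' p‖)
      ≤ crossWeight lam e e' p * ‖F (merge e.1 e.2 p)‖ ^ 2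
        + crossWeight lam e' e p * ‖F (merge e'.1 e'.2 p)‖ ^ 2 := by
  have hw : 0 < (lam + omega p)⁻¹ := inv_pos.mpr (by linarith [omega_nonneg p])
  rw [crossWeight, crossWeight, mul_assoc, mul_assoc _ _ (‖F (merge e'.1 e'.2 p)‖ ^ 2), ← mul_add]
  refine mul_le_mul_of_nonneg_left ?_ hw.le
  refine (mul_le_mul (norm_pairTerm_le F e p) (norm_pairTerm_le F e' p) (norm_nonneg _)
    (by positivity)).trans ?_
  have ha := pairOmega_le_omegaR e p
  have hb := pairOmega_le_omegaR e' p
  have ha0 := pairOmega_nonneg e p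
  have hb0 := pairOmega_nonneg e' p
  set a := pairOmega e p
  set b := pairOmega e' p
  set x := omegaR (merge e.1 e.2 p)
  set y := omegaR (merge e'.1 e'.2 p)
  set u := ‖F (merge e.1 e.2 p)‖
  set v := ‖F (merge e'.1 e'.2 p)‖
  have hx0 : 0 ≤ x := ha0.trans ha
  have hy0 : 0 ≤ y := hb0.trans hb
  rcases hx0.eq_or_lt with hx | hx
  · have : a = 0 := by linarith
    simp [this]
  rcases hy0.eq_or_lt with hy | hy
  · have : b = 0 := by linarith
    simp [this]
  have hX : 0 < threeQuarters x := by unfold threeQuarters; positivity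
  have hY : 0 < threeQuarters y := by unfold threeQuarters; positivity
  set ρ := threeQuarters x / threeQuarters y with hρ
  have hρ' : threeQuarters y / threeQuarters x = ρ⁻¹ := by rw [hρ, inv_div]
  have hρ0 : 0 < ρ := div_pos hX hY
  have hamgm : u * v ≤ ρ * u ^ 2 + ρ⁻¹ * v ^ 2 := by
    have h1 : ρ * ρ⁻¹ = 1 := mul_inv_cancel₀ hρ0.ne'
    have h2 : 0 < ρ⁻¹ := inv_pos.mpr hρ0
    have h3 : 0 ≤ ρ⁻¹ * (ρ * u - v) ^ 2 := by positivity
    have h4 : ρ⁻¹ * (ρ * u - v) ^ 2 = ρ * u ^ 2 - 2 * (u * v) + ρ⁻¹ * v ^ 2 := by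
      field_simp
      ring
    have h5 : 0 ≤ u * v := mul_nonneg (norm_nonneg _) (norm_nonneg _)
    linarith
  rw [hρ']
  have h := mul_le_mul_of_nonneg_left hamgm (mul_nonneg (Real.sqrt_nonneg a) (Real.sqrt_nonneg b))
  calc _ = √a * √b * (u * v) := by ring
    _ ≤ _ := h
    _ = _ := by ring

/-- If the index `e.1` does not occur in the pair `e'`, then the momentum with this index is one of
the momenta of the configuration merged along `e'`. -/
theorem omega1_le_omegaR_merge {n : ℕ} {e e' : Fin (n + 1) × Fin n} (h1 : e.1 ≠ e'.1)
    (h2 : e.1 ≠ e'.1.succAbove e'.2) (p : shell (n + 1)) :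
    omega1 (p.1 e.1).1 ≤ omegaR (merge e'.1 e'.2 p) := by
  obtain ⟨i, hi⟩ := Fin.exists_succAbove_eq h1
  have hik : i ≠ e'.2 := fun h => h2 (by rw [← hi, h])
  have h := omega1_le_omegaR (merge e'.1 e'.2 p) i
  rwa [merge_apply_of_ne _ hik, hi] at h

theorem lintegral_crossWeight_fibre_le {n : ℕ} {lam : ℝ} (hlam : 0 < lam)
    {e e' : Fin (n + 1) × Fin n} (h1 : e.1 ≠ e'.1) (h2 : e.1 ≠ e'.1.succAbove e'.2) (q : shell n) :
    ∫⁻ t, ENNReal.ofReal (crossWeight lam e e' (split e.1 e.2 (q, t))) ∂torusMeasure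
      ≤ ENNReal.ofReal 384 * ENNReal.ofReal (omegaR q) := by
  have ha0 := omega1_nonneg (q.1 e.2).1
  have haq := omega1_le_omegaR q e.2
  set a := omega1 (q.1 e.2).1 with ha
  rcases ha0.eq_or_lt with h0 | h0
  · have h3 (t : Momentum) : crossWeight lam e e' (split e.1 e.2 (q, t)) = 0 := by
      rw [crossWeight, pairOmega_split, ← ha, ← h0]
      simp
    simp [h3]
  have hq0 : 0 < omegaR q := h0.trans_le haq
  set c := 4 * (√a * threeQuarters (omegaR q)) with hc
  have hX : 0 < threeQuarters (omegaR q) := by unfold threeQuarters; positivity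
  have hc0 : 0 < c := by positivity
  have hpt (t : Momentum) : ENNReal.ofReal (crossWeight lam e e' (split e.1 e.2 (q, t)))
      ≤ ENNReal.ofReal c * ((ENNReal.ofReal (√√(omega1 t.1)))⁻¹
        * ENNReal.ofReal (a + omega1 t.1 + omega1 t.2)⁻¹) := by
    have ht1 := omega1_nonneg t.1
    have ht2 := omega1_nonneg t.2
    rcases ht1.eq_or_lt with h | h
    · rw [← h]
      simp only [Real.sqrt_zero, ENNReal.ofReal_zero, ENNReal.inv_zero]
      rw [ENNReal.top_mul, ENNReal.mul_top]
      · exact le_top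
      · rwa [Ne, ENNReal.ofReal_eq_zero, not_le]
      · rw [Ne, ENNReal.ofReal_eq_zero, not_le]
        positivity
    rw [← ENNReal.ofReal_inv_of_pos (by positivity), ← ENNReal.ofReal_mul (by positivity),
      ← ENNReal.ofReal_mul hc0.le]
    refine ENNReal.ofReal_le_ofReal ?_
    rw [crossWeight, pairOmega_split, ← ha, merge_split]
    set p := split e.1 e.2 (q, t) with hp
    have hpt : p.1 e.1 = t := split_same _ _ _ _
    have hy := omega1_le_omegaR_merge h1 h2 p
    rw [hpt] at hy
    have hb := pairOmega_le_omegaR e' p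
    have hb0 := pairOmega_nonneg e' p
    set y := omegaR (merge e'.1 e'.2 p)
    set b := pairOmega e' p
    have hy0 : 0 < y := h.trans_le hy
    have hω1 := add_le_omega p e.1
    rw [hpt] at hω1
    have hω2 := omega_merge_le e.1 e.2 p
    rw [hp, merge_split, ← hp] at hω2
    have hω3 := haq.trans (omegaR_le_omega q)
    have hinv : (lam + omega p)⁻¹ ≤ 4 * (a + omega1 t.1 + omega1 t.2)⁻¹ := by
      have h5 : 0 < a + omega1 t.1 + omega1 t.2 := by linarith
      calc _ ≤ ((a + omega1 t.1 + omega1 t.2) / 4)⁻¹ :=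
            inv_anti₀ (by linarith) (by linarith)
        _ = _ := by rw [inv_div]; ring
    have hratio : √b * (threeQuarters (omegaR q) / threeQuarters y)
        ≤ threeQuarters (omegaR q) * (√√(omega1 t.1))⁻¹ := by
      have h5 : √b ≤ √y := Real.sqrt_le_sqrt hb
      have h6 : √√(omega1 t.1) ≤ √√y := Real.sqrt_le_sqrt (Real.sqrt_le_sqrt hy)
      have h7 : 0 < √√(omega1 t.1) := by positivity
      have h8 : 0 < √y := by positivity
      have h9 : 0 < √√y := by positivity
      calc _ ≤ √y * (threeQuarters (omegaR q) / threeQuarters y) := by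
            refine mul_le_mul_of_nonneg_right h5 (div_nonneg hX.le (threeQuarters_nonneg y))
        _ = threeQuarters (omegaR q) * (√√y)⁻¹ := by
            rw [threeQuarters.eq_def y]
            field_simp
        _ ≤ _ := mul_le_mul_of_nonneg_left (inv_anti₀ h7 h6) hX.le
    have h10 : 0 < (a + omega1 t.1 + omega1 t.2)⁻¹ := by positivity
    calc _ = (lam + omega p)⁻¹ * (√a * (√b * (threeQuarters (omegaR q) / threeQuarters y))) := by
          ring
      _ ≤ 4 * (a + omega1 t.1 + omega1 t.2)⁻¹
          * (√a * (threeQuarters (omegaR q) * (√√(omega1 t.1))⁻¹)) := by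
          refine mul_le_mul hinv (mul_le_mul_of_nonneg_left hratio (Real.sqrt_nonneg a)) ?_
            (by positivity)
          exact mul_nonneg (Real.sqrt_nonneg a) (mul_nonneg (Real.sqrt_nonneg b)
            (div_nonneg hX.le (threeQuarters_nonneg y)))
      _ = _ := by rw [hc]; ring
  refine (lintegral_mono hpt).trans ?_
  rw [lintegral_const_mul' _ _ ENNReal.ofReal_ne_top]
  refine (mul_le_mul_right (lintegral_singular_le h0) _).trans ?_
  rw [← ENNReal.ofReal_mul hc0.le, ← ENNReal.ofReal_mul (by norm_num)]
  refine ENNReal.ofReal_le_ofReal ?_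
  have h7 : √√a ≤ √√(omegaR q) := Real.sqrt_le_sqrt (Real.sqrt_le_sqrt haq)
  have h8 : √√(omegaR q) * √√(omegaR q) = √(omegaR q) :=
    Real.mul_self_sqrt (Real.sqrt_nonneg _)
  have h9 : √(omegaR q) * √(omegaR q) = omegaR q := Real.mul_self_sqrt hq0.le
  calc c * (96 / √√a) = 384 * (√√a * threeQuarters (omegaR q)) := by
        have h5 : √a / √√a = √√a := Real.div_sqrt
        rw [hc]
        linear_combination 384 * threeQuarters (omegaR q) * h5
    _ ≤ 384 * (√√(omegaR q) * threeQuarters (omegaR q)) := by gcongr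
    _ = 384 * omegaR q := by
        rw [threeQuarters]
        linear_combination 384 * √(omegaR q) * h8 + 384 * h9

theorem lintegral_crossWeight_le {n : ℕ} {lam : ℝ} (hlam : 0 < lam) (F : SymL2 n)
    {e e' : Fin (n + 1) × Fin n} (h1 : e' ≠ e) (h2 : e' ≠ swapPair e) :
    ∫⁻ p, ENNReal.ofReal (crossWeight lam e e' p)
        * ENNReal.ofReal (‖(F : Lp ℂ 2 (mu n)) (merge e.1 e.2 p)‖ ^ 2) ∂mu (n + 1)
      ≤ ENNReal.ofReal 384 * ∫⁻ q, ENNReal.ofReal (omegaR q)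
        * ENNReal.ofReal (‖(F : Lp ℂ 2 (mu n)) q‖ ^ 2) ∂mu n := by
  have hF := measurable_coe_symL2 F
  -- The momentum with index `d.1`, where `d` is `e` or `swapPair e`, is split off.
  have key (d : Fin (n + 1) × Fin n) (hd1 : d.1 ≠ e'.1) (hd2 : d.1 ≠ e'.1.succAbove e'.2) :
      ∫⁻ p, ENNReal.ofReal (crossWeight lam d e' p)
        * ENNReal.ofReal (‖(F : Lp ℂ 2 (mu n)) (merge d.1 d.2 p)‖ ^ 2) ∂mu (n + 1)
      ≤ ENNReal.ofReal 384 * ∫⁻ q, ENNReal.ofReal (omegaR q)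
        * ENNReal.ofReal (‖(F : Lp ℂ 2 (mu n)) q‖ ^ 2) ∂mu n := by
    rw [lintegral_mul_merge d.1 d.2 (measurable_crossWeight lam d e').ennreal_ofReal
      (G := fun q => ENNReal.ofReal (‖(F : Lp ℂ 2 (mu n)) q‖ ^ 2)) (by fun_prop)]
    have h3 : ((n + 1 : ℕ) : ℝ≥0∞)⁻¹ ≤ 1 := by
      rw [ENNReal.inv_le_one]
      exact_mod_cast Nat.le_add_left 1 n
    refine (mul_le_of_le_one_left zero_le h3).trans ?_
    rw [← lintegral_const_mul' _ _ ENNReal.ofReal_ne_top]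
    refine lintegral_mono fun q => ?_
    rw [← mul_assoc]
    exact mul_le_mul_left (lintegral_crossWeight_fibre_le hlam hd1 hd2 q) _
  by_cases hd : e.1 ≠ e'.1 ∧ e.1 ≠ e'.1.succAbove e'.2
  · exact key e hd.1 hd.2
  · have hs : (swapPair e).1 ≠ e'.1 ∧ (swapPair e).1 ≠ e'.1.succAbove e'.2 := by
      have hne : (swapPair e).1 ≠ e.1 := Fin.succAbove_ne _ _
      rw [not_and_or, not_not, not_not] at hd
      rcases hd with hd | hd
      · refine ⟨hd ▸ hne, fun h => h1 ?_⟩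
        refine Prod.ext hd.symm (Fin.succAbove_right_injective (p := e'.1) ?_)
        rw [← h, ← hd]
        rfl
      · refine ⟨fun h => h2 ?_, hd ▸ hne⟩
        refine Prod.ext h.symm (Fin.succAbove_right_injective (p := e'.1) ?_)
        rw [← hd, ← h]
        exact (succAbove_swapPair e).symm
    refine le_trans (le_of_eq ?_) (key (swapPair e) hs.1 hs.2)
    refine lintegral_congr_ae ?_
    filter_upwards [ae_merge_swapPair F] with p hp
    rw [crossWeight_swapPair, hp e]

theorem lintegral_cross_le {n : ℕ} {lam : ℝ} (hlam : 0 < lam) (F : SymL2 n)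
    {W : shell (n + 1) → ℝ≥0∞} (hW : ∀ p, W p ≤ ENNReal.ofReal (lam + omega p)⁻¹)
    {e e' : Fin (n + 1) × Fin n} (h1 : e' ≠ e) (h2 : e' ≠ swapPair e) :
    ∫⁻ p, W p * ENNReal.ofReal (‖pairTerm (F : Lp ℂ 2 (mu n)) e p‖
        * ‖pairTerm (F : Lp ℂ 2 (mu n)) e' p‖) ∂mu (n + 1)
      ≤ ENNReal.ofReal 768 * ∫⁻ q, ENNReal.ofReal (omegaR q)
        * ENNReal.ofReal (‖(F : Lp ℂ 2 (mu n)) q‖ ^ 2) ∂mu n := by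
  have hF := measurable_coe_symL2 F
  have hnn (d d' : Fin (n + 1) × Fin n) (p : shell (n + 1)) : 0 ≤ crossWeight lam d d' p := by
    have hw : 0 < (lam + omega p)⁻¹ := inv_pos.mpr (by linarith [omega_nonneg p])
    exact mul_nonneg hw.le (mul_nonneg (by positivity)
      (div_nonneg (threeQuarters_nonneg _) (threeQuarters_nonneg _)))
  have h3 : e ≠ swapPair e' := fun h => h2 (by rw [h, swapPair_swapPair])
  calc _ ≤ ∫⁻ p, ENNReal.ofReal (crossWeight lam e e' p)
        * ENNReal.ofReal (‖(F : Lp ℂ 2 (mu n)) (merge e.1 e.2 p)‖ ^ 2)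
        + ENNReal.ofReal (crossWeight lam e' e p)
        * ENNReal.ofReal (‖(F : Lp ℂ 2 (mu n)) (merge e'.1 e'.2 p)‖ ^ 2) ∂mu (n + 1) := by
        refine lintegral_mono fun p => (mul_le_mul_left (hW p) _).trans ?_
        have hw : 0 < (lam + omega p)⁻¹ := inv_pos.mpr (by linarith [omega_nonneg p])
        rw [← ENNReal.ofReal_mul hw.le, ← ENNReal.ofReal_mul (hnn _ _ _),
          ← ENNReal.ofReal_mul (hnn _ _ _), ← ENNReal.ofReal_add
          (mul_nonneg (hnn _ _ _) (sq_nonneg _)) (mul_nonneg (hnn _ _ _) (sq_nonneg _))]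
        exact ENNReal.ofReal_le_ofReal (norm_mul_norm_pairTerm_le hlam _ e e' p)
    _ = _ := by
        have h4 : Measurable (merge e.1 e.2) := (continuous_merge e.1 e.2).measurable
        have h5 := measurable_crossWeight lam e e'
        exact lintegral_add_left (by fun_prop) _
    _ ≤ _ := add_le_add (lintegral_crossWeight_le hlam F h1 h2)
        (lintegral_crossWeight_le hlam F h1.symm h3)
    _ = _ := by
        rw [← add_mul, ← ENNReal.ofReal_add (by norm_num) (by norm_num)]
        norm_num

/-! ### The lower bound by the diagonal terms -/

theorem le_lintegral_pairTerm {n : ℕ} {F : shell n → ℂ} (hF : Measurable F)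
    {W : shell (n + 1) → ℝ≥0∞} (hW : Measurable W) {J : shell n → ℝ≥0∞}
    (hJ : ∀ m k q, J q ≤ ∫⁻ t, {p | omega p ≤ 1 / 2}.indicator W (split m k (q, t)) ∂torusMeasure)
    (e : Fin (n + 1) × Fin n) :
    ENNReal.ofReal (1 / 8) * (((n + 1 : ℕ) : ℝ≥0∞)⁻¹
        * ∫⁻ q, ENNReal.ofReal (omega1 (q.1 e.2).1) * (J q * ENNReal.ofReal (‖F q‖ ^ 2)) ∂mu n)
      ≤ ∫⁻ p, W p * ENNReal.ofReal (‖pairTerm F e p‖ ^ 2) ∂mu (n + 1) := by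
  have hm := (continuous_pairOmega e).measurable
  have hset : MeasurableSet {p : shell (n + 1) | omega p ≤ 1 / 2} :=
    measurableSet_le (continuous_omega _).measurable measurable_const
  calc _ ≤ ENNReal.ofReal (1 / 8) * (((n + 1 : ℕ) : ℝ≥0∞)⁻¹
        * ∫⁻ q, (∫⁻ t, {p | omega p ≤ 1 / 2}.indicator W (split e.1 e.2 (q, t))
        * ENNReal.ofReal (pairOmega e (split e.1 e.2 (q, t))) ∂torusMeasure)
        * ENNReal.ofReal (‖F q‖ ^ 2) ∂mu n) := by
        refine mul_le_mul_right (mul_le_mul_right (lintegral_mono fun q => ?_) _) _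
        simp only [pairOmega_split]
        rw [lintegral_mul_const' _ _ ENNReal.ofReal_ne_top,
          mul_comm _ (ENNReal.ofReal (omega1 _)), mul_assoc]
        gcongr
        exact hJ _ _ _
    _ = ENNReal.ofReal (1 / 8) * ∫⁻ p, ({p | omega p ≤ 1 / 2}.indicator W p
        * ENNReal.ofReal (pairOmega e p)) * ENNReal.ofReal (‖F (merge e.1 e.2 p)‖ ^ 2)
        ∂mu (n + 1) := by
        congr 1
        exact (lintegral_mul_merge e.1 e.2 ((hW.indicator hset).mul hm.ennreal_ofReal)
          (G := fun q => ENNReal.ofReal (‖F q‖ ^ 2)) (by fun_prop)).symm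
    _ ≤ _ := by
        rw [← lintegral_const_mul' _ _ ENNReal.ofReal_ne_top]
        refine lintegral_mono fun p => ?_
        by_cases hp : omega p ≤ 1 / 2
        · rw [Set.indicator_of_mem (show p ∈ {p | omega p ≤ 1 / 2} from hp), mul_assoc,
            ← ENNReal.ofReal_mul (pairOmega_nonneg e p), mul_left_comm,
            ← ENNReal.ofReal_mul (by norm_num)]
          refine mul_le_mul_right (ENNReal.ofReal_le_ofReal ?_) _
          rw [norm_pairTerm_sq]
          have h1 := mul_le_mul_of_nonneg_right (le_norm_pairFactor_sq e hp)
            (sq_nonneg ‖F (merge e.1 e.2 p)‖)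
          linarith
        · rw [Set.indicator_of_notMem (by simpa using hp)]
          simp

/-- The diagonal terms of `A₊ F`, which come in equal pairs, are bounded by the full form and the
off-diagonal terms. -/
theorem le_lintegral_creation {n : ℕ} {lam : ℝ} (hlam : 0 < lam) (F : SymL2 n)
    {W : shell (n + 1) → ℝ≥0∞} (hWm : Measurable W)
    (hW : ∀ p, W p ≤ ENNReal.ofReal (lam + omega p)⁻¹) {J : shell n → ℝ≥0∞} (hJm : Measurable J)
    (hJ : ∀ m k q, J q ≤
      ∫⁻ t, {p | omega p ≤ 1 / 2}.indicator W (split m k (q, t)) ∂torusMeasure) :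
    ENNReal.ofReal (1 / 4) * ∫⁻ q, ENNReal.ofReal (omegaR q)
        * (J q * ENNReal.ofReal (‖(F : Lp ℂ 2 (mu n)) q‖ ^ 2)) ∂mu n
      ≤ ∫⁻ p, W p * ENNReal.ofReal (‖(creation n F : Lp ℂ 2 (mu (n + 1))) p‖ ^ 2) ∂mu (n + 1)
        + ENNReal.ofReal (((n + 1) * n) ^ 2 * 768) * ∫⁻ q, ENNReal.ofReal (omegaR q)
          * ENNReal.ofReal (‖(F : Lp ℂ 2 (mu n)) q‖ ^ 2) ∂mu n := by
  have hF := measurable_coe_symL2 F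
  have hpt (e : Fin (n + 1) × Fin n) : Measurable (pairTerm (F : Lp ℂ 2 (mu n)) e) := by
    have h1 := (continuous_pairFactor e).measurable
    have h2 : Measurable (merge e.1 e.2) := (continuous_merge e.1 e.2).measurable
    unfold pairTerm
    fun_prop
  set f := fun e => pairTerm ((F : Lp ℂ 2 (mu n)) : shell n → ℂ) e with hf
  set X := ∫⁻ q, ENNReal.ofReal (omegaR q) * ENNReal.ofReal (‖(F : Lp ℂ 2 (mu n)) q‖ ^ 2) ∂mu n
  set A := ∫⁻ p, W p * ENNReal.ofReal (‖(creation n F : Lp ℂ 2 (mu (n + 1))) p‖ ^ 2) ∂mu (n + 1)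
  have hdiag : ENNReal.ofReal (1 / 4) * ∫⁻ q, ENNReal.ofReal (omegaR q)
        * (J q * ENNReal.ofReal (‖(F : Lp ℂ 2 (mu n)) q‖ ^ 2)) ∂mu n
      ≤ 2 * ∑ e, ∫⁻ p, W p * ENNReal.ofReal (‖f e p‖ ^ 2) ∂mu (n + 1) := by
    rw [← sum_lintegral_pairs (G := fun q => J q * ENNReal.ofReal (‖(F : Lp ℂ 2 (mu n)) q‖ ^ 2))
      (hJm.mul (by fun_prop))]
    have h1 : ENNReal.ofReal (1 / 4) = 2 * ENNReal.ofReal (1 / 8) := by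
      rw [← ENNReal.ofReal_ofNat, ← ENNReal.ofReal_mul (by norm_num)]
      norm_num
    rw [h1, mul_assoc, Finset.mul_sum]
    gcongr with e
    exact le_lintegral_pairTerm hF hWm hJ e
  have hsum : 2 * ∑ e, ∫⁻ p, W p * ENNReal.ofReal (‖f e p‖ ^ 2) ∂mu (n + 1)
      ≤ A + ∑ e, ∑ e' ∈ (Finset.univ.erase e).erase (swapPair e),
        ∫⁻ p, W p * ENNReal.ofReal (‖f e p‖ * ‖f e' p‖) ∂mu (n + 1) := by
    have hL : 2 * ∑ e, ∫⁻ p, W p * ENNReal.ofReal (‖f e p‖ ^ 2) ∂mu (n + 1)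
        = ∫⁻ p, W p * ENNReal.ofReal (2 * ∑ e, ‖f e p‖ ^ 2) ∂mu (n + 1) := by
      rw [← lintegral_finsetSum _ fun e _ => by have := hpt e; fun_prop,
        ← lintegral_const_mul' _ _ (by norm_num)]
      refine lintegral_congr fun p => ?_
      rw [ENNReal.ofReal_mul (by norm_num), ENNReal.ofReal_sum_of_nonneg fun _ _ => sq_nonneg _,
        ← Finset.mul_sum, ENNReal.ofReal_ofNat, mul_left_comm]
    have hR : ∑ e, ∑ e' ∈ (Finset.univ.erase e).erase (swapPair e),
          ∫⁻ p, W p * ENNReal.ofReal (‖f e p‖ * ‖f e' p‖) ∂mu (n + 1)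
        = ∫⁻ p, W p * ENNReal.ofReal (∑ e, ∑ e' ∈ (Finset.univ.erase e).erase (swapPair e),
          ‖f e p‖ * ‖f e' p‖) ∂mu (n + 1) := by
      have h1 (e e' : Fin (n + 1) × Fin n) :
          Measurable fun p => W p * ENNReal.ofReal (‖f e p‖ * ‖f e' p‖) := by
        have := hpt e
        have := hpt e'
        fun_prop
      simp_rw [← lintegral_finsetSum _ fun e' _ => h1 _ e']
      rw [← lintegral_finsetSum _ fun e _ => Finset.measurable_fun_sum _ fun e' _ => h1 e e']
      refine lintegral_congr fun p => ?_
      rw [ENNReal.ofReal_sum_of_nonneg fun _ _ => Finset.sum_nonneg fun _ _ => by positivity,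
        Finset.mul_sum]
      refine Finset.sum_congr rfl fun e _ => ?_
      rw [ENNReal.ofReal_sum_of_nonneg fun _ _ => by positivity, Finset.mul_sum]
    rw [hL, hR, ← lintegral_add_right]
    · refine lintegral_mono_ae ?_
      filter_upwards [creation_ae_eq F, ae_merge_swapPair F] with p h1 h2
      rw [h1, ← mul_add, ← ENNReal.ofReal_add (sq_nonneg _)
        (Finset.sum_nonneg fun _ _ => Finset.sum_nonneg fun _ _ => by positivity)]
      refine mul_le_mul_right (ENNReal.ofReal_le_ofReal ?_) _
      refine two_mul_sum_sq_le (f := fun e => f e p) swapPair_ne fun e => ?_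
      simp only [hf, pairTerm]
      rw [pairFactor_swapPair, h2 e]
    · refine hWm.mul (Measurable.ennreal_ofReal ?_)
      refine Finset.measurable_fun_sum _ fun e _ => Finset.measurable_fun_sum _ fun e' _ => ?_
      have := hpt e
      have := hpt e'
      fun_prop
  have hcross : ∑ e, ∑ e' ∈ (Finset.univ.erase e).erase (swapPair e),
        ∫⁻ p, W p * ENNReal.ofReal (‖f e p‖ * ‖f e' p‖) ∂mu (n + 1)
      ≤ ENNReal.ofReal (((n + 1) * n) ^ 2 * 768) * X := by
    calc _ ≤ ∑ e : Fin (n + 1) × Fin n, ∑ e' : Fin (n + 1) × Fin n, ENNReal.ofReal 768 * X := by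
          refine Finset.sum_le_sum fun e _ => ?_
          refine (Finset.sum_le_sum fun e' he' => ?_).trans
            (Finset.sum_le_sum_of_subset (Finset.subset_univ _))
          have h := Finset.mem_erase.mp he'
          exact lintegral_cross_le hlam F hW (Finset.mem_erase.mp h.2).1 h.1
      _ = _ := by
          simp only [Finset.sum_const, Finset.card_univ, Fintype.card_prod, Fintype.card_fin,
            nsmul_eq_mul]
          rw [← mul_assoc, ← mul_assoc, ENNReal.ofReal_mul (by positivity)]
          congr 2
          rw [← Nat.cast_mul, ← ENNReal.ofReal_natCast]
          congr 1
          push_cast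
          ring
  exact hdiag.trans (hsum.trans (add_le_add_right hcross _))

/-! ### The resolvent integrated over a split momentum -/

/-- The logarithm in the self-energy may be evaluated at `w = b + ω(s)` in place of
`z ≈ b + ω(r) + ω(s)`, up to an error that is integrable without a logarithm: if `x = ω(r)` is at
most `√w` then the two logarithms are comparable, and otherwise `z ≳ x + √w`. -/
theorem inv_add_mul_log_le {w x z R κ : ℝ} (hw : 0 < w) (hw1 : w ≤ 1 / 1296) (hx : 0 ≤ x)
    (hz1 : (w + x) / 4 ≤ z) (hz2 : z ≤ 3 * (w + x)) (hz : z ≤ 1) (hR : x ≤ R) (hκ : 0 ≤ κ)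
    (hκ1 : κ ≤ 1) :
    (z + R * (-Real.log z) ^ κ)⁻¹ ≤ 8 * (√w + x)⁻¹ + 4 * (w + x * (-Real.log w) ^ κ)⁻¹ := by
  have hz0 : 0 < z := by linarith
  have hsw : 0 < √w := Real.sqrt_pos.mpr hw
  have hsw2 : √w ^ 2 = w := Real.sq_sqrt hw.le
  have hsw1 : √w ≤ 1 := Real.sqrt_le_one.mpr (by linarith)
  have hlz : 0 ≤ -Real.log z := neg_nonneg.mpr (Real.log_nonpos hz0.le hz)
  have hlw : 0 < -Real.log w := neg_pos.mpr (Real.log_neg hw (by linarith))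
  have hLz : 0 ≤ (-Real.log z) ^ κ := Real.rpow_nonneg hlz κ
  have hLw : 0 < (-Real.log w) ^ κ := Real.rpow_pos_of_pos hlw κ
  have hR0 : 0 ≤ R := hx.trans hR
  rcases le_or_gt x √w with h | h
  · have h1 : Real.log z ≤ Real.log 6 + Real.log w / 2 := by
      rw [← Real.log_sqrt hw.le, ← Real.log_mul (by norm_num) hsw.ne']
      refine Real.log_le_log hz0 (hz2.trans ?_)
      nlinarith
    have h2 : 4 * Real.log 6 ≤ -Real.log w := by
      have h3 : Real.log w ≤ Real.log (1 / 1296) := Real.log_le_log hw hw1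
      have h4 : Real.log (1 / 1296) = -(4 * Real.log 6) := by
        rw [one_div, Real.log_inv, show (1296 : ℝ) = 6 ^ 4 by norm_num, Real.log_pow]
        norm_num
      linarith
    have h3 : 1 / 4 * -Real.log w ≤ -Real.log z := by linarith
    have h4 : 1 / 4 * (-Real.log w) ^ κ ≤ (-Real.log z) ^ κ := by
      refine le_trans ?_ (Real.rpow_le_rpow (by positivity) h3 hκ)
      rw [Real.mul_rpow (by norm_num) hlw.le]
      refine mul_le_mul_of_nonneg_right ?_ hLw.le
      have h5 := Real.rpow_le_rpow_of_exponent_ge (x := 1 / 4) (by norm_num) (by norm_num) hκ1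
      rwa [Real.rpow_one] at h5
    have h5 : 1 / 4 * (w + x * (-Real.log w) ^ κ) ≤ z + R * (-Real.log z) ^ κ := by
      have h6 : x * (1 / 4 * (-Real.log w) ^ κ) ≤ R * (-Real.log z) ^ κ :=
        mul_le_mul hR h4 (by positivity) hR0
      linarith
    have h6 : (z + R * (-Real.log z) ^ κ)⁻¹ ≤ 4 * (w + x * (-Real.log w) ^ κ)⁻¹ := by
      refine (inv_anti₀ (by positivity) h5).trans_eq ?_
      rw [mul_inv]
      norm_num
    have h7 : 0 ≤ 8 * (√w + x)⁻¹ := by positivity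
    linarith
  · have h5 : 1 / 8 * (√w + x) ≤ z + R * (-Real.log z) ^ κ := by
      have := mul_nonneg hR0 hLz
      linarith
    have h6 : (z + R * (-Real.log z) ^ κ)⁻¹ ≤ 8 * (√w + x)⁻¹ := by
      refine (inv_anti₀ (by positivity) h5).trans_eq ?_
      rw [mul_inv]
      norm_num
    have h7 : 0 ≤ 4 * (w + x * (-Real.log w) ^ κ)⁻¹ := by positivity
    linarith

theorem inv_omega_split_le {n : ℕ} (m : Fin (n + 1)) (k : Fin n) (q : shell n) (t : Momentum)
    {ε : ℝ} (hε : 0 < ε) (h : ε < omega (split m k (q, t))) :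
    2 * (omega (split m k (q, t)))⁻¹ ≤ 4 * (ε + omega1 t.1 + omega1 t.2)⁻¹ := by
  have h1 := add_le_omega (split m k (q, t)) m
  rw [split_same] at h1
  have h2 := omega1_nonneg t.1
  have h3 := omega1_nonneg t.2
  calc _ ≤ 2 * ((ε + omega1 t.1 + omega1 t.2) / 2)⁻¹ := by
        refine mul_le_mul_of_nonneg_left (inv_anti₀ (by positivity) (by linarith)) (by norm_num)
    _ = _ := by rw [inv_div]; ring

/-- If the merged configuration is outside of the set `ω ≤ 2 ε`, then all the configurations in the
fibre are outside of the set `ω ≤ ε`, and the integral of the free resolvent over the fibre is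
at most logarithmic in `ε`. -/
theorem lintegral_fibre_le_of_lt {n : ℕ} (m : Fin (n + 1)) (k : Fin n) (q : shell n)
    {ε : ℝ} (hε : 0 < ε) (hε1 : ε ≤ 1) {W : shell (n + 1) → ℝ≥0∞}
    (hbad : ∀ p, ε < omega p → W p ≤ ENNReal.ofReal (2 * (omega p)⁻¹)) (hq : 2 * ε < omega q) :
    ∫⁻ t, W (split m k (q, t)) ∂torusMeasure ≤ ENNReal.ofReal (96 + 24 * (-Real.log ε)) := by
  calc _ ≤ ∫⁻ t, ENNReal.ofReal 4 * ENNReal.ofReal (ε + omega1 t.1 + omega1 t.2)⁻¹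
        ∂torusMeasure := by
        refine lintegral_mono fun t => ?_
        have h1 := omega_merge_le m k (split m k (q, t))
        rw [merge_split] at h1
        have h2 : ε < omega (split m k (q, t)) := by linarith
        rw [← ENNReal.ofReal_mul (by norm_num)]
        exact (hbad _ h2).trans (ENNReal.ofReal_le_ofReal (inv_omega_split_le m k q t hε h2))
    _ ≤ ENNReal.ofReal 4 * ENNReal.ofReal (24 + 6 * (-Real.log ε)) := by
        rw [lintegral_const_mul' _ _ ENNReal.ofReal_ne_top]
        exact mul_le_mul_right (lintegral_inv_torus_le hε hε1) _
    _ = _ := by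
        rw [← ENNReal.ofReal_mul (by norm_num)]
        congr 1
        ring

/-- The integral over the fibre for a merged configuration `q` in the set `ω ≤ 2 ε`. -/
theorem lintegral_fibre_le {n : ℕ} (m : Fin (n + 1)) (k : Fin n) (q : shell n)
    {lam ε κ γ : ℝ} (hlam : 0 < lam) (hlamε : lam ≤ ε) (hε1 : ε ≤ 1 / 5184)
    (hκ : 0 ≤ κ) (hκ1 : κ ≤ 1) (hγ : 0 < γ) {W : shell (n + 1) → ℝ≥0∞}
    (hbad : ∀ p, ε < omega p → W p ≤ ENNReal.ofReal (2 * (omega p)⁻¹))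
    (hgood : ∀ p, omega p ≤ ε → W p ≤ ENNReal.ofReal
      (γ⁻¹ * (lam + omega p + omegaR p * (-Real.log (lam + omega p)) ^ κ)⁻¹))
    (hq : omega q ≤ 2 * ε) :
    ∫⁻ t, W (split m k (q, t)) ∂torusMeasure
      ≤ ENNReal.ofReal (96 + 24 * (-Real.log ε)
        + γ⁻¹ * (256 + 96 * (-Real.log (lam + omega q)) ^ (1 - κ / 2))) := by
  have hm := measurable_omega1
  have hε : 0 < ε := hlam.trans_le hlamε
  have hq0 := omega_nonneg q
  set b := lam + omega q with hb
  have hb0 : 0 < b := by linarith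
  have hb1 : b ≤ 1 / 1296 := by linarith
  have hlb : 0 ≤ (-Real.log b) ^ (1 - κ / 2) :=
    Real.rpow_nonneg (neg_nonneg.mpr (Real.log_nonpos hb0.le (by linarith))) _
  have hlε : 0 ≤ -Real.log ε := neg_nonneg.mpr (Real.log_nonpos hε.le (by linarith))
  set f₁ := fun t : Momentum => ENNReal.ofReal 4
    * ENNReal.ofReal (ε + omega1 t.1 + omega1 t.2)⁻¹ with hf₁
  set f₂ := fun t : Momentum => ENNReal.ofReal (8 * (√(b + omega1 t.2) + omega1 t.1)⁻¹) with hf₂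
  set f₃ := {t : Momentum | b + omega1 t.2 ≤ 1 / 1296}.indicator (fun t => ENNReal.ofReal
        (4 * (b + omega1 t.2 + omega1 t.1 * (-Real.log (b + omega1 t.2)) ^ κ)⁻¹)) with hf₃
  have hpt (t : Momentum) :
      W (split m k (q, t)) ≤ f₁ t + ENNReal.ofReal γ⁻¹ * (f₂ t + f₃ t) := by
    set p := split m k (q, t) with hp
    have hω1 := add_le_omega p m
    have hR := omega1_le_omegaR p m
    have hω3 := omega_le_merge m k p
    have hω2 := omega_merge_le m k p
    rw [hp, split_same, ← hp] at hω1 hR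
    rw [hp, split_same, merge_split, ← hp] at hω3
    rw [hp, merge_split, ← hp] at hω2
    have ht1 := omega1_nonneg t.1
    have ht2 := omega1_nonneg t.2
    rcases lt_or_ge ε (omega p) with h | h
    · refine le_trans ?_ le_self_add
      simp only [hf₁]
      rw [← ENNReal.ofReal_mul (by norm_num)]
      exact (hbad _ h).trans (ENNReal.ofReal_le_ofReal (inv_omega_split_le m k q t hε h))
    · refine le_trans ?_ le_add_self
      have hw : b + omega1 t.2 ≤ 1 / 1296 := by linarith
      have hw0 : 0 < b + omega1 t.2 := by linarith
      have hlw : 0 < -Real.log (b + omega1 t.2) := neg_pos.mpr (Real.log_neg hw0 (by linarith))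
      have hpow : 0 < (-Real.log (b + omega1 t.2)) ^ κ := Real.rpow_pos_of_pos hlw κ
      rw [hf₃, Set.indicator_of_mem (show t ∈ {t : Momentum | b + omega1 t.2 ≤ 1 / 1296} from hw),
        hf₂, ← ENNReal.ofReal_add (by positivity) (by positivity),
        ← ENNReal.ofReal_mul (by positivity)]
      refine (hgood p h).trans (ENNReal.ofReal_le_ofReal (mul_le_mul_of_nonneg_left ?_
        (by positivity)))
      exact inv_add_mul_log_le hw0 hw ht1 (by linarith) (by linarith) (by linarith) hR hκ hκ1
  have h₁ : Measurable f₁ := by fun_prop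
  have h₂ : Measurable f₂ := by fun_prop
  have hi₁ : ∫⁻ t, f₁ t ∂torusMeasure ≤ ENNReal.ofReal (96 + 24 * (-Real.log ε)) := by
    rw [hf₁, lintegral_const_mul' _ _ ENNReal.ofReal_ne_top]
    refine (mul_le_mul_right (lintegral_inv_torus_le hε (by linarith)) _).trans_eq ?_
    rw [← ENNReal.ofReal_mul (by norm_num)]
    congr 1
    ring
  refine (lintegral_mono hpt).trans ?_
  rw [lintegral_add_left h₁, lintegral_const_mul' _ (fun t => f₂ t + f₃ t) ENNReal.ofReal_ne_top,
    lintegral_add_left h₂,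
    ENNReal.ofReal_add (p := 96 + 24 * (-Real.log ε)) (by positivity) (by positivity),
    ENNReal.ofReal_mul (p := γ⁻¹) (by positivity),
    ENNReal.ofReal_add (p := 256) (by norm_num) (by positivity)]
  exact add_le_add hi₁ (mul_le_mul_right (add_le_add (lintegral_inv_sqrt_add_le hb0)
    (lintegral_log_weight_le hb0 hb1 hκ hκ1)) _)

/-- The lower bound of the integral over the fibre for a merged configuration in the set `ω ≤ η⁴`.
On the region of integration `b (2 |log b|)^κ ≤ s² ≤ η² / 9`, `r² ≤ s² / (2 |log b|)^κ`, the
denominator is at most of order `s²`. -/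
theorem le_lintegral_fibre {n : ℕ} (m : Fin (n + 1)) (k : Fin n) (q : shell n)
    {lam η κ : ℝ} (hlam : 0 < lam) (hlamη : lam ≤ η ^ 4) (hη0 : 0 < η) (hη : Real.log η ≤ -16)
    (hκ : 0 ≤ κ) (hκ1 : κ ≤ 1) {W : shell (n + 1) → ℝ≥0∞} (hWm : Measurable W)
    (hgood : ∀ p, omega p ≤ η ^ 2 → ENNReal.ofReal
      (lam + omega p + omegaR p * (-Real.log (lam + omega p)) ^ κ)⁻¹ ≤ W p)
    (hq : omega q ≤ η ^ 4) :
    ENNReal.ofReal (1 / 20000 * (-Real.log (lam + omega q)) ^ (1 - κ / 2))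
      ≤ ∫⁻ t, {p | omega p ≤ 1 / 2}.indicator W (split m k (q, t)) ∂torusMeasure := by
  have hq0 := omega_nonneg q
  have hηsmall : η ≤ 1 / 12 := by
    have h1 : η ≤ Real.exp (-16) := (Real.log_le_iff_le_exp hη0).mp hη
    have h2 : Real.exp (-16) ≤ 1 / 12 := by
      rw [Real.exp_neg, one_div]
      exact inv_anti₀ (by norm_num) (by linarith [Real.add_one_le_exp (16 : ℝ)])
    linarith
  have hη2 : η ^ 2 ≤ 1 / 144 := by nlinarith
  have hη4 : η ^ 4 ≤ 1 / 144 * η ^ 2 := by nlinarith [sq_nonneg η]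
  set b := lam + omega q with hb
  have hb0 : 0 < b := by linarith
  have hbη : b ≤ 2 * η ^ 4 := by linarith
  set B := -Real.log b with hB
  have hlog2 : Real.log 2 ≤ 1 := by linarith [Real.log_two_lt_d9]
  have hlogη : 4 * (-Real.log η) - Real.log 2 ≤ B := by
    have h1 : Real.log b ≤ Real.log (2 * η ^ 4) := Real.log_le_log hb0 hbη
    rw [Real.log_mul (by norm_num) (by positivity), Real.log_pow] at h1
    push_cast at h1
    linarith
  have hB60 : 60 ≤ B := by linarith
  set M := (2 * B) ^ κ with hM
  have hM1 : 1 ≤ M := Real.one_le_rpow (by linarith) hκ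
  have hM2 : M ≤ 2 * B := by
    have h := Real.rpow_le_rpow_of_exponent_le (x := 2 * B) (by linarith) hκ1
    rwa [Real.rpow_one] at h
  have hM0 : 0 < M := by linarith
  have hMs : √M ≤ 2 * B ^ (κ / 2) := by
    have h1 : √M = (2 * B) ^ (κ / 2) := by
      rw [hM, Real.sqrt_eq_rpow, ← Real.rpow_mul (by linarith)]
      congr 1
      ring
    rw [h1, Real.mul_rpow (by norm_num) (by linarith)]
    refine mul_le_mul_of_nonneg_right ?_ (Real.rpow_nonneg (by linarith) _)
    have h2 := Real.rpow_le_rpow_of_exponent_le (x := 2) (by norm_num)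
      (show κ / 2 ≤ 1 by linarith)
    rwa [Real.rpow_one] at h2
  set s₀ := √(b * M) with hs₀
  have hs₀0 : 0 < s₀ := Real.sqrt_pos.mpr (by positivity)
  have hs₀2 : s₀ ^ 2 = b * M := Real.sq_sqrt (by positivity)
  -- The length of the interval of integration on the logarithmic scale.
  have hlog : B / 8 ≤ Real.log (η / 3 / s₀) := by
    have h1 : Real.log s₀ = (-B + Real.log M) / 2 := by
      rw [hs₀, Real.log_sqrt (by positivity), Real.log_mul hb0.ne' hM0.ne', hB]
      ring
    have h2 : Real.log M ≤ 2 + B / 8 := by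
      have h3 : Real.log M ≤ Real.log (2 * B) := Real.log_le_log hM0 hM2
      have h4 : Real.log (2 * B) = 4 * Real.log 2 + Real.log (B / 8) := by
        rw [show 2 * B = 2 ^ 4 * (B / 8) by ring, Real.log_mul (by norm_num) (by positivity),
          Real.log_pow]
        norm_num
      have h5 := Real.log_le_sub_one_of_pos (show 0 < B / 8 by linarith)
      linarith [Real.log_two_lt_d9]
    have h3 : Real.log 3 ≤ 2 := by
      have h4 := Real.log_le_sub_one_of_pos (show (0 : ℝ) < 3 by norm_num)
      linarith
    rw [Real.log_div (by positivity) hs₀0.ne', Real.log_div hη0.ne' (by norm_num), h1]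
    linarith
  have hs : s₀ ≤ η / 3 := by
    have h1 : 0 ≤ Real.log (η / 3 / s₀) := by linarith
    have h2 : 1 ≤ η / 3 / s₀ := (Real.log_nonneg_iff (by positivity)).mp h1
    rwa [one_le_div hs₀0] at h2
  have hset : MeasurableSet {p : shell (n + 1) | omega p ≤ 1 / 2} :=
    measurableSet_le (continuous_omega _).measurable measurable_const
  refine le_trans ?_ (le_lintegral_torus (K := 18) (M := M) (s₀ := s₀) (s₁ := η / 3)
    ((hWm.indicator hset).comp (measurable_split_right m k q)) (by norm_num) hM1 hs₀0 hs
    (by linarith) ?_)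
  · refine ENNReal.ofReal_le_ofReal ?_
    have hB0 : 0 < B := by linarith
    have h1 : 0 < B ^ (κ / 2) := Real.rpow_pos_of_pos hB0 _
    have h2 : 0 < √M := Real.sqrt_pos.mpr hM0
    rw [Real.rpow_sub hB0, Real.rpow_one, le_div_iff₀ (by positivity)]
    calc 1 / 20000 * (B / B ^ (κ / 2)) * (64 * 18 * √M)
        ≤ 1 / 20000 * (B / B ^ (κ / 2)) * (64 * 18 * (2 * B ^ (κ / 2))) := by gcongr
      _ = B * (2304 / 20000) := by field_simp; norm_num
      _ ≤ B / 8 := by linarith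
      _ ≤ _ := hlog
  · intro r s hr hrs hs0 hs1
    have hspos : 0 < s := hs₀0.trans hs0
    have hx := omega1_coe_le r
    have hy := omega1_coe_le s
    have hx0 := omega1_nonneg (r : Angle)
    have hy0 := omega1_nonneg (s : Angle)
    have hr2 : r ^ 2 * M ≤ s ^ 2 := by
      have h2 : 0 < √M := Real.sqrt_pos.mpr hM0
      have h3 : r * √M ≤ s := ((lt_div_iff₀ h2).mp hrs).le
      calc r ^ 2 * M = (r * √M) ^ 2 := by rw [mul_pow, Real.sq_sqrt hM0.le]
        _ ≤ s ^ 2 := pow_le_pow_left₀ (by positivity) h3 2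
    have hbs : b * M ≤ s ^ 2 := by
      rw [← hs₀2]
      exact pow_le_pow_left₀ hs₀0.le hs0.le 2
    set p := split m k (q, ((r : Angle), (s : Angle))) with hp
    have hω2 := omega_merge_le m k p
    have hω3 := omega_le_merge m k p
    have hR := omegaR_le_merge m k p
    rw [hp, merge_split, ← hp] at hω2
    rw [hp, split_same, merge_split, ← hp] at hω3 hR
    simp only at hω3 hR
    have hRq := omegaR_le_omega q
    have hR0 := omegaR_nonneg p
    set x := omega1 (r : Angle)
    set y := omega1 (s : Angle)
    have hxs : x * M ≤ s ^ 2 := (mul_le_mul_of_nonneg_right hx hM0.le).trans hr2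
    have hxs' : x ≤ s ^ 2 := (le_mul_of_one_le_right hx0 hM1).trans hxs
    have hs2 : s ^ 2 ≤ η ^ 2 / 9 := by
      have h := pow_le_pow_left₀ hspos.le hs1.le 2
      linarith
    have hgp : omega p ≤ η ^ 2 := by linarith
    have hz0 : 0 < lam + omega p := by linarith [omega_nonneg p]
    have hlz0 : 0 ≤ -Real.log (lam + omega p) :=
      neg_nonneg.mpr (Real.log_nonpos hz0.le (by linarith))
    have hlz : -Real.log (lam + omega p) ≤ 2 * B := by
      have h1 : Real.log (b / 2) ≤ Real.log (lam + omega p) :=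
        Real.log_le_log (by linarith) (by linarith)
      rw [Real.log_div hb0.ne' (by norm_num)] at h1
      linarith
    have hL : (-Real.log (lam + omega p)) ^ κ ≤ M := Real.rpow_le_rpow hlz0 hlz hκ
    have hL0 : 0 ≤ (-Real.log (lam + omega p)) ^ κ := Real.rpow_nonneg hlz0 κ
    change _ ≤ {p | omega p ≤ 1 / 2}.indicator W p
    rw [Set.indicator_of_mem (show p ∈ {p | omega p ≤ 1 / 2} from by
      change omega p ≤ 1 / 2; linarith)]
    refine le_trans (ENNReal.ofReal_le_ofReal (inv_anti₀ ?_ ?_)) (hgood p hgp)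
    · have := mul_nonneg hR0 hL0
      linarith
    · have h1 : omegaR p * (-Real.log (lam + omega p)) ^ κ ≤ (3 * x + 2 * b) * M :=
        mul_le_mul (by linarith) hL hL0 (by positivity)
      have h2 : b ≤ b * M := le_mul_of_one_le_right hb0.le hM1
      nlinarith

/-! ### Small values of `λ` -/

/-- For small `λ` the number `log |log λ|` is large, so that the absolute value in `loglog` has no
effect and exponentiation recovers `|log λ|`. -/
theorem exists_forall_lt_loglog (A : ℝ) : ∃ lam₀ : ℝ, 0 < lam₀ ∧ ∀ lam : ℝ, 0 < lam → lam < lam₀ →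
    A ≤ loglog lam ∧ Real.log lam < 0 ∧ |Real.log lam| = Real.exp (loglog lam) := by
  refine ⟨Real.exp (-Real.exp (max A 1)), Real.exp_pos _, fun lam h0 h1 => ?_⟩
  have h2 : Real.log lam < -Real.exp (max A 1) := by
    rw [← Real.log_exp (-Real.exp (max A 1))]
    exact Real.log_lt_log h0 h1
  have h3 : Real.exp (max A 1) < |Real.log lam| := by
    rw [abs_of_neg (by linarith [Real.exp_pos (max A 1)])]
    linarith
  have h4 : 0 < |Real.log lam| := (Real.exp_pos _).trans h3
  have h5 : max A 1 < Real.log |Real.log lam| := by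
    rwa [Real.lt_log_iff_exp_lt h4]
  have h6 : loglog lam = Real.log |Real.log lam| :=
    abs_of_pos (by linarith [le_max_right A 1])
  rw [h6, Real.exp_log h4]
  exact ⟨(le_max_left A 1).trans h5.le, h2.trans (neg_lt_zero.mpr (Real.exp_pos _)), rfl⟩

/-- The relations between the parameters, for small `λ`. The number `η = |log λ|^{-τ}` is the fourth
root of the bound `|log λ|^{-4τ}` that defines the smaller good set. -/
structure SmallParameters (lam τ η : ℝ) : Prop where
  lam_pos : 0 < lam
  one_lt : 1 < τ
  large : 10 ^ 18 * τ ≤ √(loglog lam)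
  eta_pos : 0 < η
  log_eta : Real.log η = -(τ * loglog lam)
  good_iff : ∀ {n : ℕ} (p : shell n), Good lam τ p ↔ omega p ≤ η ^ 2
  good_two_iff : ∀ {n : ℕ} (p : shell n), Good lam (2 * τ) p ↔ omega p ≤ η ^ 4
  lam_le : lam ≤ η ^ 4

theorem exists_smallParameters {τ : ℝ} (hτ : 1 < τ) : ∃ lam₀ : ℝ, 0 < lam₀ ∧
    ∀ lam : ℝ, 0 < lam → lam < lam₀ → ∃ η, SmallParameters lam τ η := by
  obtain ⟨lam₀, h0, h⟩ := exists_forall_lt_loglog ((10 ^ 18 * τ) ^ 2)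
  refine ⟨lam₀, h0, fun lam hlam hlt => ?_⟩
  obtain ⟨h1, h0', h2⟩ := h lam hlam hlt
  set ℓ := loglog lam with hℓ
  have hℓ1 : 8 * τ ≤ ℓ := by nlinarith
  have hpow (a : ℝ) : |Real.log lam| ^ a = Real.exp (ℓ * a) := by
    rw [h2, ← Real.exp_mul]
  refine ⟨Real.exp (-(τ * ℓ)), hlam, hτ, Real.le_sqrt_of_sq_le h1, Real.exp_pos _,
    Real.log_exp _, fun p => ?_, fun p => ?_, ?_⟩
  · rw [Good, hpow, ← Real.exp_nat_mul]
    norm_num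
    ring_nf
  · rw [Good, hpow, ← Real.exp_nat_mul]
    norm_num
    ring_nf
  · have h3 : lam = Real.exp (-Real.exp ℓ) := by
      rw [← h2]
      rw [abs_of_neg h0', neg_neg, Real.exp_log hlam]
    rw [← Real.exp_nat_mul]
    nth_rewrite 1 [h3]
    refine Real.exp_le_exp.mpr ?_
    have h4 := Real.quadratic_le_exp_of_nonneg (x := ℓ) (by linarith)
    push_cast
    nlinarith

theorem sqrt_loglog_sq (lam : ℝ) : √(loglog lam) ^ 2 = loglog lam := Real.sq_sqrt (abs_nonneg _)

namespace SmallParameters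

theorem large_one {lam τ η : ℝ} (h : SmallParameters lam τ η) : 10 ^ 18 ≤ √(loglog lam) := by
  linarith [h.large, h.one_lt]

theorem loglog_large {lam τ η : ℝ} (h : SmallParameters lam τ η) : 10 ^ 18 ≤ loglog lam := by
  nlinarith [sqrt_loglog_sq lam, h.large_one]

theorem mul_loglog_large {lam τ η : ℝ} (h : SmallParameters lam τ η) :
    10 ^ 18 ≤ τ * loglog lam := by
  nlinarith [h.loglog_large, h.one_lt]

theorem log_eta_le {lam τ η : ℝ} (h : SmallParameters lam τ η) : Real.log η ≤ -16 := by
  linarith [h.log_eta, h.mul_loglog_large]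

theorem eta_sq_le {lam τ η : ℝ} (h : SmallParameters lam τ η) : η ^ 2 ≤ 1 / 5184 := by
  have h1 : η ≤ Real.exp (-16) := by
    rw [← Real.log_le_iff_le_exp h.eta_pos]
    exact h.log_eta_le
  have h2 : Real.exp (-16) ≤ 1 / 72 := by
    have h3 := Real.quadratic_le_exp_of_nonneg (x := 16) (by norm_num)
    rw [Real.exp_neg, inv_eq_one_div]
    exact one_div_le_one_div_of_le (by norm_num) (by linarith)
  have h4 := pow_le_pow_left₀ h.eta_pos.le (h1.trans h2) 2
  norm_num at h4 ⊢
  exact h4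

theorem eta_four_le {lam τ η : ℝ} (h : SmallParameters lam τ η) : 2 * η ^ 4 ≤ η ^ 2 := by
  nlinarith [h.eta_sq_le, sq_nonneg η]

theorem log_eta_four {lam τ η : ℝ} (h : SmallParameters lam τ η) :
    Real.log (η ^ 4) = -(4 * (τ * loglog lam)) := by
  rw [Real.log_pow, h.log_eta]
  push_cast
  ring

/-- On the good set the logarithm is negative and of size at least one. -/
theorem one_le_neg_log {lam τ η : ℝ} (h : SmallParameters lam τ η)
    {x : ℝ} (hx : 0 ≤ x) (hx' : x ≤ η ^ 2) :
    1 ≤ -Real.log (lam + x) := by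
  have h1 : lam + x ≤ Real.exp (-1) := by
    have h2 : (0.36 : ℝ) < Real.exp (-1) := by linarith [Real.exp_neg_one_gt_d9]
    linarith [h.lam_le, h.eta_four_le, h.eta_sq_le, h2]
  have h3 := (Real.log_le_iff_le_exp (by linarith [h.lam_pos])).mpr h1
  linarith

/-- On the smaller good set the logarithm exceeds `log |log λ|`. -/
theorem loglog_le_neg_log {lam τ η : ℝ} (h : SmallParameters lam τ η)
    {x : ℝ} (hx : 0 ≤ x) (hx' : x ≤ η ^ 4) :
    loglog lam ≤ -Real.log (lam + x) := by
  have h1 : lam + x ≤ 2 * η ^ 4 := by linarith [h.lam_le]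
  have h2 := Real.log_le_log (by linarith [h.lam_pos]) h1
  have h4 : 0 < η ^ 4 := pow_pos h.eta_pos 4
  rw [Real.log_mul (by norm_num) h4.ne', h.log_eta_four] at h2
  nlinarith [Real.log_two_lt_d9, h.loglog_large, h.one_lt]

end SmallParameters

open Classical in
/-- The logarithmic factor in the upper self-energy. -/
def growth {n : ℕ} (lam κ τ : ℝ) (q : shell n) : ℝ :=
  if Good lam τ q then |Real.log (lam + omega q)| ^ κ
  else max 1 |Real.log (lam + omega q)|

theorem symbolU_eq {n : ℕ} (lam κ τ : ℝ) (q : shell n) :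
    symbolU n lam κ τ q = omegaR q * growth lam κ τ q := by
  unfold symbolU growth
  split_ifs <;> rfl

theorem measurable_growth {n : ℕ} (lam κ τ : ℝ) :
    Measurable (growth (n := n) lam κ τ) := by
  have hm : Measurable fun q : shell n => |Real.log (lam + omega q)| := by
    have h1 : Measurable fun q : shell n => Real.log (lam + omega q) :=
      Real.measurable_log.comp (measurable_const.add (continuous_omega n).measurable)
    exact measurable_abs.comp h1
  refine Measurable.ite ?_ (hm.pow_const κ) (measurable_const.max hm)
  exact measurableSet_le (continuous_omega n).measurable measurable_const

theorem SmallParameters.one_le_growth {lam τ η : ℝ} (h : SmallParameters lam τ η) {κ : ℝ}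
    (hκ : 0 ≤ κ) {n : ℕ} (q : shell n) : 1 ≤ growth lam κ τ q := by
  unfold growth
  split_ifs with hg
  · have h1 := h.one_le_neg_log (omega_nonneg q) ((h.good_iff q).mp hg)
    exact Real.one_le_rpow (h1.trans (neg_le_abs _)) hκ
  · exact le_max_left _ _

theorem SmallParameters.growth_of_le {lam τ η : ℝ} (h : SmallParameters lam τ η) (κ : ℝ)
    {n : ℕ} {q : shell n} (hq : omega q ≤ η ^ 2) :
    growth lam κ τ q = (-Real.log (lam + omega q)) ^ κ := by
  have h1 := h.one_le_neg_log (omega_nonneg q) hq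
  rw [growth, if_pos ((h.good_iff q).mpr hq), abs_of_neg (by linarith)]

theorem symbolU_nonneg {n : ℕ} (lam κ τ : ℝ) (q : shell n) : 0 ≤ symbolU n lam κ τ q := by
  rw [symbolU_eq]
  refine mul_nonneg (omegaR_nonneg q) ?_
  unfold growth
  split_ifs
  · exact Real.rpow_nonneg (abs_nonneg _) _
  · exact zero_le_one.trans (le_max_left _ _)

/-! ### The two estimates on the quadratic forms -/

/-- The multiplier to which `λ - S + Ω` is compared from below. -/
def lowerSymbol (n : ℕ) (lam κ τ γ : ℝ) (p : shell n) : ℝ :=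
  lam + omega p + γ * symbolV n lam κ (2 * τ) p

/-- The multiplier to which `λ - S + Ω` is compared from above, up to the factor `γ⁻¹`. -/
def upperSymbol (n : ℕ) (lam κ τ : ℝ) (p : shell n) : ℝ :=
  lam + omega p + symbolU n lam κ τ p

theorem isSymbol_lowerSymbol (n : ℕ) {lam κ : ℝ} (hlam : 0 < lam) (hκ : 0 ≤ κ) (τ γ : ℝ) :
    IsSymbol (lowerSymbol n lam κ τ γ) :=
  (isSymbol_lam_add_omega n lam).add ((isSymbol_symbolV n hlam hκ (2 * τ)).const_mul γ)

theorem isSymbol_upperSymbol (n : ℕ) {lam κ : ℝ} (hlam : 0 < lam) (hκ : 0 ≤ κ) (τ : ℝ) :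
    IsSymbol (upperSymbol n lam κ τ) :=
  (isSymbol_lam_add_omega n lam).add (isSymbol_symbolU n hlam hκ τ)

theorem le_upperSymbol {n : ℕ} (lam κ τ : ℝ) (p : shell n) :
    lam + omega p ≤ upperSymbol n lam κ τ p :=
  le_add_of_nonneg_right (symbolU_nonneg lam κ τ p)

theorem SmallParameters.gamma_mul_sq_le {lam τ η γ : ℝ} (h : SmallParameters lam τ η)
    (hγ : γ ≤ (loglog lam ^ 3)⁻¹) : γ * loglog lam ^ 2 ≤ 1 / 2 := by
  have h1 := h.loglog_large
  have h0 : 0 < loglog lam := by linarith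
  calc γ * loglog lam ^ 2 ≤ (loglog lam ^ 3)⁻¹ * loglog lam ^ 2 := by gcongr
    _ = (loglog lam)⁻¹ := by field_simp
    _ ≤ 1 / 2 := by
      rw [inv_eq_one_div]
      exact one_div_le_one_div_of_le (by norm_num) (by linarith)

theorem SmallParameters.gamma_le_one {lam τ η γ : ℝ} (h : SmallParameters lam τ η)
    (hγ : γ ≤ (loglog lam ^ 3)⁻¹) : γ ≤ 1 :=
  hγ.trans (inv_le_one_of_one_le₀ (one_le_pow₀ (by linarith [h.loglog_large])))

/-- Off the smaller good set, the negative part of the lower self-energy costs at most half of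
`ω`. -/
theorem SmallParameters.le_lowerSymbol_of_lt {lam τ η γ : ℝ} (h : SmallParameters lam τ η)
    (hγ : γ ≤ (loglog lam ^ 3)⁻¹) {n : ℕ} {κ : ℝ} {p : shell n} (hp : η ^ 4 < omega p) :
    lam + omega p / 2 ≤ lowerSymbol n lam κ τ γ p := by
  have h1 := h.gamma_mul_sq_le hγ
  have h2 := omegaR_le_omega p
  have h3 := omegaR_nonneg p
  rw [lowerSymbol, symbolV, if_neg (fun hg => hp.not_ge ((h.good_two_iff p).mp hg))]
  nlinarith

theorem SmallParameters.lowerSymbol_of_le {lam τ η γ : ℝ} (h : SmallParameters lam τ η)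
    {n : ℕ} {κ : ℝ} {p : shell n} (hp : omega p ≤ η ^ 4) :
    lowerSymbol n lam κ τ γ p
      = lam + omega p + γ * (omegaR p * (-Real.log (lam + omega p)) ^ κ) := by
  have h1 := h.loglog_le_neg_log (omega_nonneg p) hp
  have h2 := h.loglog_large
  rw [lowerSymbol, symbolV, if_pos ((h.good_two_iff p).mpr hp), abs_of_neg (by linarith)]

theorem SmallParameters.lam_le_lowerSymbol {lam τ η γ : ℝ} (h : SmallParameters lam τ η)
    (hγ0 : 0 < γ) (hγ : γ ≤ (loglog lam ^ 3)⁻¹) {n : ℕ} {κ : ℝ} (p : shell n) :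
    lam ≤ lowerSymbol n lam κ τ γ p := by
  have h0 := omega_nonneg p
  rcases le_or_gt (omega p) (η ^ 4) with hp | hp
  · have h1 := h.loglog_le_neg_log (omega_nonneg p) hp
    have h2 := h.loglog_large
    rw [h.lowerSymbol_of_le hp]
    have h3 : 0 ≤ γ * (omegaR p * (-Real.log (lam + omega p)) ^ κ) :=
      mul_nonneg hγ0.le (mul_nonneg (omegaR_nonneg p) (Real.rpow_nonneg (by linarith) _))
    linarith
  · linarith [h.le_lowerSymbol_of_lt hγ (κ := κ) hp]

theorem SmallParameters.four_le {lam τ η : ℝ} (h : SmallParameters lam τ η) :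
    η ^ 4 ≤ 1 / 5184 := by
  linarith [h.eta_four_le, h.eta_sq_le, pow_pos h.eta_pos 4]

/-- The fibre integral of the inverse of the lower multiplier. -/
theorem SmallParameters.lintegral_fibre_lowerSymbol_le {lam τ η γ κ : ℝ}
    (h : SmallParameters lam τ η) (hγ0 : 0 < γ) (hγ : γ ≤ (loglog lam ^ 3)⁻¹)
    (hκ : 0 ≤ κ) (hκ1 : κ ≤ 1) {n : ℕ} (m : Fin (n + 1)) (k : Fin n) (q : shell n) :
    ∫⁻ t, ENNReal.ofReal (lowerSymbol (n + 1) lam κ τ γ (split m k (q, t)))⁻¹ ∂torusMeasure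
      ≤ ENNReal.ofReal (γ⁻¹ * (448 + 96 * (τ * loglog lam)) * growth lam (1 - κ / 2) τ q) := by
  have hlam := h.lam_pos
  have hε : 0 < η ^ 4 := pow_pos h.eta_pos 4
  have hγ1 := h.gamma_le_one hγ
  have hγi : 1 ≤ γ⁻¹ := (one_le_inv₀ hγ0).mpr hγ1
  have hT := h.mul_loglog_large
  have hg : 1 ≤ growth lam (1 - κ / 2) τ q := h.one_le_growth (by linarith) q
  have hbad (p : shell (n + 1)) (hp : η ^ 4 < omega p) :
      ENNReal.ofReal (lowerSymbol (n + 1) lam κ τ γ p)⁻¹ ≤ ENNReal.ofReal (2 * (omega p)⁻¹) := by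
    have h1 := h.le_lowerSymbol_of_lt hγ (κ := κ) hp
    have h2 : 0 < omega p := hε.trans hp
    refine ENNReal.ofReal_le_ofReal ?_
    calc (lowerSymbol (n + 1) lam κ τ γ p)⁻¹ ≤ (omega p / 2)⁻¹ :=
          inv_anti₀ (by linarith) (by linarith)
      _ = 2 * (omega p)⁻¹ := by rw [inv_div, div_eq_mul_inv]
  have hgood (p : shell (n + 1)) (hp : omega p ≤ η ^ 4) :
      ENNReal.ofReal (lowerSymbol (n + 1) lam κ τ γ p)⁻¹ ≤ ENNReal.ofReal
        (γ⁻¹ * (lam + omega p + omegaR p * (-Real.log (lam + omega p)) ^ κ)⁻¹) := by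
    refine ENNReal.ofReal_le_ofReal ?_
    have h0 := omega_nonneg p
    have h1 := h.loglog_le_neg_log h0 hp
    have h2 := h.loglog_large
    have h3 : 0 ≤ omegaR p * (-Real.log (lam + omega p)) ^ κ :=
      mul_nonneg (omegaR_nonneg p) (Real.rpow_nonneg (by linarith) _)
    rw [h.lowerSymbol_of_le hp, ← mul_inv]
    refine inv_anti₀ (by positivity) ?_
    nlinarith
  rcases le_or_gt (omega q) (2 * η ^ 4) with hq | hq
  · refine (lintegral_fibre_le m k q hlam h.lam_le h.four_le hκ hκ1 hγ0
      (W := fun p => ENNReal.ofReal (lowerSymbol (n + 1) lam κ τ γ p)⁻¹) hbad hgood hq).trans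
      (ENNReal.ofReal_le_ofReal ?_)
    rw [← h.growth_of_le (1 - κ / 2) (hq.trans h.eta_four_le), h.log_eta_four]
    set g := growth lam (1 - κ / 2) τ q
    set T := τ * loglog lam
    have h1 : (96 + 96 * T) ≤ γ⁻¹ * ((96 + 96 * T) * g) := by
      have h3 : 1 ≤ γ⁻¹ * g := one_le_mul_of_one_le_of_one_le hγi hg
      nlinarith
    have h2 : γ⁻¹ * 256 ≤ γ⁻¹ * (256 * g) := by gcongr; linarith
    linarith
  · refine (lintegral_fibre_le_of_lt m k q hε (h.four_le.trans (by norm_num))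
      (W := fun p => ENNReal.ofReal (lowerSymbol (n + 1) lam κ τ γ p)⁻¹) hbad hq).trans
      (ENNReal.ofReal_le_ofReal ?_)
    rw [h.log_eta_four]
    set g := growth lam (1 - κ / 2) τ q
    set T := τ * loglog lam
    have h3 : 1 ≤ γ⁻¹ * g := one_le_mul_of_one_le_of_one_le hγi hg
    nlinarith

/-- The powers of `n` and of `log |log λ|` that the upper estimate costs. -/
theorem SmallParameters.succ_mul_mul_le {lam τ η : ℝ} (h : SmallParameters lam τ η) {n : ℕ}
    (hn : 1 ≤ n) (hn10 : (n : ℝ) ^ 10 ≤ √(loglog lam)) :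
    ((n + 1) * n : ℝ) * (448 + 96 * (τ * loglog lam)) ≤ loglog lam ^ 2 := by
  have h1 : (1 : ℝ) ≤ n := by exact_mod_cast hn
  have h2 : (n : ℝ) ^ 2 ≤ (n : ℝ) ^ 10 := pow_le_pow_right₀ h1 (by norm_num)
  have h3 : ((n + 1) * n : ℝ) ≤ 2 * √(loglog lam) := by nlinarith
  have h4 := h.mul_loglog_large
  have h5 : (448 : ℝ) + 96 * (τ * loglog lam) ≤ 544 * (τ * loglog lam) := by linarith
  have h6 := h.large
  have h7 := h.loglog_large
  calc ((n + 1) * n : ℝ) * (448 + 96 * (τ * loglog lam))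
      ≤ (2 * √(loglog lam)) * (544 * (τ * loglog lam)) := by gcongr
    _ ≤ √(loglog lam) * √(loglog lam) * loglog lam := by
      have h8 : 1088 * τ ≤ √(loglog lam) := by linarith [h.one_lt]
      have h9 : 0 ≤ √(loglog lam) * loglog lam := by positivity
      nlinarith
    _ = loglog lam ^ 2 := by rw [← sq, sqrt_loglog_sq, sq]

/-- The upper bound on the quadratic form of the inverse of the lower multiplier. -/
theorem integral_creation_le {lam τ η γ κ : ℝ}
    (h : SmallParameters lam τ η) (hγ0 : 0 < γ) (hγ : γ ≤ (loglog lam ^ 3)⁻¹)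
    (hκ : 0 ≤ κ) (hκ1 : κ ≤ 1) {n : ℕ} (hn : 1 ≤ n) (hn10 : (n : ℝ) ^ 10 ≤ √(loglog lam))
    (F : SymL2 n) :
    ∫ p, (lowerSymbol (n + 1) lam κ τ γ p)⁻¹
        * ‖(creation n F : Lp ℂ 2 (mu (n + 1))) p‖ ^ 2 ∂mu (n + 1)
      ≤ γ⁻¹ * loglog lam ^ 2
        * ∫ q, symbolU n lam (1 - κ / 2) τ q * ‖(F : Lp ℂ 2 (mu n)) q‖ ^ 2 ∂mu n := by
  have hlam := h.lam_pos
  have hU := isSymbol_symbolU n hlam (κ := 1 - κ / 2) (by linarith) τ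
  have hM := (isSymbol_lowerSymbol (n + 1) hlam hκ τ γ).inv hlam
    (h.lam_le_lowerSymbol hγ0 hγ)
  have hM0 (p : shell (n + 1)) : 0 ≤ (lowerSymbol (n + 1) lam κ τ γ p)⁻¹ :=
    inv_nonneg.mpr (hlam.le.trans (h.lam_le_lowerSymbol hγ0 hγ p))
  have hc : 0 ≤ γ⁻¹ * loglog lam ^ 2 := by positivity
  have hU0 := symbolU_nonneg (n := n) lam (1 - κ / 2) τ
  have hR0 : 0 ≤ γ⁻¹ * loglog lam ^ 2
        * ∫ q, symbolU n lam (1 - κ / 2) τ q * ‖(F : Lp ℂ 2 (mu n)) q‖ ^ 2 ∂mu n :=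
    mul_nonneg hc (integral_nonneg fun q => mul_nonneg (hU0 q) (sq_nonneg _))
  rw [← ENNReal.ofReal_le_ofReal_iff hR0, ENNReal.ofReal_mul hc,
    ofReal_integral_eq_lintegral_ofReal (integrable_mul_norm_sq hM.measurable hM.bounded _)
      (Filter.Eventually.of_forall fun p => mul_nonneg (hM0 p) (sq_nonneg _)),
    ofReal_integral_eq_lintegral_ofReal (integrable_mul_norm_sq hU.measurable hU.bounded _)
      (Filter.Eventually.of_forall fun q => mul_nonneg (hU0 q) (sq_nonneg _))]
  have hJ : Measurable fun q : shell n => ENNReal.ofReal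
      (γ⁻¹ * (448 + 96 * (τ * loglog lam)) * growth lam (1 - κ / 2) τ q) :=
    (measurable_const.mul (measurable_growth _ _ _)).ennreal_ofReal
  have h1 := lintegral_creation_le F
    (W := fun p => ENNReal.ofReal (lowerSymbol (n + 1) lam κ τ γ p)⁻¹)
    hM.measurable.ennreal_ofReal hJ (h.lintegral_fibre_lowerSymbol_le hγ0 hγ hκ hκ1)
  simp only [ENNReal.ofReal_mul (hM0 _)]
  refine h1.trans ?_
  rw [← lintegral_const_mul' _ _ ENNReal.ofReal_ne_top,
    ← lintegral_const_mul' _ _ ENNReal.ofReal_ne_top]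
  refine lintegral_mono fun q => ?_
  have hg : 1 ≤ growth lam (1 - κ / 2) τ q := h.one_le_growth (by linarith) q
  have hT := h.mul_loglog_large
  have hR := omegaR_nonneg q
  have hK := h.succ_mul_mul_le hn hn10
  have hγi : 0 < γ⁻¹ := inv_pos.mpr hγ0
  rw [← ENNReal.ofReal_mul (by positivity), ← ENNReal.ofReal_mul hR,
    ← ENNReal.ofReal_mul (by positivity), ← ENNReal.ofReal_mul hc, symbolU_eq]
  refine ENNReal.ofReal_le_ofReal ?_
  set g := growth lam (1 - κ / 2) τ q
  set f := ‖(F : Lp ℂ 2 (mu n)) q‖ ^ 2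
  have hf : 0 ≤ f := sq_nonneg _
  calc _ = (γ⁻¹ * (omegaR q * g * f)) * (((n + 1) * n : ℝ) * (448 + 96 * (τ * loglog lam))) := by
        ring
    _ ≤ (γ⁻¹ * (omegaR q * g * f)) * loglog lam ^ 2 := by gcongr
    _ = _ := by ring

/-- The powers of `n` that the off-diagonal terms cost, against the diagonal terms. -/
theorem SmallParameters.sq_mul_le {lam τ η : ℝ} (h : SmallParameters lam τ η) {n : ℕ}
    (hn : 1 ≤ n) (hn10 : (n : ℝ) ^ 10 ≤ √(loglog lam)) :
    (((n : ℝ) + 1) * n) ^ 2 * 768 ≤ 1 / 160000 * √(loglog lam) := by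
  have h1 : (1 : ℝ) ≤ n := by exact_mod_cast hn
  have h2 : ((n : ℝ) ^ 4) ^ 2 ≤ √(loglog lam) := by
    rw [← pow_mul]
    exact (pow_le_pow_right₀ h1 (by norm_num)).trans hn10
  have h3 : (((n : ℝ) + 1) * n) ^ 2 ≤ 4 * (n : ℝ) ^ 4 := by
    have h4 : ((n : ℝ) + 1) * n ≤ 2 * (n : ℝ) ^ 2 := by nlinarith
    have h5 := pow_le_pow_left₀ (by positivity) h4 2
    calc _ ≤ _ := h5
      _ = _ := by ring
  -- `√ℓ ≥ 10¹⁸`, so that `n⁴ ≤ ℓ^{1/4}` is a small multiple of `√ℓ`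
  have h4 : (n : ℝ) ^ 4 ≤ 1 / 10 ^ 9 * √(loglog lam) := by
    refine le_of_sq_le_sq ?_ (by positivity)
    have h5 := h.large_one
    nlinarith
  linarith [Real.sqrt_nonneg (loglog lam)]

open Classical in
/-- The lower bound for the fibre integrals: a logarithm on the smaller good set. -/
def fibreBound {n : ℕ} (lam κ τ : ℝ) (q : shell n) : ℝ :=
  if Good lam (2 * τ) q then 1 / 20000 * (-Real.log (lam + omega q)) ^ κ else 0

theorem measurable_fibreBound {n : ℕ} (lam κ τ : ℝ) :
    Measurable (fibreBound (n := n) lam κ τ) := by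
  have h1 : Measurable fun q : shell n => -Real.log (lam + omega q) :=
    (Real.measurable_log.comp (measurable_const.add (continuous_omega n).measurable)).neg
  refine Measurable.ite ?_ (measurable_const.mul (h1.pow_const κ)) measurable_const
  exact measurableSet_le (continuous_omega n).measurable measurable_const

theorem SmallParameters.fibreBound_nonneg {lam τ η : ℝ} (h : SmallParameters lam τ η) (κ : ℝ)
    {n : ℕ} (q : shell n) : 0 ≤ fibreBound lam κ τ q := by
  unfold fibreBound
  split_ifs with hg
  · have h1 := h.loglog_le_neg_log (omega_nonneg q) ((h.good_two_iff q).mp hg)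
    have h2 := h.loglog_large
    have h3 : 0 ≤ (-Real.log (lam + omega q)) ^ κ := Real.rpow_nonneg (by linarith) _
    positivity
  · exact le_rfl

theorem SmallParameters.fibreBound_le {lam τ η κ : ℝ} (h : SmallParameters lam τ η)
    (hκ : 0 ≤ κ) (hκ1 : κ ≤ 1) {n : ℕ} (m : Fin (n + 1)) (k : Fin n) (q : shell n) :
    ENNReal.ofReal (fibreBound lam (1 - κ / 2) τ q)
      ≤ ∫⁻ t, {p | omega p ≤ 1 / 2}.indicator
        (fun p => ENNReal.ofReal (upperSymbol (n + 1) lam κ τ p)⁻¹) (split m k (q, t))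
          ∂torusMeasure := by
  have hlam := h.lam_pos
  by_cases hq : Good lam (2 * τ) q
  · rw [fibreBound, if_pos hq]
    refine le_lintegral_fibre m k q hlam h.lam_le h.eta_pos h.log_eta_le hκ hκ1
      ?_ (fun p hp => le_of_eq ?_) ((h.good_two_iff q).mp hq)
    · exact (isSymbol_upperSymbol (n + 1) hlam hκ τ).measurable.inv.ennreal_ofReal
    · rw [upperSymbol, symbolU_eq, h.growth_of_le κ hp]
  · rw [fibreBound, if_neg hq, ENNReal.ofReal_zero]
    exact zero_le

/-- Pointwise, the diagonal terms dominate the off-diagonal ones, on the smaller good set because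
of the logarithm and elsewhere because the lower self-energy is negative there. -/
theorem SmallParameters.symbolV_add_le {lam τ η κ N : ℝ} (h : SmallParameters lam τ η)
    (hκ1 : κ ≤ 1) (hN : N ≤ 1 / 160000 * √(loglog lam)) {n : ℕ} (q : shell n) :
    1 / 160000 * symbolV n lam (1 - κ / 2) (2 * τ) q + N * omegaR q
      ≤ 1 / 4 * (omegaR q * fibreBound lam (1 - κ / 2) τ q) := by
  have hR := omegaR_nonneg q
  have hs := sqrt_loglog_sq lam
  have hs1 := h.large_one
  unfold symbolV fibreBound
  split_ifs with hg
  · have h1 := h.loglog_le_neg_log (omega_nonneg q) ((h.good_two_iff q).mp hg)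
    have h2 := h.loglog_large
    rw [abs_of_neg (by linarith)]
    set b := -Real.log (lam + omega q)
    have h3 : √(loglog lam) ≤ b ^ (1 - κ / 2) := by
      rw [Real.sqrt_eq_rpow]
      calc loglog lam ^ (1 / 2 : ℝ) ≤ b ^ (1 / 2 : ℝ) := by gcongr
        _ ≤ b ^ (1 - κ / 2) := Real.rpow_le_rpow_of_exponent_le (by linarith) (by linarith)
    have h4 : N ≤ 1 / 160000 * b ^ (1 - κ / 2) := by linarith
    nlinarith
  · have h4 : √(loglog lam) ≤ loglog lam ^ 2 := by
      have h5 := h.loglog_large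
      nlinarith
    nlinarith

/-- Passage from extended nonnegative integrals to real ones, when a multiple of the finite integral
of `r ≥ 0` was added to both sides of an inequality. -/
theorem mul_integral_le_of_lintegral_le {α : Type*} [MeasurableSpace α] {ν : Measure α}
    {v r : α → ℝ} (hv : Integrable v ν) (hr : Integrable r ν) (hr0 : ∀ x, 0 ≤ r x) {a N B : ℝ}
    (hN : 0 ≤ N) (hB : 0 ≤ B)
    (h : ∫⁻ x, ENNReal.ofReal (a * v x + N * r x) ∂ν
      ≤ ENNReal.ofReal B + ENNReal.ofReal N * ∫⁻ x, ENNReal.ofReal (r x) ∂ν) :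
    a * ∫ x, v x ∂ν ≤ B := by
  have hI : Integrable (fun x => a * v x + N * r x) ν := (hv.const_mul a).add (hr.const_mul N)
  have hr1 : 0 ≤ ∫ x, r x ∂ν := integral_nonneg hr0
  rw [← ofReal_integral_eq_lintegral_ofReal hr (Filter.Eventually.of_forall hr0),
    ← ENNReal.ofReal_mul hN, ← ENNReal.ofReal_add hB (mul_nonneg hN hr1)] at h
  -- the integrand may be negative: pass to its positive part
  have h1 : ENNReal.ofReal (∫ x, a * v x + N * r x ∂ν)
      ≤ ∫⁻ x, ENNReal.ofReal (a * v x + N * r x) ∂ν := by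
    refine (ENNReal.ofReal_le_ofReal (integral_mono hI hI.pos_part fun x =>
      le_max_left _ _)).trans ?_
    rw [ofReal_integral_eq_lintegral_ofReal hI.pos_part
      (Filter.Eventually.of_forall fun x => le_max_right _ _)]
    simp
  have h2 := h1.trans h
  rw [ENNReal.ofReal_le_ofReal_iff (add_nonneg hB (mul_nonneg hN hr1)),
    integral_add (hv.const_mul a) (hr.const_mul N), integral_const_mul, integral_const_mul] at h2
  linarith

/-- The lower bound on the quadratic form of the inverse of the upper multiplier. -/
theorem le_integral_creation {lam τ η κ : ℝ} (h : SmallParameters lam τ η)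
    (hκ : 0 ≤ κ) (hκ1 : κ ≤ 1) {n : ℕ} (hn : 1 ≤ n) (hn10 : (n : ℝ) ^ 10 ≤ √(loglog lam))
    (F : SymL2 n) :
    1 / 160000 * ∫ q, symbolV n lam (1 - κ / 2) (2 * τ) q * ‖(F : Lp ℂ 2 (mu n)) q‖ ^ 2 ∂mu n
      ≤ ∫ p, (upperSymbol (n + 1) lam κ τ p)⁻¹
        * ‖(creation n F : Lp ℂ 2 (mu (n + 1))) p‖ ^ 2 ∂mu (n + 1) := by
  have hlam := h.lam_pos
  set N : ℝ := (((n : ℝ) + 1) * n) ^ 2 * 768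
  have hN0 : 0 ≤ N := by positivity
  have hM0 (p : shell (n + 1)) : lam + omega p ≤ upperSymbol (n + 1) lam κ τ p :=
    le_upperSymbol lam κ τ p
  have hM1 (p : shell (n + 1)) : lam ≤ upperSymbol (n + 1) lam κ τ p := by
    linarith [hM0 p, omega_nonneg p]
  have hM := (isSymbol_upperSymbol (n + 1) hlam hκ τ).inv hlam hM1
  have hMi (p : shell (n + 1)) : 0 ≤ (upperSymbol (n + 1) lam κ τ p)⁻¹ :=
    inv_nonneg.mpr (hlam.le.trans (hM1 p))
  have hV := integrable_mul_norm_sq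
    (isSymbol_symbolV n hlam (κ := 1 - κ / 2) (by linarith) (2 * τ)).measurable
    (isSymbol_symbolV n hlam (κ := 1 - κ / 2) (by linarith) (2 * τ)).bounded F
  have hR := integrable_mul_norm_sq (continuous_omegaR n).measurable
    (bounded_of_continuous (continuous_omegaR n)) F
  have hW := integrable_mul_norm_sq hM.measurable hM.bounded (creation n F)
  have hW1 : 0 ≤ ∫ p, (upperSymbol (n + 1) lam κ τ p)⁻¹
        * ‖(creation n F : Lp ℂ 2 (mu (n + 1))) p‖ ^ 2 ∂mu (n + 1) :=
    integral_nonneg fun p => mul_nonneg (hMi p) (sq_nonneg _)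
  have h1 := le_lintegral_creation hlam F
    (W := fun p => ENNReal.ofReal (upperSymbol (n + 1) lam κ τ p)⁻¹)
    hM.measurable.ennreal_ofReal
    (fun p => ENNReal.ofReal_le_ofReal
      (inv_anti₀ (add_pos_of_pos_of_nonneg hlam (omega_nonneg p)) (hM0 p)))
    (measurable_fibreBound lam (1 - κ / 2) τ).ennreal_ofReal
    (h.fibreBound_le hκ hκ1)
  simp only [← ENNReal.ofReal_mul (hMi _), ← ENNReal.ofReal_mul (omegaR_nonneg _)] at h1
  rw [← ofReal_integral_eq_lintegral_ofReal hW
      (Filter.Eventually.of_forall fun p => mul_nonneg (hMi p) (sq_nonneg _)),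
    ← lintegral_const_mul' _ _ ENNReal.ofReal_ne_top] at h1
  refine mul_integral_le_of_lintegral_le hV hR
    (fun q => mul_nonneg (omegaR_nonneg q) (sq_nonneg _)) hN0 hW1 (le_trans ?_ h1)
  refine lintegral_mono fun q => ?_
  have h3 := h.fibreBound_nonneg (1 - κ / 2) q
  have h4 := omegaR_nonneg q
  have h5 := h.symbolV_add_le hκ1 (h.sq_mul_le hn hn10) q
  rw [← ENNReal.ofReal_mul h3, ← ENNReal.ofReal_mul h4, ← ENNReal.ofReal_mul (by norm_num)]
  refine ENNReal.ofReal_le_ofReal ?_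
  calc _ = (1 / 160000 * symbolV n lam (1 - κ / 2) (2 * τ) q + N * omegaR q)
        * ‖(F : Lp ℂ 2 (mu n)) q‖ ^ 2 := by ring
    _ ≤ 1 / 4 * (omegaR q * fibreBound lam (1 - κ / 2) τ q)
        * ‖(F : Lp ℂ 2 (mu n)) q‖ ^ 2 := mul_le_mul_of_nonneg_right h5 (sq_nonneg _)
    _ = _ := by ring

/-! ### Comparison of inverses -/

section Operators

variable {E H : Type*} [NormedAddCommGroup E] [InnerProductSpace ℂ E] [NormedAddCommGroup H]
  [InnerProductSpace ℂ H]

theorem re_inner_vadd (B : H →L[ℂ] H) (Ω : H →ₗ.[ℂ] H)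
    (x : ((B : H →ₗ[ℂ] H) +ᵥ Ω).domain) :
    (⟪(x : H), ((B : H →ₗ[ℂ] H) +ᵥ Ω) x⟫_ℂ).re
      = (⟪(x : H), B x⟫_ℂ).re + (⟪(x : H), Ω ⟨x, x.2⟩⟫_ℂ).re := by
  rw [LinearPMap.vadd_apply, inner_add_right, Complex.add_re]
  rfl

theorem re_inner_real_smul (c : ℝ) (x y : H) :
    (⟪x, (c : ℂ) • y⟫_ℂ).re = c * (⟪x, y⟫_ℂ).re := by
  rw [inner_smul_right, Complex.re_ofReal_mul]

/-- If `M = c⁻¹ K` and `K L x = x`, then `c L x` is a solution of `M y = x`. -/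
theorem apply_smul_eq_of_eq_smul {c : ℝ} (hc : c ≠ 0) {K L M : H →L[ℂ] H}
    (hM : ∀ x, M x = ((c⁻¹ : ℝ) : ℂ) • K x) {x : H} (h : K (L x) = x) :
    M (((c : ℂ) • L) x) = x := by
  rw [hM, smul_apply, map_smul, h, smul_smul, ← Complex.ofReal_mul,
    inv_mul_cancel₀ hc, Complex.ofReal_one, one_smul]

variable [CompleteSpace E] [CompleteSpace H]

theorem isSelfAdjoint_real_smul (c : ℝ) {T : H →L[ℂ] H}
    (hT : IsSelfAdjoint T) : IsSelfAdjoint ((c : ℂ) • T) :=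
  IsSelfAdjoint.smul (Complex.conj_ofReal c) hT

theorem re_inner_conj (A : E →L[ℂ] H) (R : H →L[ℂ] H) (F : E) :
    (⟪F, (A.adjoint ∘L R ∘L A) F⟫_ℂ).re = (⟪A F, R (A F)⟫_ℂ).re := by
  rw [ContinuousLinearMap.comp_apply, ContinuousLinearMap.adjoint_inner_right]
  rfl

/-- If `B + Ω` dominates an invertible positive operator `M`, then it is invertible and a bound on
`A* M⁻¹ A` passes to `A* (B + Ω)⁻¹ A`. -/
theorem exists_inverse_conj_le {Ω : H →ₗ.[ℂ] H} (hΩ : IsSelfAdjoint Ω) {B M N : H →L[ℂ] H}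
    (hB : IsSelfAdjoint B) (hM : IsSelfAdjoint M) {c : ℝ} (hc : 0 < c)
    (hMc : ∀ x, c * ‖x‖ ^ 2 ≤ (⟪x, M x⟫_ℂ).re)
    (hMΩ : ∀ x : Ω.domain,
      (⟪(x : H), M x⟫_ℂ).re ≤ (⟪(x : H), B x⟫_ℂ).re + (⟪(x : H), Ω x⟫_ℂ).re)
    (hMN : ∀ x, M (N x) = x) {A : E →L[ℂ] H} {T : E →L[ℂ] E} (hT : IsSelfAdjoint T)
    (h : ∀ F, (⟪A F, N (A F)⟫_ℂ).re ≤ (⟪F, T F⟫_ℂ).re) :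
    ∃ R : H →L[ℂ] H, ((∀ y, ∃ x : ((B : H →ₗ[ℂ] H) +ᵥ Ω).domain,
        (x : H) = R y ∧ ((B : H →ₗ[ℂ] H) +ᵥ Ω) x = y) ∧
      ∀ x : ((B : H →ₗ[ℂ] H) +ᵥ Ω).domain, R (((B : H →ₗ[ℂ] H) +ᵥ Ω) x) = x) ∧
      A.adjoint ∘L R ∘L A ≤ T := by
  have hD := isSelfAdjoint_vadd hB hΩ
  have hMD (x : ((B : H →ₗ[ℂ] H) +ᵥ Ω).domain) :
      (⟪(x : H), M x⟫_ℂ).re ≤ (⟪(x : H), ((B : H →ₗ[ℂ] H) +ᵥ Ω) x⟫_ℂ).re := by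
    rw [re_inner_vadd]
    exact hMΩ ⟨x, x.2⟩
  obtain ⟨R, hR⟩ := exists_boundedInverse hD hc fun x => (hMc x).trans (hMD x)
  refine ⟨R, hR, le_of_re_inner_le ((isSelfAdjoint_of_inverse hD hR.1).adjoint_conj A) hT
    fun F => ?_⟩
  rw [re_inner_conj]
  exact (re_inner_inverse_le hR.1 hM (fun x => (by positivity : 0 ≤ c * ‖x‖ ^ 2).trans (hMc x))
    hMD (hMN (A F))).trans (h F)

/-- If `B + Ω` is positive, invertible and dominated by an invertible operator `M`, then a lower
bound on `A* M⁻¹ A` passes to `A* (B + Ω)⁻¹ A`. -/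
theorem le_conj_inverse {Ω : H →ₗ.[ℂ] H} (hΩ : IsSelfAdjoint Ω) {B M N : H →L[ℂ] H}
    (hB : IsSelfAdjoint B)
    (hD0 : ∀ x : ((B : H →ₗ[ℂ] H) +ᵥ Ω).domain,
      0 ≤ (⟪(x : H), ((B : H →ₗ[ℂ] H) +ᵥ Ω) x⟫_ℂ).re)
    (hΩM : ∀ x : Ω.domain,
      (⟪(x : H), B x⟫_ℂ).re + (⟪(x : H), Ω x⟫_ℂ).re ≤ (⟪(x : H), M x⟫_ℂ).re)
    (hMN : ∀ x, M (N x) = x) {A : E →L[ℂ] H} {T : E →L[ℂ] E} (hT : IsSelfAdjoint T)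
    (h : ∀ F, (⟪F, T F⟫_ℂ).re ≤ (⟪A F, N (A F)⟫_ℂ).re) {R : H →L[ℂ] H}
    (hR : ∀ y, ∃ x : ((B : H →ₗ[ℂ] H) +ᵥ Ω).domain,
        (x : H) = R y ∧ ((B : H →ₗ[ℂ] H) +ᵥ Ω) x = y) :
    T ≤ A.adjoint ∘L R ∘L A := by
  have hD := isSelfAdjoint_vadd hB hΩ
  refine le_of_re_inner_le hT ((isSelfAdjoint_of_inverse hD hR).adjoint_conj A) fun F => ?_
  rw [re_inner_conj]
  refine (h F).trans (re_inner_le_inverse hD hR hD0 (fun x => ?_) (hMN (A F)))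
  rw [re_inner_vadd]
  exact hΩM ⟨x, x.2⟩

end Operators

/-! ### The bounds on `A₊* (λ - S + Ω)⁻¹ A₊` -/

theorem re_inner_mulOp_mono {n : ℕ} {φ ψ : shell n → ℝ} (hφ : IsSymbol φ) (hψ : IsSymbol ψ)
    (h : ∀ p, φ p ≤ ψ p) (F : SymL2 n) : (⟪F, mulOp φ F⟫_ℂ).re ≤ (⟪F, mulOp ψ F⟫_ℂ).re := by
  rw [inner_mulOp hφ, inner_mulOp hψ]
  exact integral_mono (integrable_mul_norm_sq hφ.measurable hφ.bounded F)
    (integrable_mul_norm_sq hψ.measurable hψ.bounded F)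
    fun p => mul_le_mul_of_nonneg_right (h p) (sq_nonneg _)

theorem re_inner_mulOp_add_smul {n : ℕ} {φ ψ : shell n → ℝ} (hφ : IsSymbol φ) (hψ : IsSymbol ψ)
    (c : ℝ) (F : SymL2 n) : (⟪F, mulOp (fun p => φ p + c * ψ p) F⟫_ℂ).re
      = (⟪F, mulOp φ F⟫_ℂ).re + c * (⟪F, mulOp ψ F⟫_ℂ).re := by
  rw [inner_mulOp hφ, inner_mulOp hψ, inner_mulOp (hφ.add (hψ.const_mul c)), ← integral_const_mul,
    ← integral_add (integrable_mul_norm_sq hφ.measurable hφ.bounded F)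
      ((integrable_mul_norm_sq hψ.measurable hψ.bounded F).const_mul c)]
  congr 1
  funext p
  ring

theorem mul_norm_sq_le_re_inner_mulOp {n : ℕ} {φ : shell n → ℝ} (hφ : IsSymbol φ) {c : ℝ}
    (h : ∀ p, c ≤ φ p) (F : SymL2 n) : c * ‖F‖ ^ 2 ≤ (⟪F, mulOp φ F⟫_ℂ).re := by
  have hs : IsSymbol (fun _ : shell n => c) :=
    ⟨measurable_const, ⟨|c|, fun _ => le_rfl⟩, fun _ _ => rfl⟩
  have h1 : mulOp (fun _ : shell n => c) F = (c : ℂ) • F := by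
    apply Subtype.ext
    apply Lp.ext
    filter_upwards [mulOp_coe hs F, Lp.coeFn_smul (c : ℂ) (F : Lp ℂ 2 (mu n))] with p h2 h3
    rw [h2, Submodule.coe_smul, h3, Pi.smul_apply, smul_eq_mul]
  have h2 := re_inner_mulOp_mono hs hφ h F
  rw [h1] at h2
  exact ((re_inner_real_smul c F F).trans
    (congrArg (c * ·) (inner_self_eq_norm_sq (𝕜 := ℂ) F))).symm.trans_le h2

theorem mulOp_const_mul {n : ℕ} {φ : shell n → ℝ} (hφ : IsSymbol φ) (c : ℝ) (F : SymL2 n) :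
    mulOp (fun p => c * φ p) F = (c : ℂ) • mulOp φ F := by
  apply Subtype.ext
  apply Lp.ext
  filter_upwards [mulOp_coe (hφ.const_mul c) F, mulOp_coe hφ F,
    Lp.coeFn_smul (c : ℂ) (mulOp φ F : Lp ℂ 2 (mu n))] with p h1 h2 h3
  rw [h1, Submodule.coe_smul, h3, Pi.smul_apply, h2, smul_eq_mul]
  push_cast
  ring

/-- The upper bound on `A₊* (λ - S + Ω)⁻¹ A₊`, with the existence of the inverse. -/
theorem exists_inverse_creation_le {lam τ η γ κ : ℝ}
    (h : SmallParameters lam τ η) (hγ0 : 0 < γ) (hγ : γ ≤ (loglog lam ^ 3)⁻¹)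
    (hκ : 0 ≤ κ) (hκ1 : κ ≤ 1) {n : ℕ} (hn : 1 ≤ n) (hn10 : (n : ℝ) ^ 10 ≤ √(loglog lam))
    {Ω : SymL2 (n + 1) →ₗ.[ℂ] SymL2 (n + 1)} (hΩ : IsSelfAdjoint Ω)
    (hV : BoundedBelowBy Ω ((γ : ℂ) • opV (n + 1) lam κ (2 * τ))) :
    ∃ R : SymL2 (n + 1) →L[ℂ] SymL2 (n + 1), IsBoundedInverse (shifted lam Ω) R ∧
      (creation n).adjoint ∘L R ∘L creation n
        ≤ ((γ⁻¹ * loglog lam ^ 2 : ℝ) : ℂ) • opU n lam (1 - κ / 2) τ := by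
  have hlam := h.lam_pos
  have hs := isSymbol_lam_add_omega (n + 1) lam
  have hm := isSymbol_lowerSymbol (n + 1) hlam hκ τ γ
  have hmlam := h.lam_le_lowerSymbol (n := n + 1) hγ0 hγ (κ := κ)
  have hmi := hm.inv hlam hmlam
  have hU := isSymbol_symbolU n hlam (κ := 1 - κ / 2) (by linarith) τ
  refine exists_inverse_conj_le hΩ (isSelfAdjoint_mulOp hs) (isSelfAdjoint_mulOp hm) hlam
    (mul_norm_sq_le_re_inner_mulOp hm hmlam) (fun x => ?_)
    (mulOp_mulOp_inv hm hmi fun p => (hlam.trans_le (hmlam p)).ne')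
    (isSelfAdjoint_real_smul _ (isSelfAdjoint_mulOp hU)) (fun F => ?_)
  · have h1 := (re_inner_real_smul γ (x : SymL2 (n + 1)) _).symm.trans_le (hV x)
    have h2 := re_inner_mulOp_add_smul hs (isSymbol_symbolV (n + 1) hlam hκ (2 * τ)) γ
      (x : SymL2 (n + 1))
    exact h2.trans_le (add_le_add_right h1 _)
  · have h1 := integral_creation_le h hγ0 hγ hκ hκ1 hn hn10 F
    rw [← inner_mulOp hmi (creation n F), ← inner_mulOp hU F] at h1
    exact h1.trans_eq (re_inner_real_smul _ F _).symm

/-- The inequality of `le_integral_creation` with an unspecified constant, which does not depend on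
any of the parameters. -/
theorem exists_le_integral_creation : ∃ C : ℝ, 0 < C ∧ ∀ {lam τ η κ : ℝ},
    SmallParameters lam τ η → 0 ≤ κ → κ ≤ 1 → ∀ {n : ℕ}, 1 ≤ n → (n : ℝ) ^ 10 ≤ √(loglog lam) →
    ∀ F : SymL2 n, C * ∫ q, symbolV n lam (1 - κ / 2) (2 * τ) q
        * ‖(F : Lp ℂ 2 (mu n)) q‖ ^ 2 ∂mu n
      ≤ ∫ p, (upperSymbol (n + 1) lam κ τ p)⁻¹
        * ‖(creation n F : Lp ℂ 2 (mu (n + 1))) p‖ ^ 2 ∂mu (n + 1) :=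
  ⟨1 / 160000, by norm_num, fun h hκ hκ1 _ hn hn10 F => le_integral_creation h hκ hκ1 hn hn10 F⟩

/-- The lower bound on `A₊* (λ - S + Ω)⁻¹ A₊`, from the bound on the quadratic form of the inverse
of the upper multiplier. -/
theorem le_creation_inverse {lam τ η γ κ C : ℝ}
    (h : SmallParameters lam τ η) (hγ0 : 0 < γ) (hγ : γ ≤ (loglog lam ^ 3)⁻¹)
    (hκ : 0 ≤ κ) (hκ1 : κ ≤ 1) {n : ℕ}
    (hC : ∀ F : SymL2 n, C * ∫ q, symbolV n lam (1 - κ / 2) (2 * τ) q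
        * ‖(F : Lp ℂ 2 (mu n)) q‖ ^ 2 ∂mu n
      ≤ ∫ p, (upperSymbol (n + 1) lam κ τ p)⁻¹
        * ‖(creation n F : Lp ℂ 2 (mu (n + 1))) p‖ ^ 2 ∂mu (n + 1))
    {Ω : SymL2 (n + 1) →ₗ.[ℂ] SymL2 (n + 1)} (hΩ : IsSelfAdjoint Ω)
    (hU : BoundedAboveBy Ω (((γ⁻¹ : ℝ) : ℂ) • opU (n + 1) lam κ τ))
    (h0 : BoundedBelowBy (shifted lam Ω) 0)
    {R : SymL2 (n + 1) →L[ℂ] SymL2 (n + 1)} (hR : IsBoundedInverse (shifted lam Ω) R) :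
    ((C * γ : ℝ) : ℂ) • opV n lam (1 - κ / 2) (2 * τ)
      ≤ (creation n).adjoint ∘L R ∘L creation n := by
  have hlam := h.lam_pos
  have hs := isSymbol_lam_add_omega (n + 1) lam
  have hsu := isSymbol_symbolU (n + 1) hlam hκ τ
  have hu := isSymbol_upperSymbol (n + 1) hlam hκ τ
  have hulam (p : shell (n + 1)) : lam ≤ upperSymbol (n + 1) lam κ τ p := by
    linarith [le_upperSymbol lam κ τ p, omega_nonneg p]
  have hui := hu.inv hlam hulam
  have hV := isSymbol_symbolV n hlam (κ := 1 - κ / 2) (by linarith) (2 * τ)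
  have hγi : 1 ≤ γ⁻¹ := (one_le_inv₀ hγ0).mpr (h.gamma_le_one hγ)
  refine le_conj_inverse (M := mulOp fun p => γ⁻¹ * upperSymbol (n + 1) lam κ τ p)
    (N := (γ : ℂ) • mulOp fun p => (upperSymbol (n + 1) lam κ τ p)⁻¹) hΩ
    (isSelfAdjoint_mulOp hs) (fun x => ?_) (fun x => ?_) (fun F => ?_)
    (isSelfAdjoint_real_smul _ (isSelfAdjoint_mulOp hV)) (fun F => ?_) hR.1
  · have h1 := h0 x
    rw [zero_apply, inner_zero_right] at h1
    exact h1
  · have h1 := (hU x).trans_eq (re_inner_real_smul γ⁻¹ (x : SymL2 (n + 1)) _)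
    have h2 := re_inner_mulOp_add_smul hs hsu γ⁻¹ (x : SymL2 (n + 1))
    refine ((add_le_add_right h1 _).trans_eq h2.symm).trans
      (re_inner_mulOp_mono (hs.add (hsu.const_mul γ⁻¹)) (hu.const_mul γ⁻¹) (fun p => ?_) _)
    have h3 : 0 ≤ lam + omega p := add_nonneg hlam.le (omega_nonneg p)
    rw [upperSymbol, mul_add]
    exact add_le_add_left (le_mul_of_one_le_left h3 hγi) _
  · have h1 : mulOp (upperSymbol (n + 1) lam κ τ)
        (mulOp (fun p => (upperSymbol (n + 1) lam κ τ p)⁻¹) F) = F :=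
      mulOp_mulOp_inv hu hui (fun p => (hlam.trans_le (hulam p)).ne') F
    exact apply_smul_eq_of_eq_smul hγ0.ne' (mulOp_const_mul hu γ⁻¹) h1
  · have h1 := ((congrArg (C * ·) (inner_mulOp hV F)).trans_le (hC F)).trans_eq
      (inner_mulOp hui (creation n F)).symm
    have h2 := re_inner_real_smul (C * γ) F (mulOp (symbolV n lam (1 - κ / 2) (2 * τ)) F)
    have h3 := re_inner_real_smul γ (creation n F)
      (mulOp (fun p => (upperSymbol (n + 1) lam κ τ p)⁻¹) (creation n F))
    have h4 := mul_le_mul_of_nonneg_left h1 hγ0.le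
    have h5 : C * γ * (⟪F, mulOp (symbolV n lam (1 - κ / 2) (2 * τ)) F⟫_ℂ).re
        = γ * (C * (⟪F, mulOp (symbolV n lam (1 - κ / 2) (2 * τ)) F⟫_ℂ).re) := by ring
    exact ((h2.trans h5).trans_le h4).trans_eq h3.symm

end

end ASEP

theorem theorem3 (τ : ℝ) (hτ : 1 < τ) :
    ∃ C : ℝ, 0 < C ∧ ∃ lam₀ : ℝ, 0 < lam₀ ∧ ∀ lam : ℝ, 0 < lam → lam < lam₀ →
      ∀ κ : ℝ, 0 ≤ κ → κ ≤ 1 →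
      ∀ n : ℕ, 1 ≤ n → (n : ℝ) ^ 10 ≤ ASEP.loglog lam ^ (1 / 2 : ℝ) →
      ∀ γ : ℝ, 0 < γ → γ ≤ (ASEP.loglog lam ^ 3)⁻¹ →
      ∀ Ω : ASEP.SymL2 (n + 1) →ₗ.[ℂ] ASEP.SymL2 (n + 1), IsSelfAdjoint Ω →
        (ASEP.BoundedBelowBy Ω ((γ : ℂ) • ASEP.opV (n + 1) lam κ (2 * τ)) →
          ∃ R : ASEP.SymL2 (n + 1) →L[ℂ] ASEP.SymL2 (n + 1),
            ASEP.IsBoundedInverse (ASEP.shifted lam Ω) R ∧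
            (ASEP.creation n).adjoint ∘L R ∘L ASEP.creation n
              ≤ ((γ⁻¹ * ASEP.loglog lam ^ 2 : ℝ) : ℂ) • ASEP.opU n lam (1 - κ / 2) τ) ∧
        (ASEP.BoundedAboveBy Ω (((γ⁻¹ : ℝ) : ℂ) • ASEP.opU (n + 1) lam κ τ) →
          ASEP.BoundedBelowBy (ASEP.shifted lam Ω) 0 →
          ∀ R : ASEP.SymL2 (n + 1) →L[ℂ] ASEP.SymL2 (n + 1),
            ASEP.IsBoundedInverse (ASEP.shifted lam Ω) R →
            ((C * γ : ℝ) : ℂ) • ASEP.opV n lam (1 - κ / 2) (2 * τ)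
              ≤ (ASEP.creation n).adjoint ∘L R ∘L ASEP.creation n) := by
  refine ASEP.exists_le_integral_creation.elim fun C hC =>
    (ASEP.exists_smallParameters hτ).elim fun lam₀ hsmall => ?_
  refine ⟨C, hC.1, lam₀, hsmall.1, fun lam hlam hlt κ hκ hκ1 n hn hn10 γ hγ0 hγ Ω hΩ => ?_⟩
  refine (hsmall.2 lam hlam hlt).elim fun η h => ?_
  have hn10' : (n : ℝ) ^ 10 ≤ √(ASEP.loglog lam) := by
    rwa [Real.sqrt_eq_rpow]
  exact ⟨fun hV => ASEP.exists_inverse_creation_le h hγ0 hγ hκ hκ1 hn hn10' hΩ hV,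
    fun hU h0 R hR => ASEP.le_creation_inverse h hγ0 hγ hκ hκ1
      (hC.2 h hκ hκ1 hn hn10') hΩ hU h0 hR⟩
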